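/- **Setting.** Let $d,d'\in\mathbb N$, $\Sigma\in GL_{d'}(\mathbb R)$, $V\in C^\infty(\mathbb R^d,\mathbb R)$, and write $X=(x,v)\in\mathbb R^{d}\times\mathbb R^{d'}$, $f(x,v)=V(x)+|\Sigma v|^2$. For $h\in(0,h_0]$ let $\alpha=\alpha(\cdot,h):\mathbb R^{d+d'}\to\mathbb R^d$ and $\beta=\beta(\cdot,h):\mathbb R^{d+d'}\to\mathbb R^{d'}$ be smooth, with classical expansions $\alpha\sim\sum_{j\ge0}h^j\alpha^j$, $\beta\sim\sum_{j\ge0}h^j\beta^j$ in $C^\infty$ (for all $N$, all derivatives of the remainder of order $N$ are $O(h^N)$ locally uniformly), such that for all $h\in(0,h_0]$ $$\alpha\cdot\partial_xV+2\beta\cdot\Sigma^T\Sigma v-\tfrac h2(\operatorname{div}_x\alpha+\operatorname{div}_v\beta)=0 .$$ Let $P=X_h+N_h$ with $$X_h=\alpha\cdot h\partial_x+\beta\cdot h\partial_v+\tfrac h2(\operatorname{div}_x\alpha+\operatorname{div}_v\beta),\qquad N_h=-h^2\Delta_v+4|\Sigma^T\Sigma v|^2-2h\operatorname{Tr}(\Sigma^T\Sigma).$$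 Let $\mathbf s\in\mathbb R^d$ be a saddle point of $V$, i.e. a nondegenerate critical point of index $1$; we also write $\mathbf s$ for the point $(\mathbf s,0)$ of $\mathbb R^{d+d'}$. **Claim.** In each of the three situations below there are an open neighbourhood $\mathcal W=\mathcal W_x\times\mathcal W_v$ of $\mathbf s$, an $h_1>0$, and functions $\ell=\ell(\cdot,h)\in C^\infty(\mathcal W)$, $0<h\le h_1$, with a classical expansion $\ell\sim\sum_{j\ge0}h^j\ell_j$ in $C^\infty(\mathcal W)$, $\ell_j\in C^\infty(\mathcal W)$, $\ell_0(\mathbf s)=0$, such that: * (i) The eikonal equation and, for all $j\ge1$, the transport equations are solved to infinite order at $\mathbf s$: $$\alpha^0\cdot\partial_x\ell_0+\beta^0\cdot\partial_v\ell_0+4\Sigma^T\Sigma v\cdot\partial_v\ell_0+\ell_0|\partial_v\ell_0|^2=O((X-\mathbf s)^\infty),$$ $$\big(\alpha^0\cdot\partial_x+(\beta^0+4\Sigma^T\Sigma v+2\ell_0\partial_v\ell_0)\cdot\partial_v+|\partial_v\ell_0|^2\big)\ell_j+R_j=O((X-\mathbf s)^\infty),$$ where $$R_j=\sum_{k<j}\big(\alpha^{j-k}\cdot\partial_x\ell_k+\beta^{j-k}\cdot\partial_v\ell_k\big)+\sum_{\substack{p+q+r=j\\p,q,r<j}}\ell_p\,\partial_v\ell_q\cdot\partial_v\ell_r-\Delta_v\ell_{j-1}.$$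 For every smooth even function $\zeta$ on $\mathbb R$, equal to $1$ on $[-1,1]$ and supported in $[-2,2]$, and every $\tau>0$, the function $\chi(X)=\int_0^{\ell(X,h)}\zeta(t/\tau)e^{-t^2/(2h)}\,dt$ satisfies $$P(\chi e^{-f/h})=h\,O\big((X-\mathbf s)^\infty+h^\infty\big)\,e^{-(f+\ell^2/2)/h},$$ that is, for every $N$ there is $C$ such that $|P(\chi e^{-f/h})|\le C\,h\,(|X-\mathbf s|^N+h^N)e^{-(f+\ell^2/2)/h}$ for $X\in\mathcal W$, $0<h\le h_1$. Moreover $\eta(\mathbf s):=\nabla\ell_0(\mathbf s)\ne0$. * (ii) Either $\partial_v\ell_0(\mathbf s)\neq0$, or there is a nonzero, $h$-independent, positive semidefinite matrix $A$ such that $|\partial_v\ell_0|^2=4\langle A\nabla f,\nabla f\rangle(1+O(X-\mathbf s))$ on $\mathcal W$ and $\langle A\nabla f,\nabla f\rangle$ is not identically $0$ near $\mathbf s$. * (iii) $\det\operatorname{Hess}_{\mathbf s}\big(f+\tfrac{\ell_0^2}2\big)=-\det\operatorname{Hess}_{\mathbf s}f$. * (iv) For all $X\in\mathcal W\setminus\{\mathbf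 s\}$ with $X-\mathbf s\in\eta(\mathbf s)^\perp$, one has $f(X)>f(\mathbf s)$. **Situation 1 (partially degenerate $\alpha,\beta$).** For some $M\in\mathcal M_{d,d'}(\mathbb R)$ and $M_\beta\in\mathcal M_{d',d}(\mathbb R)$, as $X\to\mathbf s$, $\alpha^0(X)=Mv+o(X-\mathbf s)$ and $\beta^0(X)=M_\beta(x-\mathbf s)+o(X-\mathbf s)$; and, with $H=\operatorname{Hess}_{\mathbf s}V$, the matrix $$\Lambda=\begin{pmatrix}0&-\frac12HM(\Sigma^T\Sigma)^{-1}\\M^T&4\Sigma^T\Sigma\end{pmatrix}$$ has, for some $\mu>0$, the algebraically simple eigenvalue $-\mu$, all its other complex eigenvalues having nonnegative real part. **Situation 2 ($\alpha,\beta$ with no linear part).** $d=d'=1$, $\Sigma=\frac12$, $\alpha=v^2-h$, $\beta=-2v\,\partial_xV(x)$. **Situation 3 (added magnetic field).** $d=d'=3$, $\alpha=4\Sigma^T\Sigma v$, $\beta=-2\partial_xV+b(x)\wedge\Sigma^T\Sigma v$, with $b\in C^\infty(\mathbb R^3,\mathbb R^3)$. -/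

import Mathlib

open scoped ContDiff

noncomputable section

namespace KFP

/-- The phase space of the variables `X = (x, v)`, `x ∈ ℝ^d`, `v ∈ ℝ^d'`, with the Euclidean norm:
`X (Sum.inl i)` is `x_i` and `X (Sum.inr j)` is `v_j`. -/
abbrev Phase (d d' : ℕ) : Type := EuclideanSpace ℝ (Fin d ⊕ Fin d')

/-- The position component `x` of `X = (x, v)`. -/
def xPart {d d' : ℕ} (X : Phase d d') : EuclideanSpace ℝ (Fin d) :=
  WithLp.toLp 2 fun i => X (Sum.inl i)

/-- The velocity component `v` of `X = (x, v)`. -/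
def vPart {d d' : ℕ} (X : Phase d d') : EuclideanSpace ℝ (Fin d') :=
  WithLp.toLp 2 fun j => X (Sum.inr j)

/-- The point `(x, 0)` of the phase space. -/
def atRest {d : ℕ} (d' : ℕ) (x : EuclideanSpace ℝ (Fin d)) : Phase d d' :=
  WithLp.toLp 2 (Sum.elim (fun i => x i) (fun _ => 0))

/-- The partial derivative `∂_i u (X)`. -/
def pd {ι : Type} [Fintype ι] [DecidableEq ι] (i : ι) (u : EuclideanSpace ℝ ι → ℝ)
    (X : EuclideanSpace ℝ ι) : ℝ :=
  fderiv ℝ u X (EuclideanSpace.single i 1)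

/-- The Hessian matrix of `u` at `X`. -/
def hess {ι : Type} [Fintype ι] [DecidableEq ι] (u : EuclideanSpace ℝ ι → ℝ)
    (X : EuclideanSpace ℝ ι) : Matrix ι ι ℝ :=
  Matrix.of fun i j => pd i (pd j u) X

/-- `s` is a nondegenerate critical point of index `1` of `V`: the Hessian is invertible and has
exactly one negative eigenvalue, counted with multiplicity. -/
def IsSaddle {d : ℕ} (V : EuclideanSpace ℝ (Fin d) → ℝ) (s : EuclideanSpace ℝ (Fin d)) : Prop :=
  (∀ i, pd i V s = 0) ∧ (hess V s).det ≠ 0 ∧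
    ((hess V s).charpoly.roots.filter fun r => r < 0).card = 1

/-- `a · ∂_x u` at `X`. -/
def dotDx {d d' : ℕ} (a : EuclideanSpace ℝ (Fin d)) (u : Phase d d' → ℝ) (X : Phase d d') : ℝ :=
  ∑ i, a i * pd (Sum.inl i) u X

/-- `b · ∂_v u` at `X`. -/
def dotDv {d d' : ℕ} (b : EuclideanSpace ℝ (Fin d')) (u : Phase d d' → ℝ) (X : Phase d d') : ℝ :=
  ∑ j, b j * pd (Sum.inr j) u X

/-- `∂_v u · ∂_v w` at `X`. -/
def gradVDot {d d' : ℕ} (u w : Phase d d' → ℝ) (X : Phase d d') : ℝ :=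
  ∑ j, pd (Sum.inr j) u X * pd (Sum.inr j) w X

/-- The Laplacian `Δ_v u` in the velocity variables. -/
def lapV {d d' : ℕ} (u : Phase d d' → ℝ) (X : Phase d d') : ℝ :=
  ∑ j, pd (Sum.inr j) (pd (Sum.inr j) u) X

/-- The divergence `div_x a + div_v b` at `X`. -/
def divXV {d d' : ℕ} (a : Phase d d' → EuclideanSpace ℝ (Fin d))
    (b : Phase d d' → EuclideanSpace ℝ (Fin d')) (X : Phase d d') : ℝ :=
  (∑ i, pd (Sum.inl i) (fun Y => a Y i) X) + ∑ j, pd (Sum.inr j) (fun Y => b Y j) X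

/-- The vector `ΣᵀΣ v`. -/
def frictionVec {d d' : ℕ} (Sg : Matrix (Fin d') (Fin d') ℝ) (X : Phase d d') :
    EuclideanSpace ℝ (Fin d') :=
  WithLp.toLp 2 ((Sg.transpose * Sg).mulVec (fun j => X (Sum.inr j)))

/-- `f(x, v) = V(x) + |Σ v|²`. -/
def energy {d d' : ℕ} (Sg : Matrix (Fin d') (Fin d') ℝ) (V : EuclideanSpace ℝ (Fin d) → ℝ)
    (X : Phase d d') : ℝ :=
  V (xPart X) + ∑ i, (Sg.mulVec (fun j => X (Sum.inr j)) i) ^ 2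

/-- The algebraic relation `α · ∂_x V + 2 β · ΣᵀΣ v - (h/2) (div_x α + div_v β) = 0`, for a fixed
value of `h`. -/
def SkewRelation {d d' : ℕ} (Sg : Matrix (Fin d') (Fin d') ℝ) (V : EuclideanSpace ℝ (Fin d) → ℝ)
    (h : ℝ) (a : Phase d d' → EuclideanSpace ℝ (Fin d))
    (b : Phase d d' → EuclideanSpace ℝ (Fin d')) : Prop :=
  ∀ X : Phase d d',
    (∑ i, a X i * pd i V (xPart X)) + 2 * (∑ j, b X j * frictionVec Sg X j)
      - h / 2 * divXV a b X = 0

/-- The operator `P = X + N`, with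
`X = α · h∂_x + β · h∂_v + (h/2) (div_x α + div_v β)` and
`N = -h² Δ_v + 4 |ΣᵀΣ v|² - 2 h Tr(ΣᵀΣ)`, for a fixed value of `h`. -/
def kineticOp {d d' : ℕ} (Sg : Matrix (Fin d') (Fin d') ℝ) (h : ℝ)
    (a : Phase d d' → EuclideanSpace ℝ (Fin d)) (b : Phase d d' → EuclideanSpace ℝ (Fin d'))
    (u : Phase d d' → ℝ) (X : Phase d d') : ℝ :=
  (h * dotDx (a X) u X + h * dotDv (b X) u X + h / 2 * divXV a b X * u X)
    + (-h ^ 2 * lapV u X + 4 * (∑ j, (frictionVec Sg X j) ^ 2) * u X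
      - 2 * h * (Sg.transpose * Sg).trace * u X)

/-- The family `a h`, `0 < h ≤ h₀`, of smooth functions on the open set `U` has the classical
expansion `a ∼ ∑_j h^j c_j`, with smooth `c_j`, in `C^∞(U)`: all the derivatives of the remainder
of order `N` are `O(h^N)`, uniformly on the compact subsets of `U`. -/
def HasClassicalExpansion {E F : Type} [NormedAddCommGroup E] [NormedSpace ℝ E]
    [NormedAddCommGroup F] [NormedSpace ℝ F] (U : Set E) (h₀ : ℝ) (a : ℝ → E → F)
    (c : ℕ → E → F) : Prop :=
  (∀ h ∈ Set.Ioc 0 h₀, ContDiffOn ℝ ∞ (a h) U) ∧ (∀ j, ContDiffOn ℝ ∞ (c j) U) ∧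
    ∀ K : Set E, K ⊆ U → IsCompact K → ∀ N k : ℕ, ∃ C : ℝ, ∀ h ∈ Set.Ioc 0 h₀, ∀ X ∈ K,
      ‖iteratedFDeriv ℝ k (fun Y => a h Y - ∑ j ∈ Finset.range N, h ^ j • c j Y) X‖ ≤ C * h ^ N

/-- `u = O((X - s)^∞)` on `W`. -/
def FlatAt {d d' : ℕ} (W : Set (Phase d d')) (s : Phase d d') (u : Phase d d' → ℝ) : Prop :=
  ∀ N : ℕ, ∃ C : ℝ, ∀ X ∈ W, |u X| ≤ C * ‖X - s‖ ^ N

/-- The left-hand side of the eikonal equation,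
`α⁰ · ∂_x ℓ₀ + β⁰ · ∂_v ℓ₀ + 4 ΣᵀΣ v · ∂_v ℓ₀ + ℓ₀ |∂_v ℓ₀|²`. -/
def eikonal {d d' : ℕ} (Sg : Matrix (Fin d') (Fin d') ℝ)
    (αc : ℕ → Phase d d' → EuclideanSpace ℝ (Fin d))
    (βc : ℕ → Phase d d' → EuclideanSpace ℝ (Fin d'))
    (ℓc : ℕ → Phase d d' → ℝ) (X : Phase d d') : ℝ :=
  dotDx (αc 0 X) (ℓc 0) X + dotDv (βc 0 X) (ℓc 0) X + 4 * dotDv (frictionVec Sg X) (ℓc 0) X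
    + ℓc 0 X * gradVDot (ℓc 0) (ℓc 0) X

/-- The term `R_j` (`j ≥ 1`) of the `j`-th transport equation: the contribution of the `ℓ_k`, `k < j`,
to the coefficient of `h^j` in
`w = α · ∂_x ℓ + β · ∂_v ℓ + 4 ΣᵀΣ v · ∂_v ℓ + ℓ |∂_v ℓ|² - h Δ_v ℓ`. -/
def transportRem {d d' : ℕ}
    (αc : ℕ → Phase d d' → EuclideanSpace ℝ (Fin d))
    (βc : ℕ → Phase d d' → EuclideanSpace ℝ (Fin d'))
    (ℓc : ℕ → Phase d d' → ℝ) (j : ℕ) (X : Phase d d') : ℝ :=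
  (∑ k ∈ Finset.range j, (dotDx (αc (j - k) X) (ℓc k) X + dotDv (βc (j - k) X) (ℓc k) X))
    + (∑ p ∈ Finset.range j, ∑ q ∈ Finset.range j, ∑ r ∈ Finset.range j,
        if p + q + r = j then ℓc p X * gradVDot (ℓc q) (ℓc r) X else 0)
    - lapV (ℓc (j - 1)) X

/-- The left-hand side of the `j`-th transport equation (`j ≥ 1`),
`(α⁰ · ∂_x + (β⁰ + 4 ΣᵀΣ v + 2 ℓ₀ ∂_v ℓ₀) · ∂_v + |∂_v ℓ₀|²) ℓ_j + R_j`. -/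
def transport {d d' : ℕ} (Sg : Matrix (Fin d') (Fin d') ℝ)
    (αc : ℕ → Phase d d' → EuclideanSpace ℝ (Fin d))
    (βc : ℕ → Phase d d' → EuclideanSpace ℝ (Fin d'))
    (ℓc : ℕ → Phase d d' → ℝ) (j : ℕ) (X : Phase d d') : ℝ :=
  dotDx (αc 0 X) (ℓc j) X + dotDv (βc 0 X) (ℓc j) X + 4 * dotDv (frictionVec Sg X) (ℓc j) X
    + 2 * ℓc 0 X * gradVDot (ℓc 0) (ℓc j) X + gradVDot (ℓc 0) (ℓc 0) X * ℓc j X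
    + transportRem αc βc ℓc j X

/-- A smooth even function on `ℝ`, equal to `1` on `[-1, 1]` and supported in `[-2, 2]`. -/
def IsCutoff (ζ : ℝ → ℝ) : Prop :=
  ContDiff ℝ ∞ ζ ∧ (∀ t, ζ (-t) = ζ t) ∧ (∀ t ∈ Set.Icc (-1 : ℝ) 1, ζ t = 1) ∧
    tsupport ζ ⊆ Set.Icc (-2) 2

/-- `χ(X) = ∫_0^{ℓ(X)} ζ(t/τ) e^{-t²/(2h)} dt`. -/
def chi {d d' : ℕ} (ζ : ℝ → ℝ) (τ h : ℝ) (ℓ : Phase d d' → ℝ) (X : Phase d d') : ℝ :=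
  ∫ t in (0 : ℝ)..ℓ X, ζ (t / τ) * Real.exp (-t ^ 2 / (2 * h))

/-- The quadratic form `⟨A ∇u, ∇u⟩` at `X`. -/
def gradForm {d d' : ℕ} (A : Matrix (Fin d ⊕ Fin d') (Fin d ⊕ Fin d') ℝ) (u : Phase d d' → ℝ)
    (X : Phase d d') : ℝ :=
  ∑ i, ∑ j, A i j * pd j u X * pd i u X

/-- The conclusion at the saddle point `s` of `V`, for the operator `P` with coefficients
`α ∼ ∑_j h^j αc_j` and `β ∼ ∑_j h^j βc_j`: existence of a function `ℓ ∼ ∑_j h^j ℓc_j` on a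
neighbourhood `W = Wx × Wv` of `(s, 0)` with the properties listed below. -/
def WKBConclusion {d d' : ℕ} (Sg : Matrix (Fin d') (Fin d') ℝ)
    (V : EuclideanSpace ℝ (Fin d) → ℝ)
    (α : ℝ → Phase d d' → EuclideanSpace ℝ (Fin d))
    (β : ℝ → Phase d d' → EuclideanSpace ℝ (Fin d'))
    (αc : ℕ → Phase d d' → EuclideanSpace ℝ (Fin d))
    (βc : ℕ → Phase d d' → EuclideanSpace ℝ (Fin d'))
    (s : EuclideanSpace ℝ (Fin d)) : Prop :=
  ∃ (Wx : Set (EuclideanSpace ℝ (Fin d))) (Wv : Set (EuclideanSpace ℝ (Fin d')))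
    (W : Set (Phase d d')) (h₁ : ℝ) (ℓ : ℝ → Phase d d' → ℝ) (ℓc : ℕ → Phase d d' → ℝ),
    IsOpen Wx ∧ IsOpen Wv ∧ s ∈ Wx ∧ (0 : EuclideanSpace ℝ (Fin d')) ∈ Wv ∧
    W = {X | xPart X ∈ Wx ∧ vPart X ∈ Wv} ∧ 0 < h₁ ∧
    -- `ℓ` is smooth with a classical expansion, and `ℓ₀` vanishes at the saddle point
    HasClassicalExpansion W h₁ ℓ ℓc ∧ ℓc 0 (atRest d' s) = 0 ∧
    -- the eikonal and transport equations are solved to infinite order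
    FlatAt W (atRest d' s) (eikonal Sg αc βc ℓc) ∧
    (∀ j : ℕ, 1 ≤ j → FlatAt W (atRest d' s) (transport Sg αc βc ℓc j)) ∧
    -- `P (χ e^{-f/h}) = h O(X^∞ + h^∞) e^{-(f + ℓ²/2)/h}`
    (∀ ζ : ℝ → ℝ, IsCutoff ζ → ∀ τ : ℝ, 0 < τ → ∀ N : ℕ, ∃ C : ℝ, ∀ h ∈ Set.Ioc 0 h₁, ∀ X ∈ W,
      |kineticOp Sg h (α h) (β h)
          (fun Y => chi ζ τ h (ℓ h) Y * Real.exp (-energy Sg V Y / h)) X|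
        ≤ h * (C * (‖X - atRest d' s‖ ^ N + h ^ N))
          * Real.exp (-(energy Sg V X + ℓ h X ^ 2 / 2) / h)) ∧
    -- `η = ∇ℓ₀(s) ≠ 0`
    gradient (ℓc 0) (atRest d' s) ≠ 0 ∧
    -- `∂_v ℓ₀(s) ≠ 0`, or `|∂_v ℓ₀|² = 4 ⟨A ∇f, ∇f⟩ (1 + O(X - s))`
    (gradVDot (ℓc 0) (ℓc 0) (atRest d' s) ≠ 0 ∨
      ∃ A : Matrix (Fin d ⊕ Fin d') (Fin d ⊕ Fin d') ℝ, A ≠ 0 ∧ A.PosSemidef ∧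
        (∃ ρ : Phase d d' → ℝ, (∃ C : ℝ, ∀ X ∈ W, |ρ X| ≤ C * ‖X - atRest d' s‖) ∧
          ∀ X ∈ W, gradVDot (ℓc 0) (ℓc 0) X = 4 * gradForm A (energy Sg V) X * (1 + ρ X)) ∧
        ¬ ∀ᶠ X in nhds (atRest d' s), gradForm A (energy Sg V) X = 0) ∧
    -- `det Hess_s (f + ℓ₀²/2) = - det Hess_s f`
    (hess (fun Y => energy Sg V Y + ℓc 0 Y ^ 2 / 2) (atRest d' s)).det
      = -(hess (energy Sg V) (atRest d' s)).det ∧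
    -- `f > f(s)` on `s + η^⊥`, away from `s`
    ∀ X ∈ W, X ≠ atRest d' s → inner ℝ (gradient (ℓc 0) (atRest d' s)) (X - atRest d' s) = 0 →
      energy Sg V (atRest d' s) < energy Sg V X

/-- The matrix `Λ = [[0, -½ H M (ΣᵀΣ)⁻¹], [Mᵀ, 4 ΣᵀΣ]]`. -/
def Lam {d d' : ℕ} (Sg : Matrix (Fin d') (Fin d') ℝ) (H : Matrix (Fin d) (Fin d) ℝ)
    (M : Matrix (Fin d) (Fin d') ℝ) : Matrix (Fin d ⊕ Fin d') (Fin d ⊕ Fin d') ℝ :=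
  Matrix.fromBlocks 0 (-(1 / 2 : ℝ) • (H * M * (Sg.transpose * Sg)⁻¹))
    M.transpose ((4 : ℝ) • (Sg.transpose * Sg))

/-- For some `μ > 0`, `-μ` is an (algebraically) simple eigenvalue of `L`, and every other complex
eigenvalue of `L` has nonnegative real part. -/
def IsSimpleSpectrum {ι : Type} [Fintype ι] [DecidableEq ι] (L : Matrix ι ι ℝ) : Prop :=
  ∃ μ : ℝ, 0 < μ ∧
    (L.map (algebraMap ℝ ℂ)).charpoly.rootMultiplicity (-(μ : ℂ)) = 1 ∧
    ∀ z ∈ spectrum ℂ (L.map (algebraMap ℝ ℂ)), z = -(μ : ℂ) ∨ 0 ≤ z.re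

/-- `α = v² - h` in dimension `d = d' = 1`. -/
def alphaQuad (h : ℝ) (X : Phase 1 1) : EuclideanSpace ℝ (Fin 1) :=
  WithLp.toLp 2 fun _ => X (Sum.inr 0) ^ 2 - h

/-- The coefficients `α⁰ = v²`, `α¹ = -1`, `α^j = 0` (`j ≥ 2`) of `v² - h`. -/
def alphaQuadCoeff : ℕ → Phase 1 1 → EuclideanSpace ℝ (Fin 1)
  | 0, X => WithLp.toLp 2 fun _ => X (Sum.inr 0) ^ 2
  | 1, _ => WithLp.toLp 2 fun _ => -1
  | _ + 2, _ => 0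

/-- `β = -2 v ∂_x V(x)` in dimension `d = d' = 1`. -/
def betaQuad (V : EuclideanSpace ℝ (Fin 1) → ℝ) (X : Phase 1 1) : EuclideanSpace ℝ (Fin 1) :=
  WithLp.toLp 2 fun _ => -2 * X (Sum.inr 0) * pd 0 V (xPart X)

/-- `α = 4 ΣᵀΣ v` in dimension `d = d' = 3`. -/
def alphaMag (Sg : Matrix (Fin 3) (Fin 3) ℝ) (X : Phase 3 3) : EuclideanSpace ℝ (Fin 3) :=
  (4 : ℝ) • frictionVec Sg X

/-- `β = -2 ∂_x V + b(x) ∧ ΣᵀΣ v` in dimension `d = d' = 3`. -/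
def betaMag (Sg : Matrix (Fin 3) (Fin 3) ℝ) (V : EuclideanSpace ℝ (Fin 3) → ℝ)
    (b : EuclideanSpace ℝ (Fin 3) → EuclideanSpace ℝ (Fin 3)) (X : Phase 3 3) :
    EuclideanSpace ℝ (Fin 3) :=
  WithLp.toLp 2 ((fun i => -2 * pd i V (xPart X))
    + crossProduct (b (xPart X)).ofLp (frictionVec Sg X).ofLp)

/-- The coefficients of the expansion of a function that does not depend on `h`. -/
def constCoeff {E F : Type} [Zero F] (a : E → F) : ℕ → E → F
  | 0, X => a X
  | _ + 1, _ => 0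

end KFP

end

/-! Conjugation. Put b = (α⁰, β⁰ + 4ΣᵀΣv) and w = α·∂_xℓ + β·∂_vℓ + 4ΣᵀΣv·∂_vℓ + ℓ|∂_vℓ|² - hΔ_vℓ.
The skew relation makes e^{-f/h} a null function of P, so only terms in which χ is differentiated
survive, and P(χe^{-f/h}) = h e^{-(f+ℓ²/2)/h} (ζ(ℓ/τ) w - (h/τ) ζ'(ℓ/τ)|∂_vℓ|²) (`kineticOp_chi`).
The ζ' term lives where |ℓ| ≥ τ, and ℓ = O(|X - s| + h), so there |X - s| + h is bounded below and
the term is harmless. The coefficients of w in powers of h are the eikonal and transport expressions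
(`wkbW_asym`). It thus suffices to solve these in formal power series at s; Borel summation, at s
and then in h, produces ℓ.

Linear algebra at s. Let A = Hess f, let B₀ be the linear part of b and η = ∇ℓ₀(s). The eikonal
equation at first order reads B₀ᵀη = -|η_v|²η: η is an eigenvector for some -μ < 0, normalized by
|η_v|² = μ. Letting h → 0 in the skew relation gives b·∇f = 2|∂_v f|², whose quadratic part is
Az·B₀z = 2|(Az)_v|². At z = w := A⁻¹η this forces w·η = -2. As A has exactly one negative direction,
A is then positive on η^⊥, which is (iv); A + ηηᵀ is positive definite; and det(A + ηηᵀ) = (1 +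
η·A⁻¹η) det A = -det A, which is (iii).

Higher orders. On homogeneous polynomials the linearized equation acts as BX·∂ + μ with B = B₀ +
2(0,η_v)ηᵀ. These spaces are finite dimensional, so injectivity is enough. The positive form Q =
½⟨(A + ηηᵀ)z, z⟩ has nonnegative derivative along B; a degree n kernel element p satisfies Bp = -μp,
which at a maximum of p²/Qⁿ forces p = 0 (`eq_zero_of_vecDot_linField`).

Situations 1 and 3 reduce to finding η (`WKBConclusion.of_eigenvector`). In Situation 1 the
quadratic identity determines M_β and identifies B₀ᵀ with Λ. In Situation 3, det B₀ < 0 provides a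
negative eigenvalue. In both, the upper left block of B₀ vanishes, whence η_v ≠ 0.

In Situation 2, B₀ has no negative eigenvalue. One looks for ℓ_j(x, v) = g_j(x, v²). With z = v²,
the j-th equation has the form z(first-order expression in g_j) = (∂_x + 2∂_z)g_{j-1}, so it
requires the right-hand side to vanish on z = 0. The field ∂_x + 2∂_z is transverse to z = 0, hence
g_j(x, 0) can be prescribed, and this freedom meets the next compatibility condition: y = g_0(x, 0)
must solve yy' = -2V', and the g_j(x, 0) a linear equation with leading part η²((x - s)∂_x + 1),
here with η = ∂_xℓ₀(s). Then |∂_vℓ₀|² = 4v²(∂_z g_0)² gives the second alternative in (ii). -/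

noncomputable section

set_option linter.unusedSectionVars false

namespace KFP

/-! ### Smooth functions as a differential algebra, filtered by the order of vanishing at a point.
-/

section SmoothAlgebra

variable {ι : Type} [Fintype ι] [DecidableEq ι]

/-- The algebra of smooth real functions on a Euclidean space. -/
def smoothAlg (ι : Type) [Fintype ι] : Subalgebra ℝ (EuclideanSpace ℝ ι → ℝ) where
  carrier := {u | ContDiff ℝ ∞ u}
  mul_mem' := fun {a b} (ha : ContDiff ℝ ∞ a) (hb : ContDiff ℝ ∞ b) => ha.mul hb
  add_mem' := fun {a b} (ha : ContDiff ℝ ∞ a) (hb : ContDiff ℝ ∞ b) => ha.add hb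
  algebraMap_mem' := fun r => (contDiff_const : ContDiff ℝ ∞ fun _ => r)

/-- Smooth real functions on a Euclidean space. -/
def Sm (ι : Type) [Fintype ι] : Type := smoothAlg ι

instance : CommRing (Sm ι) := inferInstanceAs (CommRing (smoothAlg ι))

instance : Algebra ℝ (Sm ι) := inferInstanceAs (Algebra ℝ (smoothAlg ι))

/-- A smooth function as an element of `Sm`. -/
def Sm.mk (f : EuclideanSpace ℝ ι → ℝ) (hf : ContDiff ℝ ∞ f) : Sm ι := ⟨f, hf⟩

@[simp] theorem Sm.mk_apply (f : EuclideanSpace ℝ ι → ℝ) (hf : ContDiff ℝ ∞ f) (X) :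
    (Sm.mk f hf).1 X = f X := rfl

@[ext] theorem Sm.ext {u w : Sm ι} (h : ∀ X, u.1 X = w.1 X) : u = w :=
  Subtype.ext (funext h)

@[simp] theorem Sm.add_apply (u w : Sm ι) (X) : (u + w).1 X = u.1 X + w.1 X := rfl
@[simp] theorem Sm.sub_apply (u w : Sm ι) (X) : (u - w).1 X = u.1 X - w.1 X := rfl
@[simp] theorem Sm.mul_apply (u w : Sm ι) (X) : (u * w).1 X = u.1 X * w.1 X := rfl
@[simp] theorem Sm.neg_apply (u : Sm ι) (X) : (-u).1 X = -u.1 X := rfl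
@[simp] theorem Sm.smul_apply (c : ℝ) (u : Sm ι) (X) : (c • u).1 X = c * u.1 X := rfl
@[simp] theorem Sm.zero_apply (X) : (0 : Sm ι).1 X = 0 := rfl
@[simp] theorem Sm.one_apply (X) : (1 : Sm ι).1 X = 1 := rfl
@[simp] theorem Sm.algebraMap_apply (c : ℝ) (X) : (algebraMap ℝ (Sm ι) c).1 X = c := rfl

theorem Sm.contDiff (u : Sm ι) : ContDiff ℝ ∞ u.1 := u.2

theorem Sm.differentiable (u : Sm ι) : Differentiable ℝ u.1 :=
  u.contDiff.differentiable (by simp)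

theorem contDiff_pd {u : EuclideanSpace ℝ ι → ℝ} (hu : ContDiff ℝ ∞ u) (i : ι) :
    ContDiff ℝ ∞ (pd i u) := by
  unfold pd
  exact (hu.fderiv_right (m := ∞) (by simp)).clm_apply contDiff_const

theorem pd_eq_of_hasFDerivAt {u : EuclideanSpace ℝ ι → ℝ} {X : EuclideanSpace ℝ ι}
    {u' : EuclideanSpace ℝ ι →L[ℝ] ℝ} (h : HasFDerivAt u u' X) (i : ι) :
    pd i u X = u' (EuclideanSpace.single i 1) := by
  rw [pd, h.fderiv]

theorem fderiv_eq_sum_pd (u : EuclideanSpace ℝ ι → ℝ) (X Y : EuclideanSpace ℝ ι) :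
    fderiv ℝ u X Y = ∑ i, Y i * pd i u X := by
  have hY : Y = ∑ i, Y i • EuclideanSpace.single i (1 : ℝ) := by
    ext j
    simp [Pi.single_apply]
  conv_lhs => rw [hY]
  simp [pd]

/-- The partial derivative, as a derivation of the algebra of smooth functions. -/
def D (i : ι) : Derivation ℝ (Sm ι) (Sm ι) :=
  Derivation.mk'
    { toFun := fun u => ⟨pd i u.1, contDiff_pd u.2 i⟩
      map_add' := fun u w => by
        ext X
        exact pd_eq_of_hasFDerivAt
          ((u.differentiable X).hasFDerivAt.add (w.differentiable X).hasFDerivAt) i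
      map_smul' := fun c u => by
        ext X
        exact pd_eq_of_hasFDerivAt ((u.differentiable X).hasFDerivAt.const_smul c) i }
    fun u w => by
      ext X
      have := pd_eq_of_hasFDerivAt
          ((u.differentiable X).hasFDerivAt.mul (w.differentiable X).hasFDerivAt) i
      show pd i (u.1 * w.1) X = u.1 X * pd i w.1 X + w.1 X * pd i u.1 X
      simpa [pd] using this

@[simp] theorem D_apply (i : ι) (u : Sm ι) : (D i u).1 = pd i u.1 := rfl

theorem D_mul (i : ι) (u w : Sm ι) : D i (u * w) = u * D i w + w * D i u := by
  simp

theorem D_comm (i j : ι) (u : Sm ι) : D i (D j u) = D j (D i u) := by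
  ext X
  have hd : Differentiable ℝ (fderiv ℝ u.1) :=
    (u.contDiff.fderiv_right (m := ∞) (by simp)).differentiable (by simp)
  have key : ∀ a b : ι, pd a (pd b u.1) X
      = fderiv ℝ (fderiv ℝ u.1) X (EuclideanSpace.single a 1) (EuclideanSpace.single b 1) := by
    intro a b
    have h := ((hd X).hasFDerivAt.clm_apply
      (hasFDerivAt_const (EuclideanSpace.single b (1 : ℝ)) X))
    have h2 := pd_eq_of_hasFDerivAt h a
    have h3 : (fun y => fderiv ℝ u.1 y (EuclideanSpace.single b 1)) = pd b u.1 := rfl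
    rw [h3] at h2
    simpa using h2
  have hs : IsSymmSndFDerivAt ℝ u.1 X :=
    (u.contDiff.contDiffAt).isSymmSndFDerivAt (by
      simp only [minSmoothness_of_isRCLikeNormedField]; 
      exact (show ((2 : ℕ∞) : WithTop ℕ∞) ≤ _ from WithTop.coe_le_coe.2 le_top))
  simp only [D_apply]
  rw [key, key]
  exact hs _ _

/-- The evaluation at a point. -/
def ev (X : EuclideanSpace ℝ ι) : Sm ι →ₐ[ℝ] ℝ :=
  ((Pi.evalAlgHom ℝ (fun _ : EuclideanSpace ℝ ι => ℝ) X).comp (smoothAlg ι).val :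
    smoothAlg ι →ₐ[ℝ] ℝ)

@[simp] theorem ev_apply (X : EuclideanSpace ℝ ι) (u : Sm ι) : ev X u = u.1 X := rfl

@[simp] theorem Sm.sum_apply {κ : Type} (A : Finset κ) (u : κ → Sm ι) (X) :
    (∑ k ∈ A, u k).1 X = ∑ k ∈ A, (u k).1 X := map_sum (ev X) _ _

@[simp] theorem Sm.pow_apply (u : Sm ι) (n : ℕ) (X) : (u ^ n).1 X = u.1 X ^ n :=
  map_pow (ev X) _ _

theorem Sm.ext_ev {u w : Sm ι} (h : ∀ X, ev X u = ev X w) : u = w :=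
  Sm.ext h

/-- The centred coordinate functions `X ↦ X_i - s_i`. -/
def coord (s : EuclideanSpace ℝ ι) (i : ι) : Sm ι :=
  ⟨fun X => X i - s i, by
    have : ContDiff ℝ ∞ fun X : EuclideanSpace ℝ ι => X i - s i := by fun_prop
    exact this⟩

@[simp] theorem coord_apply (s X : EuclideanSpace ℝ ι) (i : ι) :
    (coord s i).1 X = X i - s i := rfl

theorem D_coord (s : EuclideanSpace ℝ ι) (i j : ι) :
    D i (coord s j) = if i = j then 1 else 0 := by
  ext X
  have h : HasFDerivAt (fun X : EuclideanSpace ℝ ι => X j - s j)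
      (EuclideanSpace.proj j : EuclideanSpace ℝ ι →L[ℝ] ℝ) X :=
    (EuclideanSpace.proj j : EuclideanSpace ℝ ι →L[ℝ] ℝ).hasFDerivAt.sub_const _
  have := pd_eq_of_hasFDerivAt h i
  simp only [D_apply]
  refine this.trans ?_
  by_cases hij : i = j
  · subst hij; simp
  · simp [hij, Ne.symm hij]

/-- `u` vanishes at `s` to order `n`: all the partial derivatives of order `< n` vanish. -/
def Van (s : EuclideanSpace ℝ ι) : ℕ → Sm ι → Prop
  | 0, _ => True
  | n + 1, u => ev s u = 0 ∧ ∀ i, Van s n (D i u)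

variable {s : EuclideanSpace ℝ ι}

theorem Van.add {n : ℕ} {u w : Sm ι} (hu : Van s n u) (hw : Van s n w) : Van s n (u + w) := by
  induction n generalizing u w with
  | zero => trivial
  | succ n ih =>
    refine ⟨by rw [map_add, hu.1, hw.1, add_zero], fun i => ?_⟩
    rw [map_add]
    exact ih (hu.2 i) (hw.2 i)

theorem Van.zero (n : ℕ) : Van s n (0 : Sm ι) := by
  induction n with
  | zero => trivial
  | succ n ih => exact ⟨map_zero _, fun i => by rw [map_zero]; exact ih⟩

theorem Van.of_succ {n : ℕ} {u : Sm ι} (hu : Van s (n + 1) u) : Van s n u := by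
  induction n generalizing u with
  | zero => trivial
  | succ n ih => exact ⟨hu.1, fun i => ih (hu.2 i)⟩

theorem Van.mono {m n : ℕ} (h : m ≤ n) {u : Sm ι} (hu : Van s n u) : Van s m u := by
  induction h with
  | refl => exact hu
  | step _ ih => exact ih hu.of_succ

/-- Induction on the total order with both factors free: Leibniz lowers the order of one factor by
one. When the differentiated factor has order 0 already, the other factor gives up one order
instead. -/
theorem Van.mul {m n : ℕ} {u w : Sm ι} (hu : Van s m u) (hw : Van s n w) :
    Van s (m + n) (u * w) := by
  obtain ⟨k, hk⟩ : ∃ k, m + n = k := ⟨_, rfl⟩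
  rw [hk]
  induction k generalizing m n u w with
  | zero => trivial
  | succ k ih =>
    refine ⟨?_, fun i => ?_⟩
    · rw [map_mul]
      cases m with
      | succ m => rw [hu.1, zero_mul]
      | zero =>
        cases n with
        | succ n => rw [hw.1, mul_zero]
        | zero => omega
    · rw [D_mul]
      refine Van.add ?_ ?_
      · cases n with
        | succ n => exact ih hu (hw.2 i) (by omega)
        | zero =>
          cases m with
          | zero => omega
          | succ m => exact ih (n := 0) hu.of_succ trivial (by omega)
      · cases m with
        | succ m => exact ih hw (hu.2 i) (by omega)
        | zero =>
          cases n with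
          | zero => omega
          | succ n => exact ih (n := 0) hw.of_succ trivial (by omega)

/-- The ideal of the smooth functions vanishing to order `n` at `s`. -/
def I (s : EuclideanSpace ℝ ι) (n : ℕ) : Ideal (Sm ι) where
  carrier := {u | Van s n u}
  add_mem' := fun hu hw => Van.add hu hw
  zero_mem' := Van.zero n
  smul_mem' := fun c u hu => by
    have := Van.mul (m := 0) (n := n) (u := c) (w := u) (s := s) trivial hu
    rwa [zero_add] at this

theorem mem_I_zero (u : Sm ι) : u ∈ I s 0 := trivial

theorem mem_I_succ {n : ℕ} {u : Sm ι} :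
    u ∈ I s (n + 1) ↔ ev s u = 0 ∧ ∀ i, D i u ∈ I s n := Iff.rfl

theorem mem_I_one {u : Sm ι} : u ∈ I s 1 ↔ ev s u = 0 :=
  ⟨fun h => h.1, fun h => ⟨h, fun _ => trivial⟩⟩

theorem I_anti {m n : ℕ} (h : m ≤ n) {u : Sm ι} (hu : u ∈ I s n) : u ∈ I s m := Van.mono h hu

theorem mul_mem_I {m n k : ℕ} {u w : Sm ι} (hu : u ∈ I s m) (hw : w ∈ I s n) (hk : k ≤ m + n) :
    u * w ∈ I s k := I_anti hk (Van.mul hu hw)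

theorem D_mem_I {m n : ℕ} {u : Sm ι} (hu : u ∈ I s n) (h : m ≤ n - 1) (i : ι) :
    D i u ∈ I s m := by
  cases n with
  | zero => exact I_anti (by omega) (mem_I_zero _)
  | succ n => exact I_anti h (hu.2 i)

theorem smul_mem_I {n : ℕ} {u : Sm ι} (c : ℝ) (hu : u ∈ I s n) : c • u ∈ I s n := by
  rw [Algebra.smul_def]
  exact Ideal.mul_mem_left _ _ hu

theorem coord_mem_I (i : ι) : coord s i ∈ I s 1 := mem_I_one.2 (by simp)

/-- Vanishing to all orders. -/
def Flat (s : EuclideanSpace ℝ ι) : Ideal (Sm ι) := ⨅ n, I s n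

theorem mem_Flat {u : Sm ι} : u ∈ Flat s ↔ ∀ n, u ∈ I s n := by simp [Flat]

theorem D_mem_Flat {u : Sm ι} (hu : u ∈ Flat s) (i : ι) : D i u ∈ Flat s :=
  mem_Flat.2 fun n => D_mem_I (mem_Flat.1 hu (n + 1)) (by simp) i

theorem norm_fderiv_le_sum_pd (u : EuclideanSpace ℝ ι → ℝ) (X : EuclideanSpace ℝ ι) :
    ‖fderiv ℝ u X‖ ≤ ∑ i, |pd i u X| := by
  refine ContinuousLinearMap.opNorm_le_bound _ (Finset.sum_nonneg fun i _ => abs_nonneg _) ?_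
  intro Y
  rw [fderiv_eq_sum_pd, Finset.sum_mul]
  refine (Finset.abs_sum_le_sum_abs _ _).trans (Finset.sum_le_sum fun i _ => ?_)
  rw [abs_mul, mul_comm]
  exact mul_le_mul_of_nonneg_left (EuclideanSpace.norm_eq Y ▸ by
    have := PiLp.norm_apply_le Y i
    rwa [EuclideanSpace.norm_eq] at this) (abs_nonneg _)

/-- The mean value inequality on the ball of radius ‖X - s‖ turns order n bounds on the partial
derivatives into an order n + 1 bound on the function. -/
theorem exists_bound_of_mem_I {n : ℕ} {u : Sm ι} (hu : u ∈ I s n) (R : ℝ) :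
    ∃ C : ℝ, 0 ≤ C ∧ ∀ X, ‖X - s‖ ≤ R → |u.1 X| ≤ C * ‖X - s‖ ^ n := by
  induction n generalizing u with
  | zero =>
    obtain ⟨C, hC⟩ := (isCompact_closedBall s R).exists_bound_of_continuousOn
      u.contDiff.continuous.continuousOn
    refine ⟨max C 0, le_max_right _ _, fun X hX => ?_⟩
    have := hC X (by simpa [dist_eq_norm] using hX)
    simpa using Or.inl this
  | succ n ih =>
    choose C hC0 hC using fun i => ih (hu.2 i)
    refine ⟨∑ i, C i, Finset.sum_nonneg fun i _ => hC0 i, fun X hX => ?_⟩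
    have hb : ∀ Y ∈ Metric.closedBall s ‖X - s‖,
        ‖fderiv ℝ u.1 Y‖ ≤ (∑ i, C i) * ‖X - s‖ ^ n := by
      intro Y hY
      rw [mem_closedBall_iff_norm] at hY
      refine (norm_fderiv_le_sum_pd _ _).trans ?_
      rw [Finset.sum_mul]
      refine Finset.sum_le_sum fun i _ => (hC i Y (hY.trans hX)).trans ?_
      exact mul_le_mul_of_nonneg_left (pow_le_pow_left₀ (norm_nonneg _) hY n) (hC0 i)
    have := (convex_closedBall s ‖X - s‖).norm_image_sub_le_of_norm_fderiv_le
      (fun Y _ => u.differentiable Y) hb (Metric.mem_closedBall_self (norm_nonneg _))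
      (show X ∈ Metric.closedBall s ‖X - s‖ by simp [dist_eq_norm])
    have h0 : u.1 s = 0 := hu.1
    rw [h0, sub_zero] at this
    rw [pow_succ, ← mul_assoc]
    exact this

/-- A product with a factor not vanishing at `s` vanishes to the order of the other factor. -/
theorem mem_I_of_mul_mem {n : ℕ} {a u : Sm ι} (ha : ev s a ≠ 0) (h : a * u ∈ I s n) :
    u ∈ I s n := by
  suffices H : ∀ k ≤ n, u ∈ I s k from H n le_rfl
  intro k
  induction k with
  | zero => intro _; exact mem_I_zero u
  | succ k ih =>
    intro hk
    have hu := ih (by omega)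
    have h1 : a - algebraMap ℝ (Sm ι) (ev s a) ∈ I s 1 := mem_I_one.2 (by
      rw [map_sub, AlgHom.commutes]; simp)
    -- The factor a differs from its nonzero value at s by an element of order 1, so replacing a by
    -- a constant costs one order more than is already known for u.
    have h2 : (a - algebraMap ℝ (Sm ι) (ev s a)) * u ∈ I s (k + 1) :=
      mul_mem_I h1 hu (by omega)
    have h3 := sub_mem (I_anti hk h) h2
    rw [← sub_mul, sub_sub_cancel, ← Algebra.smul_def] at h3
    have h4 := smul_mem_I (ev s a)⁻¹ h3
    rwa [smul_smul, inv_mul_cancel₀ ha, one_smul] at h4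

theorem mem_Flat_of_mul_mem {a u : Sm ι} (ha : ev s a ≠ 0) (h : a * u ∈ Flat s) :
    u ∈ Flat s :=
  mem_Flat.2 fun n => mem_I_of_mul_mem ha (mem_Flat.1 h n)

end SmoothAlgebra

/-! ### Homogeneous polynomials, leading parts and finite dimensionality. -/

section Homogeneous

variable {ι : Type} [Fintype ι] [DecidableEq ι]

/-- Smooth functions homogeneous of degree `n` with respect to `s`: homogeneous polynomials. -/
def Hom (s : EuclideanSpace ℝ ι) (n : ℕ) : Submodule ℝ (Sm ι) where
  carrier := {p | ∀ (t : ℝ) (X : EuclideanSpace ℝ ι), p.1 (s + t • X) = t ^ n * p.1 (s + X)}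
  add_mem' := fun {a b} ha hb t X => by
    show a.1 _ + b.1 _ = _ * (a.1 _ + b.1 _)
    rw [ha, hb, mul_add]
  zero_mem' := fun t X => by
    show (0 : ℝ) = _ * 0
    rw [mul_zero]
  smul_mem' := fun c a ha t X => by
    show c * a.1 _ = _ * (c * a.1 _)
    rw [ha]; ring

variable {s : EuclideanSpace ℝ ι}

theorem mul_mem_Hom {m n : ℕ} {p q : Sm ι} (hp : p ∈ Hom s m) (hq : q ∈ Hom s n) :
    p * q ∈ Hom s (m + n) := fun t X => by
  show p.1 _ * q.1 _ = _ * (p.1 _ * q.1 _)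
  rw [hp, hq]; ring

theorem coord_mem_Hom (i : ι) : coord s i ∈ Hom s 1 := fun t X => by simp

theorem hasFDerivAt_comp_affine (p : Sm ι) (t : ℝ) (X : EuclideanSpace ℝ ι) :
    HasFDerivAt (fun X => p.1 (s + t • X)) (t • fderiv ℝ p.1 (s + t • X)) X := by
  have h1 : HasFDerivAt (fun X : EuclideanSpace ℝ ι => s + t • X)
      (t • ContinuousLinearMap.id ℝ (EuclideanSpace ℝ ι)) X :=
    ((hasFDerivAt_id X).const_smul t).const_add s
  have h2 := ((p.differentiable (s + t • X)).hasFDerivAt).comp X h1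
  exact h2.congr_fderiv (by ext; simp)

theorem pd_comp_affine (p : Sm ι) (t : ℝ) (X : EuclideanSpace ℝ ι) (i : ι) :
    pd i (fun X => p.1 (s + t • X)) X = t * pd i p.1 (s + t • X) := by
  rw [pd_eq_of_hasFDerivAt (hasFDerivAt_comp_affine p t X)]
  simp [pd]

theorem D_mem_Hom {n : ℕ} {p : Sm ι} (hp : p ∈ Hom s (n + 1)) (i : ι) :
    D i p ∈ Hom s n := by
  intro t X
  have hne : ∀ t : ℝ, t ≠ 0 → pd i p.1 (s + t • X) = t ^ n * pd i p.1 (s + X) := by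
    intro t ht
    have h1 : (fun X => p.1 (s + t • X)) = fun X => t ^ (n + 1) * p.1 (s + (1 : ℝ) • X) := by
      ext X; rw [hp t X, one_smul]
    have h2 := pd_comp_affine (s := s) p t X i
    rw [h1, pd_eq_of_hasFDerivAt ((hasFDerivAt_comp_affine p 1 X).const_mul _)] at h2
    have h3 : t ^ (n + 1) * pd i p.1 (s + X) = t * pd i p.1 (s + t • X) := by
      simpa [pd] using h2
    apply mul_left_cancel₀ ht
    rw [← h3]; ring
  -- Differentiating the homogeneity relation gives the claim only after cancelling a factor t; t =
  -- 0 is recovered by continuity.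
  have hc : Continuous (pd i p.1) := (D i p).contDiff.continuous
  have := Continuous.ext_on (dense_compl_singleton (0 : ℝ))
    (f := fun t : ℝ => pd i p.1 (s + t • X)) (g := fun t : ℝ => t ^ n * pd i p.1 (s + X))
    (by fun_prop) (by fun_prop) (fun t ht => hne t ht)
  exact congrFun this t

theorem eq_const_of_mem_Hom_zero {p : Sm ι} (hp : p ∈ Hom s 0) (X : EuclideanSpace ℝ ι) :
    p.1 X = p.1 s := by
  have := hp 0 (X - s)
  simpa using this.symm

theorem D_eq_zero_of_mem_Hom_zero {p : Sm ι} (hp : p ∈ Hom s 0) (i : ι) : D i p = 0 := by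
  ext X
  have : p.1 = fun _ => p.1 s := funext (eq_const_of_mem_Hom_zero hp)
  show pd i p.1 X = 0
  rw [this]
  simp [pd]

theorem euler {n : ℕ} {p : Sm ι} (hp : p ∈ Hom s n) :
    ∑ i, coord s i * D i p = (n : ℝ) • p := by
  refine Sm.ext_ev fun X => ?_
  simp only [map_sum, map_mul, ev_apply, coord_apply, D_apply, map_smul, smul_eq_mul]
  have h1 : HasDerivAt (fun t : ℝ => s + t • (X - s)) (X - s) 1 := by
    simpa using ((hasDerivAt_id (1 : ℝ)).smul_const (X - s)).const_add s
  have h2 : HasDerivAt (fun t : ℝ => p.1 (s + t • (X - s)))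
      (fderiv ℝ p.1 (s + (1 : ℝ) • (X - s)) (X - s)) 1 :=
    ((p.differentiable _).hasFDerivAt).comp_hasDerivAt (1 : ℝ) h1
  have h3 : (fun t : ℝ => p.1 (s + t • (X - s))) = fun t => t ^ n * p.1 X := by
    ext t; rw [hp]; simp
  rw [h3] at h2
  have h4 : HasDerivAt (fun t : ℝ => t ^ n * p.1 X) ((n : ℝ) * 1 ^ (n - 1) * p.1 X) 1 :=
    (hasDerivAt_pow n 1).mul_const _
  have := h2.unique h4
  rw [fderiv_eq_sum_pd] at this
  simpa using this

theorem Hom_le_I {n : ℕ} {p : Sm ι} (hp : p ∈ Hom s n) : p ∈ I s n := by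
  induction n generalizing p with
  | zero => exact mem_I_zero p
  | succ n ih =>
    refine ⟨?_, fun i => ih (D_mem_Hom hp i)⟩
    have := hp 0 0
    simpa using this

/-- By induction on the degree the gradient vanishes, and Euler's identity recovers p from its
gradient. This turns congruences modulo higher order into exact identities of polynomials. -/
theorem eq_zero_of_mem_Hom_of_mem_I {n : ℕ} {p : Sm ι} (hp : p ∈ Hom s n)
    (h : p ∈ I s (n + 1)) : p = 0 := by
  induction n generalizing p with
  | zero =>
    refine Sm.ext_ev fun X => ?_
    rw [ev_apply, eq_const_of_mem_Hom_zero hp, map_zero]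
    exact h.1
  | succ n ih =>
    have h1 : ∀ i, D i p = 0 := fun i => ih (D_mem_Hom hp i) (h.2 i)
    have h2 := euler hp
    simp only [h1, mul_zero, Finset.sum_const_zero] at h2
    exact (smul_eq_zero.1 h2.symm).resolve_left (by positivity)

theorem const_mem_Hom (c : ℝ) : algebraMap ℝ (Sm ι) c ∈ Hom s 0 := fun t X => by
  show c = t ^ 0 * c
  simp

/-- The leading homogeneous part of a function vanishing to order `n`. -/
theorem exists_leading {n : ℕ} {u : Sm ι} (hu : u ∈ I s n) :
    ∃ p ∈ Hom s n, u - p ∈ I s (n + 1) := by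
  induction n generalizing u with
  | zero =>
    refine ⟨algebraMap ℝ (Sm ι) (ev s u), const_mem_Hom _, mem_I_one.2 ?_⟩
    rw [map_sub, AlgHom.commutes]; simp
  | succ n ih =>
    choose p hp hup using fun i => ih (hu.2 i)
    -- Integrability: the leading parts of the partial derivatives of u inherit the symmetry of
    -- second derivatives, because a homogeneous function vanishing to one order more than its
    -- degree is zero.
    have hclosed : ∀ i j, D j (p i) = D i (p j) := by
      intro i j
      cases n with
      | zero => rw [D_eq_zero_of_mem_Hom_zero (hp i), D_eq_zero_of_mem_Hom_zero (hp j)]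
      | succ n =>
        rw [← sub_eq_zero]
        refine eq_zero_of_mem_Hom_of_mem_I (s := s) (n := n)
          (sub_mem (D_mem_Hom (hp i) j) (D_mem_Hom (hp j) i)) ?_
        have h1 := D_mem_I (hup i) (show n + 1 ≤ n + 1 + 1 - 1 by omega) j
        have h2 := D_mem_I (hup j) (show n + 1 ≤ n + 1 + 1 - 1 by omega) i
        have h3 := sub_mem h2 h1
        rw [map_sub, map_sub, D_comm i j u] at h3
        simpa using h3
    -- Poincaré lemma for a closed homogeneous field: by closedness and Euler, the primitive is Σ
    -- x_i p_i up to the factor n + 1.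
    have hDP : ∀ j, D j (∑ i, coord s i * p i) = ((n : ℝ) + 1) • p j := by
      intro j
      simp only [map_sum, D_mul, D_coord, mul_ite, mul_one, mul_zero]
      rw [Finset.sum_add_distrib, Finset.sum_ite_eq Finset.univ j p]
      simp only [Finset.mem_univ, if_true, hclosed _ j]
      rw [euler (hp j), add_smul, one_smul]
    have hn : ((n : ℝ) + 1) ≠ 0 := by positivity
    refine ⟨((n : ℝ) + 1)⁻¹ • ∑ i, coord s i * p i, ?_, ?_, fun j => ?_⟩
    · refine Submodule.smul_mem _ _ (Submodule.sum_mem _ fun i _ => ?_)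
      have := mul_mem_Hom (coord_mem_Hom (s := s) i) (hp i)
      rwa [add_comm] at this
    · rw [map_sub, hu.1, map_smul, map_sum]
      simp
    · rw [map_sub, Derivation.map_smul, hDP, smul_smul, inv_mul_cancel₀ hn, one_smul]
      exact hup j

/-- By Euler's identity a homogeneous function of positive degree is determined by its gradient, so
degree n + 1 embeds in a finite product of copies of degree n. -/
instance finite_Hom (n : ℕ) : Module.Finite ℝ (Hom s n) := by
  induction n with
  | zero =>
    refine Module.Finite.of_injective
      ((ev s).toLinearMap.comp (Hom s 0).subtype) fun p q h => ?_
    refine Subtype.ext (Sm.ext_ev fun X => ?_)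
    rw [ev_apply, ev_apply, eq_const_of_mem_Hom_zero p.2, eq_const_of_mem_Hom_zero q.2]
    exact h
  | succ n ih =>
    refine Module.Finite.of_injective
      (LinearMap.pi fun i => ((D i : Sm ι →ₗ[ℝ] Sm ι).restrict
        (p := Hom s (n + 1)) (q := Hom s n) fun p hp => D_mem_Hom hp i)) ?_
    rw [← LinearMap.ker_eq_bot, LinearMap.ker_eq_bot']
    intro p h
    have h1 : ∀ i, D i p.1 = 0 := fun i => congrArg Subtype.val (congrFun h i)
    have h2 := euler p.2
    simp only [h1, mul_zero, Finset.sum_const_zero] at h2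
    exact Subtype.ext ((smul_eq_zero.1 h2.symm).resolve_left (by positivity))

/-- An injective linear operator on homogeneous polynomials is surjective. -/
theorem exists_mem_Hom_eq {n : ℕ} (T : Sm ι →ₗ[ℝ] Sm ι) (hT : ∀ p ∈ Hom s n, T p ∈ Hom s n)
    (inj : ∀ p ∈ Hom s n, T p = 0 → p = 0) {p : Sm ι} (hp : p ∈ Hom s n) :
    ∃ q ∈ Hom s n, T q = p := by
  have h1 : Function.Injective (T.restrict hT) := by
    rw [← LinearMap.ker_eq_bot, LinearMap.ker_eq_bot']
    exact fun q hq => Subtype.ext (inj q.1 q.2 (congrArg Subtype.val hq))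
  obtain ⟨q, hq⟩ := LinearMap.surjective_of_injective h1 ⟨p, hp⟩
  exact ⟨q.1, q.2, congrArg Subtype.val hq⟩

/-- Converse of `exists_bound_of_mem_I`. If u has order k < n, its leading part p scales as t^k
along rays while u is O(t^n), so dividing by t^k and letting t → 0 gives p = 0. -/
theorem mem_I_of_bound {n : ℕ} {u : Sm ι} {C r : ℝ} (hr : 0 < r)
    (h : ∀ X, ‖X - s‖ < r → |u.1 X| ≤ C * ‖X - s‖ ^ n) : u ∈ I s n := by
  suffices H : ∀ k ≤ n, u ∈ I s k from H n le_rfl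
  intro k
  induction k with
  | zero => intro _; exact mem_I_zero u
  | succ k ih =>
    intro hk
    have hu := ih (by omega)
    obtain ⟨p, hp, hup⟩ := exists_leading hu
    obtain ⟨C', hC'0, hC'⟩ := exists_bound_of_mem_I hup r
    have hp0 : p = 0 := by
      refine Sm.ext_ev fun X => ?_
      rw [map_zero, ev_apply]
      set Y := X - s with hY
      have hX : X = s + Y := by simp [hY]
      rw [hX]
      have key : ∀ t : ℝ, 0 < t → t < 1 → t * ‖Y‖ < r →
          |p.1 (s + Y)| ≤ t * (|C| * ‖Y‖ ^ n + C' * ‖Y‖ ^ (k + 1)) := by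
        intro t ht ht1 htr
        have hn : ‖s + t • Y - s‖ = t * ‖Y‖ := by
          rw [add_sub_cancel_left, norm_smul, Real.norm_of_nonneg ht.le]
        have h1 := h (s + t • Y) (by rw [hn]; exact htr)
        have h2 := hC' (s + t • Y) (by rw [hn]; exact htr.le)
        rw [hn] at h1 h2
        have h3 : (u - p).1 (s + t • Y) = u.1 (s + t • Y) - t ^ k * p.1 (s + Y) := by
          rw [← hp]; rfl
        rw [h3] at h2
        have h4 : |t ^ k * p.1 (s + Y)| ≤
            C * (t * ‖Y‖) ^ n + C' * (t * ‖Y‖) ^ (k + 1) := by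
          have := abs_sub_abs_le_abs_sub (t ^ k * p.1 (s + Y)) (u.1 (s + t • Y))
          rw [abs_sub_comm] at this
          linarith
        rw [abs_mul, abs_of_pos (pow_pos ht k)] at h4
        have h5 : C * (t * ‖Y‖) ^ n ≤ t ^ (k + 1) * (|C| * ‖Y‖ ^ n) := by
          rw [mul_pow]
          have h6 : t ^ n ≤ t ^ (k + 1) := pow_le_pow_of_le_one ht.le ht1.le hk
          calc C * (t ^ n * ‖Y‖ ^ n) ≤ |C| * (t ^ n * ‖Y‖ ^ n) :=
                mul_le_mul_of_nonneg_right (le_abs_self C) (by positivity)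
            _ = t ^ n * (|C| * ‖Y‖ ^ n) := by ring
            _ ≤ t ^ (k + 1) * (|C| * ‖Y‖ ^ n) :=
                mul_le_mul_of_nonneg_right h6 (by positivity)
        have h7 : t ^ k * |p.1 (s + Y)| ≤
            t ^ k * (t * (|C| * ‖Y‖ ^ n + C' * ‖Y‖ ^ (k + 1))) := by
          refine h4.trans ((add_le_add_left h5 _).trans (le_of_eq ?_))
          ring
        exact le_of_mul_le_mul_left h7 (pow_pos ht k)
      have hlim : Filter.Tendsto
          (fun t : ℝ => t * (|C| * ‖Y‖ ^ n + C' * ‖Y‖ ^ (k + 1))) (nhdsWithin 0 (Set.Ioi 0))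
          (nhds 0) := by
        have : Filter.Tendsto
          (fun t : ℝ => t * (|C| * ‖Y‖ ^ n + C' * ‖Y‖ ^ (k + 1))) (nhds 0) (nhds (0 * _)) :=
          Filter.tendsto_id.mul_const _
        rw [zero_mul] at this
        exact this.mono_left nhdsWithin_le_nhds
      have hev : ∀ᶠ t : ℝ in nhdsWithin 0 (Set.Ioi 0),
          |p.1 (s + Y)| ≤ t * (|C| * ‖Y‖ ^ n + C' * ‖Y‖ ^ (k + 1)) := by
        have e1 : ∀ᶠ t : ℝ in nhds 0, t < 1 := gt_mem_nhds one_pos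
        have e2 : ∀ᶠ t : ℝ in nhds 0, t * ‖Y‖ < r := by
          have : Filter.Tendsto (fun t : ℝ => t * ‖Y‖) (nhds 0) (nhds (0 * ‖Y‖)) :=
            Filter.tendsto_id.mul_const _
          rw [zero_mul] at this
          exact this.eventually (gt_mem_nhds hr)
        filter_upwards [self_mem_nhdsWithin, nhdsWithin_le_nhds e1, nhdsWithin_le_nhds e2]
          with t h1 h2 h3 using key t h1 h2 h3
      have := ge_of_tendsto hlim hev
      exact abs_nonpos_iff.1 this
    rw [hp0, sub_zero] at hup
    exact hup

end Homogeneous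

/-! ### Borel's lemma at a point and formal solution of equations. -/

section Borel

variable {ι : Type} [Fintype ι] [DecidableEq ι] {s : EuclideanSpace ℝ ι}

theorem exists_bump (ι : Type) [Fintype ι] : ∃ φ : EuclideanSpace ℝ ι → ℝ,
    ContDiff ℝ ∞ φ ∧ HasCompactSupport φ ∧ (∀ Y, ‖Y‖ ≤ 1 → φ Y = 1) ∧
      (∀ Y, 2 ≤ ‖Y‖ → φ Y = 0) ∧ (∀ Y, 0 ≤ φ Y) ∧ ∀ Y, φ Y ≤ 1 := by
  let φ : ContDiffBump (0 : EuclideanSpace ℝ ι) := ⟨1, 2, one_pos, one_lt_two⟩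
  exact ⟨φ, φ.contDiff, φ.hasCompactSupport,
    fun Y hY => φ.one_of_mem_closedBall (by rwa [mem_closedBall_zero_iff]),
    fun Y hY => φ.zero_of_le_dist (by rwa [dist_zero_right]),
    fun Y => φ.nonneg, fun Y => φ.le_one⟩

/-- A cut-off of a homogeneous polynomial of degree `k` near `s`, with small derivatives of order
less than `k`. -/
theorem exists_small_cutoff {k : ℕ} {p : Sm ι} (hp : p ∈ Hom s k) {δ : ℝ} (hδ : 0 < δ) :
    ∃ f : Sm ι, (∃ r : ℝ, 0 < r ∧ ∀ X, ‖X - s‖ < r → f.1 X = p.1 X) ∧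
      (∀ i < k, ∀ X, ‖iteratedFDeriv ℝ i f.1 X‖ ≤ δ) ∧
      (0 < k → ∀ X, ‖X - s‖ ≤ 1 → |f.1 X| ≤ δ * ‖X - s‖ ^ (k - 1)) := by
  obtain ⟨φ, hφ, hφs, hφ1, hφ0, hφn, hφl⟩ := exists_bump ι
  let g : EuclideanSpace ℝ ι → ℝ := fun Y => φ Y * p.1 (s + Y)
  have hg : ContDiff ℝ ∞ g :=
    hφ.mul (p.contDiff.comp (contDiff_const.add contDiff_id))
  have hgs : HasCompactSupport g := hφs.mul_right
  have hM : ∀ i : ℕ, ∃ M, ∀ Y, ‖iteratedFDeriv ℝ i g Y‖ ≤ M := fun i =>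
    (hg.continuous_iteratedFDeriv (by exact_mod_cast le_top)).bounded_above_of_compact_support
      (hgs.iteratedFDeriv i)
  choose M hM using hM
  obtain ⟨C, hC0, hC⟩ := exists_bound_of_mem_I (Hom_le_I hp) 1
  -- B dominates all the constants that will be multiplied by the scale ε, so that εB ≤ δ settles
  -- every estimate at once.
  set B : ℝ := 1 + 2 * C + ∑ i ∈ Finset.range k, |M i| with hB
  have hB1 : 1 ≤ B := by
    have : 0 ≤ ∑ i ∈ Finset.range k, |M i| := Finset.sum_nonneg fun i _ => abs_nonneg _
    linarith
  have hMB : ∀ i < k, M i ≤ B := by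
    intro i hi
    have h1 : |M i| ≤ ∑ i ∈ Finset.range k, |M i| :=
      Finset.single_le_sum (f := fun i => |M i|) (fun i _ => abs_nonneg _)
        (Finset.mem_range.2 hi)
    linarith [le_abs_self (M i)]
  have hCB : 2 * C ≤ B := by
    have : 0 ≤ ∑ i ∈ Finset.range k, |M i| := Finset.sum_nonneg fun i _ => abs_nonneg _
    linarith
  set ε : ℝ := min 1 (δ / B) with hε
  have hε0 : 0 < ε := lt_min one_pos (by positivity)
  have hε1 : ε ≤ 1 := min_le_left _ _
  have hεB : ε * B ≤ δ := by
    have : ε ≤ δ / B := min_le_right _ _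
    rwa [le_div_iff₀ (by linarith)] at this
  have hf : ContDiff ℝ ∞ fun X => φ (ε⁻¹ • (X - s)) * p.1 X :=
    (hφ.comp (by fun_prop : ContDiff ℝ ∞ fun X => ε⁻¹ • (X - s))).mul p.contDiff
  -- By homogeneity the cut-off at scale ε is ε^k times the rescaling of a fixed profile. Each
  -- derivative costs ε⁻¹, so a derivative of order i < k keeps at least one factor ε.
  have hfg : (fun X => φ (ε⁻¹ • (X - s)) * p.1 X) =
      ε ^ k • fun X => (fun Z => g (ε⁻¹ • Z)) (X - s) := by
    ext X
    have h1 := hp ε (ε⁻¹ • (X - s))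
    rw [smul_smul, mul_inv_cancel₀ hε0.ne', one_smul, add_sub_cancel] at h1
    simp only [g, Pi.smul_apply, smul_eq_mul]
    rw [h1]; ring
  refine ⟨Sm.mk _ hf, ⟨ε, hε0, fun X hX => ?_⟩, fun i hi X => ?_, fun hk X hX => ?_⟩
  · have : φ (ε⁻¹ • (X - s)) = 1 := hφ1 _ (by
      rw [norm_smul, Real.norm_of_nonneg (inv_nonneg.2 hε0.le)]
      rw [inv_mul_le_iff₀ hε0]; linarith)
    show φ (ε⁻¹ • (X - s)) * p.1 X = _
    rw [this, one_mul]
  · show ‖iteratedFDeriv ℝ i (fun X => φ (ε⁻¹ • (X - s)) * p.1 X) X‖ ≤ δ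
    have hgi : ContDiff ℝ i g := hg.of_le (by exact_mod_cast le_top)
    have hgi2 : ContDiff ℝ i fun X => (fun Z => g (ε⁻¹ • Z)) (X - s) :=
      hgi.comp (by fun_prop : ContDiff ℝ i fun X => ε⁻¹ • (X - s))
    have hder : iteratedFDeriv ℝ i (fun X => (fun Z => g (ε⁻¹ • Z)) (X - s)) X =
        ε⁻¹ ^ i • iteratedFDeriv ℝ i g (ε⁻¹ • (X - s)) :=
      (iteratedFDeriv_comp_sub (f := fun Z => g (ε⁻¹ • Z)) i s X).trans
        (congrFun (iteratedFDeriv_comp_const_smul ε⁻¹ hgi) _)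
    rw [hfg, iteratedFDeriv_const_smul_apply hgi2.contDiffAt, hder, norm_smul, norm_smul, norm_pow, norm_pow, norm_inv,
      Real.norm_of_nonneg hε0.le, ← mul_assoc]
    have h1 : ε ^ k * ε⁻¹ ^ i ≤ ε := by
      obtain ⟨m, rfl⟩ : ∃ m, k = i + 1 + m := ⟨k - (i + 1), by omega⟩
      have : ε ^ (i + 1 + m) * ε⁻¹ ^ i = ε * ε ^ m := by
        rw [pow_add, pow_add, inv_pow]
        field_simp
      rw [this]
      exact mul_le_of_le_one_right hε0.le (pow_le_one₀ hε0.le hε1)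
    calc _ ≤ ε * B := mul_le_mul h1 ((hM i _).trans (hMB i hi)) (norm_nonneg _) hε0.le
      _ ≤ δ := hεB
  · show |φ (ε⁻¹ • (X - s)) * p.1 X| ≤ _
    rw [abs_mul, abs_of_nonneg (hφn _)]
    by_cases hX2 : ‖X - s‖ < 2 * ε
    · have h1 := hC X hX
      obtain ⟨m, rfl⟩ : ∃ m, k = m + 1 := ⟨k - 1, by omega⟩
      rw [Nat.add_sub_cancel]
      calc φ (ε⁻¹ • (X - s)) * |p.1 X| ≤ 1 * (C * ‖X - s‖ ^ (m + 1)) :=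
            mul_le_mul (hφl _) h1 (abs_nonneg _) zero_le_one
        _ = (C * ‖X - s‖) * ‖X - s‖ ^ m := by ring
        _ ≤ δ * ‖X - s‖ ^ m := by
            refine mul_le_mul_of_nonneg_right ?_ (by positivity)
            calc C * ‖X - s‖ ≤ C * (2 * ε) := mul_le_mul_of_nonneg_left hX2.le hC0
              _ = ε * (2 * C) := by ring
              _ ≤ ε * B := mul_le_mul_of_nonneg_left hCB hε0.le
              _ ≤ δ := hεB
    · have : φ (ε⁻¹ • (X - s)) = 0 := hφ0 _ (by
        rw [norm_smul, Real.norm_of_nonneg (inv_nonneg.2 hε0.le)]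
        rw [le_inv_mul_iff₀ hε0]; linarith)
      rw [this, zero_mul]
      positivity

/-- Borel's lemma: a smooth function with prescribed homogeneous Taylor components at `s`. -/
theorem exists_borel_sum (p : ℕ → Sm ι) (hp : ∀ k, p k ∈ Hom s k) :
    ∃ u : Sm ι, ∀ N, u - ∑ k ∈ Finset.range N, p k ∈ I s N := by
  choose f hfp hfd hfb using fun k =>
    exists_small_cutoff (hp k) (δ := (1 / 2 : ℝ) ^ k) (by positivity)
  have hgeo : Summable fun k : ℕ => (1 / 2 : ℝ) ^ k := summable_geometric_two
  have hu : ContDiff ℝ ∞ fun X => ∑' k, (f k).1 X := by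
    refine contDiff_tsum_of_eventually (v := fun _ k => (1 / 2 : ℝ) ^ k)
      (fun k => (f k).contDiff) (fun _ _ => hgeo) fun i _ => ?_
    rw [Nat.cofinite_eq_atTop]
    filter_upwards [Filter.eventually_gt_atTop i] with k hk X using hfd k i hk X
  have hsum : ∀ X, Summable fun k => (f k).1 X := by
    intro X
    refine Summable.of_norm_bounded_eventually hgeo ?_
    rw [Nat.cofinite_eq_atTop]
    filter_upwards [Filter.eventually_gt_atTop 0] with k hk
    have := hfd k 0 hk X
    rwa [norm_iteratedFDeriv_zero] at this
  refine ⟨Sm.mk _ hu, fun N => ?_⟩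
  have h1 : ∀ k, f k - p k ∈ I s N := fun k => by
    obtain ⟨r, hr, h⟩ := hfp k
    refine mem_I_of_bound (C := 0) hr fun X hX => ?_
    simp [h X hX]
  -- The k-th term is at most 2^{-k}‖X - s‖^{k-1}. Cutting at N + 1 rather than N makes the exponent
  -- at least N, and the additional polynomial p N vanishes to order N by itself.
  have h2 : Sm.mk _ hu - ∑ k ∈ Finset.range (N + 1), f k ∈ I s N := by
    refine mem_I_of_bound (C := 2) one_pos fun X hX => ?_
    rw [Sm.sub_apply, Sm.sum_apply, Sm.mk_apply]
    have h3 := (hsum X).sum_add_tsum_nat_add (N + 1)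
    have h4 : ∑' k, (f k).1 X - ∑ k ∈ Finset.range (N + 1), (f k).1 X
        = ∑' k, (f (k + (N + 1))).1 X := by linarith
    rw [h4]
    have h5 : ∀ k : ℕ, ‖(f (k + (N + 1))).1 X‖ ≤ (1 / 2 : ℝ) ^ k * ‖X - s‖ ^ N := by
      intro k
      refine (hfb _ (by omega) X hX.le).trans ?_
      refine mul_le_mul ?_ ?_ (by positivity) (by positivity)
      · exact pow_le_pow_of_le_one (by norm_num) (by norm_num) (by omega)
      · exact pow_le_pow_of_le_one (norm_nonneg _) hX.le (by omega)
    have h6 := tsum_of_norm_bounded ((hasSum_geometric_two).mul_right (‖X - s‖ ^ N)) h5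
    exact h6
  have h7 : Sm.mk _ hu - ∑ k ∈ Finset.range N, p k =
      (Sm.mk _ hu - ∑ k ∈ Finset.range (N + 1), f k) +
        ∑ k ∈ Finset.range (N + 1), (f k - p k) + p N := by
    rw [Finset.sum_sub_distrib, Finset.sum_range_succ p]
    ring
  rw [h7]
  exact add_mem (add_mem h2 (sum_mem fun k _ => h1 k)) (Hom_le_I (hp N))

/-- Solution of an equation to infinite order at `s`, by successive homogeneous corrections. -/
theorem exists_formal_solution (Φ : Sm ι → Sm ι) (P : Sm ι → Prop) (n₀ : ℕ) (u₀ : Sm ι)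
    (hP : P u₀) (h₀ : Φ u₀ ∈ I s n₀)
    (step : ∀ N, n₀ ≤ N → ∀ u, u - u₀ ∈ I s n₀ → P u → Φ u ∈ I s N →
      ∃ q ∈ Hom s N, P (u + q) ∧ Φ (u + q) ∈ I s (N + 1)) :
    ∃ u : Sm ι, u - u₀ ∈ I s n₀ ∧ ∀ N, ∃ w : Sm ι, P w ∧ u - w ∈ I s N ∧ Φ w ∈ I s N := by
  choose! q hq hqP hqΦ using step
  let S : ℕ → Sm ι := fun k => Nat.rec u₀ (fun k u => u + q (n₀ + k) u) k
  have hS : ∀ k, S (k + 1) = S k + q (n₀ + k) (S k) := fun _ => rfl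
  have inv : ∀ k, S k - u₀ ∈ I s n₀ ∧ P (S k) ∧ Φ (S k) ∈ I s (n₀ + k) := by
    intro k
    induction k with
    | zero =>
      refine ⟨?_, hP, h₀⟩
      rw [show S 0 = u₀ from rfl, sub_self]
      exact zero_mem _
    | succ k ih =>
      obtain ⟨h1, h2, h3⟩ := ih
      have hk : n₀ ≤ n₀ + k := by omega
      refine ⟨?_, hS k ▸ hqP _ hk _ h1 h2 h3, hS k ▸ hqΦ _ hk _ h1 h2 h3⟩
      rw [hS, add_sub_right_comm]
      exact add_mem h1 (I_anti hk (Hom_le_I (hq _ hk _ h1 h2 h3)))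
  have hqk : ∀ k, q (n₀ + k) (S k) ∈ Hom s (n₀ + k) := fun k =>
    hq _ (by omega) _ (inv k).1 (inv k).2.1 (inv k).2.2
  -- The k-th Taylor component of the sought correction; the partial sums of these are exactly the
  -- successive approximations minus u₀.
  let p : ℕ → Sm ι := fun k => if k < n₀ then 0 else q k (S (k - n₀))
  have hp : ∀ k, p k ∈ Hom s k := by
    intro k
    by_cases hk : k < n₀
    · simp only [p, if_pos hk]; exact zero_mem _
    · have := hqk (k - n₀)
      rw [show n₀ + (k - n₀) = k by omega] at this
      simpa only [p, if_neg hk] using this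
  have hsum : ∀ m, ∑ k ∈ Finset.range (n₀ + m), p k = S m - u₀ := by
    intro m
    induction m with
    | zero =>
      rw [show S 0 = u₀ from rfl, sub_self]
      refine Finset.sum_eq_zero fun k hk => ?_
      simp only [p, if_pos (by simpa using hk : k < n₀)]
    | succ m ih =>
      rw [← add_assoc, Finset.sum_range_succ, ih, hS]
      simp only [p, if_neg (by omega : ¬ n₀ + m < n₀), Nat.add_sub_cancel_left]
      ring
  obtain ⟨w, hw⟩ := exists_borel_sum p hp
  -- The Borel sum need not satisfy P. It agrees to every order with approximations that do, and
  -- this is all that is claimed.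
  refine ⟨u₀ + w, ?_, fun N => ⟨S N, (inv N).2.1, ?_, I_anti (by omega) (inv N).2.2⟩⟩
  · have := hw n₀
    have h0 := hsum 0
    rw [add_zero] at h0
    rw [h0, show S 0 = u₀ from rfl, sub_self, sub_zero] at this
    simpa using this
  · have := hw (n₀ + N)
    rw [hsum] at this
    refine I_anti (show N ≤ n₀ + N by omega) ?_
    convert this using 1
    ring

end Borel

/-! ### Classical expansions in h and Borel summation in h. -/

section Expansion

variable {E F : Type} [NormedAddCommGroup E] [NormedSpace ℝ E]
    [NormedAddCommGroup F] [NormedSpace ℝ F]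

theorem norm_iteratedFDeriv_sum_le {c : ℕ → E → F} (hc : ∀ j, ContDiff ℝ ∞ (c j)) (A : Finset ℕ)
    {h : ℝ} (hh : 0 ≤ h) (k : ℕ) (X : E) :
    ‖iteratedFDeriv ℝ k (fun Y => ∑ j ∈ A, h ^ j • c j Y) X‖
      ≤ ∑ j ∈ A, h ^ j * ‖iteratedFDeriv ℝ k (c j) X‖ := by
  have hck : ∀ j, ContDiff ℝ k (c j) := fun j => (hc j).of_le (by exact_mod_cast le_top)
  have h1 : iteratedFDeriv ℝ k (fun Y => ∑ j ∈ A, h ^ j • c j Y) X =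
      ∑ j ∈ A, h ^ j • iteratedFDeriv ℝ k (c j) X := by
    refine (iteratedFDeriv_fun_sum_apply (f := fun j Y => h ^ j • c j Y) fun j _ =>
      ((hck j).const_smul (h ^ j)).contDiffAt).trans ?_
    exact Finset.sum_congr rfl fun j _ =>
      iteratedFDeriv_const_smul_apply' (hck j).contDiffAt
  rw [h1]
  refine (norm_sum_le _ _).trans (Finset.sum_le_sum fun j _ => ?_)
  rw [norm_smul, norm_pow, Real.norm_of_nonneg hh]

theorem exists_iteratedFDeriv_bound {c : E → F} (hc : ContDiff ℝ ∞ c) {K : Set E}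
    (hK : IsCompact K) (k : ℕ) : ∃ M, ∀ X ∈ K, ‖iteratedFDeriv ℝ k c X‖ ≤ M :=
  hK.exists_bound_of_continuousOn
    (hc.continuous_iteratedFDeriv (by exact_mod_cast le_top)).continuousOn

theorem sum_range_sub_sum_range_of_le {G : Type} [AddCommGroup G] (g : ℕ → G) {m n : ℕ}
    (h : m ≤ n) : ∑ j ∈ Finset.range n, g j - ∑ j ∈ Finset.range m, g j
      = ∑ j ∈ Finset.Ico m n, g j :=
  (Finset.sum_Ico_eq_sub g h).symm

/-- A polynomial in `h` with smooth coefficients is a classical expansion. -/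
theorem hasClassicalExpansion_of_finite {c : ℕ → E → F} (hc : ∀ j, ContDiff ℝ ∞ (c j)) (m : ℕ)
    (hm : ∀ j, m ≤ j → c j = 0) {h₀ : ℝ} :
    HasClassicalExpansion Set.univ h₀ (fun h X => ∑ j ∈ Finset.range m, h ^ j • c j X) c := by
  refine ⟨fun h _ => ?_, fun j => (hc j).contDiffOn, fun K _ hK N k => ?_⟩
  · exact (ContDiff.sum fun j _ => contDiff_const.smul (hc j)).contDiffOn
  · choose M hM using fun j => exists_iteratedFDeriv_bound (hc j) hK k
    refine ⟨∑ j ∈ Finset.Ico N m, h₀ ^ (j - N) * M j, fun h hh X hX => ?_⟩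
    have h1 : (fun Y => ∑ j ∈ Finset.range m, h ^ j • c j Y
        - ∑ j ∈ Finset.range N, h ^ j • c j Y) = fun Y => ∑ j ∈ Finset.Ico N m, h ^ j • c j Y := by
      ext Y
      rcases le_total N m with hNm | hNm
      · exact sum_range_sub_sum_range_of_le _ hNm
      · rw [← neg_sub, sum_range_sub_sum_range_of_le _ hNm, Finset.Ico_eq_empty_of_le hNm,
          Finset.sum_empty, neg_eq_zero]
        refine Finset.sum_eq_zero fun j hj => ?_
        rw [hm j (Finset.mem_Ico.1 hj).1]; simp
    rw [h1]
    refine (norm_iteratedFDeriv_sum_le hc _ hh.1.le k X).trans ?_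
    rw [Finset.sum_mul]
    refine Finset.sum_le_sum fun j hj => ?_
    have hjN : j = (j - N) + N := by have := (Finset.mem_Ico.1 hj).1; omega
    calc h ^ j * ‖iteratedFDeriv ℝ k (c j) X‖ ≤ (h ^ (j - N) * h ^ N) * M j := by
          rw [← pow_add, ← hjN]
          exact mul_le_mul_of_nonneg_left (hM j X hX) (pow_nonneg hh.1.le _)
      _ ≤ (h₀ ^ (j - N) * h ^ N) * M j := by
          have : 0 ≤ M j := (norm_nonneg _).trans (hM j X hX)
          have h2 : h ^ (j - N) ≤ h₀ ^ (j - N) := pow_le_pow_left₀ hh.1.le hh.2 _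
          have h3 := pow_nonneg hh.1.le N
          gcongr
      _ = _ := by ring

/-- Borel summation in the parameter `h`. -/
theorem exists_classical_sum [ProperSpace E] {c : ℕ → E → F} (hc : ∀ j, ContDiff ℝ ∞ (c j)) :
    ∃ ℓ : ℝ → E → F, HasClassicalExpansion Set.univ 1 ℓ c := by
  choose M hM using fun j k : ℕ => exists_iteratedFDeriv_bound (hc j)
    (isCompact_closedBall (0 : E) (j : ℝ)) k
  let B : ℕ → ℝ := fun j => 1 + ∑ k ∈ Finset.range (j + 1), |M j k|
  have hB1 : ∀ j, 1 ≤ B j := fun j => by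
    have : 0 ≤ ∑ k ∈ Finset.range (j + 1), |M j k| := Finset.sum_nonneg fun i _ => abs_nonneg _
    simp only [B]; linarith
  have hMB : ∀ j k, k ≤ j → M j k ≤ B j := by
    intro j k hk
    have h1 : |M j k| ≤ ∑ k ∈ Finset.range (j + 1), |M j k| :=
      Finset.single_le_sum (f := fun k => |M j k|) (fun i _ => abs_nonneg _)
        (Finset.mem_range.2 (by omega))
    simp only [B]
    linarith [le_abs_self (M j k)]
  -- B j bounds the derivatives of order at most j of c j on the ball of radius j. Keeping the j-th
  -- term only when h < ε j gives h · B j ≤ 2^{-j}: one power of h pays for the size of the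
  -- coefficient.
  let ε : ℕ → ℝ := fun j => (1 / 2) ^ j / B j
  have hε0 : ∀ j, 0 < ε j := fun j => div_pos (by positivity) (by linarith [hB1 j])
  have hεB : ∀ j, ε j * B j = (1 / 2) ^ j := fun j =>
    div_mul_cancel₀ _ (by linarith [hB1 j])
  have hεle : ∀ j, ε j ≤ (1 / 2) ^ j := fun j => div_le_self (by positivity) (hB1 j)
  have hex : ∀ h : ℝ, 0 < h → ∃ j, ε j ≤ h := fun h hh => by
    obtain ⟨j, hj⟩ := exists_pow_lt_of_lt_one hh (by norm_num : (1 / 2 : ℝ) < 1)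
    exact ⟨j, (hεle j).trans hj.le⟩
  -- J is the first index with ε J ≤ h; the sum is truncated there, so it is finite for each h. The
  -- value for h ≤ 0 is irrelevant.
  have hJ : ∀ h : ℝ, ∃ J : ℕ, 0 < h → ε J ≤ h ∧ ∀ i < J, h < ε i := by
    intro h
    by_cases hh : 0 < h
    · classical
      exact ⟨Nat.find (hex h hh), fun _ => ⟨Nat.find_spec (hex h hh), fun i hi =>
        not_le.1 (Nat.find_min (hex h hh) hi)⟩⟩
    · exact ⟨0, fun h' => absurd h' hh⟩
  choose J hJ using hJ
  refine ⟨fun h X => ∑ j ∈ Finset.range (J h), h ^ j • c j X,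
    fun h _ => (ContDiff.sum fun j _ => contDiff_const.smul (hc j)).contDiffOn,
    fun j => (hc j).contDiffOn, fun K _ hK N k => ?_⟩
  obtain ⟨R, hR⟩ := hK.isBounded.subset_closedBall (0 : E)
  obtain ⟨R', hR'⟩ := exists_nat_ge R
  choose A hA using fun j => exists_iteratedFDeriv_bound (hc j) hK k
  -- From index m on, the j-th ball contains K, the order k of differentiation is covered by B j,
  -- and h^j leaves a spare factor h beyond h^N.
  set m : ℕ := max (N + 1) (max k R') with hm
  let b : ℕ → ℝ := fun j => (if j < m then |A j| else 0) + (1 / 2) ^ j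
  have hb0 : ∀ j, 0 ≤ b j := fun j => by simp only [b]; split_ifs <;> positivity
  have hbs : Summable b := by
    refine Summable.add ?_ summable_geometric_two
    refine summable_of_ne_finset_zero (s := Finset.range m) fun j hj => ?_
    rw [if_neg (by simpa using hj)]
  set A' : ℝ := ∑ j ∈ Finset.range N, |A j| with hA'
  have hA'0 : 0 ≤ A' := Finset.sum_nonneg fun _ _ => abs_nonneg _
  set e : ℝ := ∑ i ∈ Finset.range N, ((ε i)⁻¹) ^ N with he
  have he0 : 0 ≤ e := Finset.sum_nonneg fun i _ => pow_nonneg (inv_nonneg.2 (hε0 i).le) _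
  refine ⟨∑' j, b j + A' * e, fun h hh X hX => ?_⟩
  obtain ⟨hJ1, hJ2⟩ := hJ h hh.1
  have hAX : ∀ j, ‖iteratedFDeriv ℝ k (c j) X‖ ≤ |A j| := fun j =>
    (hA j X hX).trans (le_abs_self _)
  have hhN : 0 ≤ h ^ N := pow_nonneg hh.1.le N
  rw [add_mul]
  rcases le_or_gt N (J h) with hNJ | hNJ
  · have h1 : (fun Y => ∑ j ∈ Finset.range (J h), h ^ j • c j Y
        - ∑ j ∈ Finset.range N, h ^ j • c j Y)
        = fun Y => ∑ j ∈ Finset.Ico N (J h), h ^ j • c j Y := by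
      ext Y; exact sum_range_sub_sum_range_of_le _ hNJ
    rw [h1]
    refine (norm_iteratedFDeriv_sum_le hc _ hh.1.le k X).trans ?_
    have h2 : ∀ j ∈ Finset.Ico N (J h), h ^ j * ‖iteratedFDeriv ℝ k (c j) X‖ ≤ b j * h ^ N := by
      intro j hj
      rw [Finset.mem_Ico] at hj
      by_cases hjm : j < m
      · have h3 : h ^ j ≤ h ^ N := pow_le_pow_of_le_one hh.1.le hh.2 hj.1
        have h4 : |A j| ≤ b j := by simp only [b, if_pos hjm]; linarith [show (0:ℝ) ≤ (1/2)^j by positivity]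
        rw [mul_comm]
        exact mul_le_mul ((hAX j).trans h4) h3 (pow_nonneg hh.1.le _) (hb0 j)
      · have hjk : k ≤ j := by
          have := le_max_right (N + 1) (max k R'); have := le_max_left k R'; omega
        have hjR : R' ≤ j := by
          have := le_max_right (N + 1) (max k R'); have := le_max_right k R'; omega
        have hjN : N + 1 ≤ j := by have := le_max_left (N + 1) (max k R'); omega
        have hXj : X ∈ Metric.closedBall (0 : E) (j : ℝ) :=
          Metric.closedBall_subset_closedBall (hR'.trans (by exact_mod_cast hjR)) (hR hX)
        have h3 : ‖iteratedFDeriv ℝ k (c j) X‖ ≤ B j := (hM j k X hXj).trans (hMB j k hjk)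
        have h4 : h * B j ≤ (1 / 2) ^ j := by
          rw [← hεB j]
          exact mul_le_mul_of_nonneg_right (hJ2 j hj.2).le (by linarith [hB1 j])
        have h5 : h ^ j ≤ h ^ N * h := by
          rw [← pow_succ]; exact pow_le_pow_of_le_one hh.1.le hh.2 hjN
        have h6 : (1 / 2 : ℝ) ^ j ≤ b j := by simp only [b, if_neg hjm]; linarith
        calc h ^ j * ‖iteratedFDeriv ℝ k (c j) X‖ ≤ (h ^ N * h) * B j :=
              mul_le_mul h5 h3 (norm_nonneg _) (mul_nonneg hhN hh.1.le)
          _ = (h * B j) * h ^ N := by ring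
          _ ≤ b j * h ^ N := mul_le_mul_of_nonneg_right (h4.trans h6) hhN
    refine (Finset.sum_le_sum h2).trans ?_
    rw [← Finset.sum_mul]
    have h7 : ∑ j ∈ Finset.Ico N (J h), b j ≤ ∑' j, b j :=
      hbs.sum_le_tsum _ fun j _ => hb0 j
    have h8 : 0 ≤ A' * e * h ^ N := by positivity
    have h9 := mul_le_mul_of_nonneg_right h7 hhN
    linarith
  -- The sum stops before N. Then h ≥ ε (J h) with J h < N, so h is bounded below, 1 ≤ e h^N, and
  -- the finitely many missing terms are absorbed in the constant.
  · have h1 : (fun Y => ∑ j ∈ Finset.range (J h), h ^ j • c j Y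
        - ∑ j ∈ Finset.range N, h ^ j • c j Y)
        = -fun Y => ∑ j ∈ Finset.Ico (J h) N, h ^ j • c j Y := by
      ext Y
      rw [← neg_sub, sum_range_sub_sum_range_of_le _ hNJ.le]; rfl
    rw [h1, iteratedFDeriv_neg_apply, norm_neg]
    refine (norm_iteratedFDeriv_sum_le hc _ hh.1.le k X).trans ?_
    have h2 : ∑ j ∈ Finset.Ico (J h) N, h ^ j * ‖iteratedFDeriv ℝ k (c j) X‖ ≤ A' := by
      refine (Finset.sum_le_sum fun j _ => ?_).trans
        (Finset.sum_le_sum_of_subset_of_nonneg (f := fun j => |A j|) (t := Finset.range N)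
          (fun j hj => ?_) fun _ _ _ => abs_nonneg _)
      · exact mul_le_of_le_one_left (norm_nonneg _) (pow_le_one₀ hh.1.le hh.2) |>.trans (hAX j)
      · rw [Finset.mem_Ico] at hj; exact Finset.mem_range.2 hj.2
    have h3 : 1 ≤ e * h ^ N := by
      have h4 : ((ε (J h))⁻¹) ^ N ≤ e :=
        Finset.single_le_sum (f := fun i => ((ε i)⁻¹) ^ N)
          (fun i _ => pow_nonneg (inv_nonneg.2 (hε0 i).le) _) (Finset.mem_range.2 hNJ)
      have h5 : 1 ≤ ((ε (J h))⁻¹ * h) ^ N := by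
        refine one_le_pow₀ ?_
        rw [inv_mul_eq_div, le_div_iff₀ (hε0 _), one_mul]
        exact hJ1
      rw [mul_pow] at h5
      exact h5.trans (mul_le_mul_of_nonneg_right h4 hhN)
    have h6 : 0 ≤ (∑' j, b j) * h ^ N := mul_nonneg (tsum_nonneg hb0) hhN
    have h7 : A' ≤ A' * (e * h ^ N) := le_mul_of_one_le_right hA'0 h3
    calc _ ≤ A' := h2
      _ ≤ A' * (e * h ^ N) := h7
      _ = A' * e * h ^ N := by ring
      _ ≤ _ := by linarith

end Expansion

/-! ### Chain rules on the phase space and derivatives of the energy. -/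

section Calculus

variable {ι : Type} [Fintype ι] [DecidableEq ι]

/-- Composition of a smooth function with a smooth function of one real variable. -/
def Sm.post (g : ℝ → ℝ) (hg : ContDiff ℝ ∞ g) (u : Sm ι) : Sm ι :=
  Sm.mk (fun X => g (u.1 X)) (hg.comp u.contDiff)

@[simp] theorem Sm.post_apply (g : ℝ → ℝ) (hg : ContDiff ℝ ∞ g) (u : Sm ι) (X) :
    (Sm.post g hg u).1 X = g (u.1 X) := rfl

theorem D_post {g g' : ℝ → ℝ} (hg : ContDiff ℝ ∞ g) (hg' : ContDiff ℝ ∞ g')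
    (h : ∀ t, HasDerivAt g (g' t) t) (u : Sm ι) (i : ι) :
    D i (Sm.post g hg u) = Sm.post g' hg' u * D i u := by
  ext X
  have h1 := (h (u.1 X)).comp_hasFDerivAt X (u.differentiable X).hasFDerivAt
  have h2 : pd i (Sm.post g hg u).1 X = _ := pd_eq_of_hasFDerivAt h1 i
  rw [D_apply, h2]
  simp [pd]

variable {d d' : ℕ}

theorem xPart_add (X Y : Phase d d') : xPart (X + Y) = xPart X + xPart Y := rfl
theorem xPart_smul (c : ℝ) (X : Phase d d') : xPart (c • X) = c • xPart X := rfl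

/-- The position component, as a continuous linear map. -/
def xPartL (d d' : ℕ) : Phase d d' →L[ℝ] EuclideanSpace ℝ (Fin d) :=
  LinearMap.toContinuousLinearMap
    { toFun := xPart, map_add' := xPart_add, map_smul' := xPart_smul }

@[simp] theorem xPartL_apply (X : Phase d d') : xPartL d d' X = xPart X := rfl

theorem contDiff_xPart : ContDiff ℝ ∞ (xPart : Phase d d' → _) := (xPartL d d').contDiff

theorem xPart_single_inl (i : Fin d) :
    xPart (EuclideanSpace.single (Sum.inl i) 1 : Phase d d') = EuclideanSpace.single i 1 := by
  ext k
  simp [xPart]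

theorem xPart_single_inr (j : Fin d') :
    xPart (EuclideanSpace.single (Sum.inr j) 1 : Phase d d') = 0 := by
  ext k
  simp [xPart]

/-- A smooth function of the position, on the phase space. -/
def liftX (V : EuclideanSpace ℝ (Fin d) → ℝ) (hV : ContDiff ℝ ∞ V) : Sm (Fin d ⊕ Fin d') :=
  Sm.mk (fun X => V (xPart X)) (hV.comp contDiff_xPart)

@[simp] theorem liftX_apply (V : EuclideanSpace ℝ (Fin d) → ℝ) (hV : ContDiff ℝ ∞ V)
    (X : Phase d d') : (liftX (d' := d') V hV).1 X = V (xPart X) := rfl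

theorem hasFDerivAt_comp_xPart {V : EuclideanSpace ℝ (Fin d) → ℝ} (hV : ContDiff ℝ ∞ V)
    (X : Phase d d') :
    HasFDerivAt (fun X => V (xPart X)) ((fderiv ℝ V (xPart X)).comp (xPartL d d')) X :=
  (hV.differentiable (by simp) (xPart X)).hasFDerivAt.comp X (xPartL d d').hasFDerivAt

theorem D_inl_liftX {V : EuclideanSpace ℝ (Fin d) → ℝ} (hV : ContDiff ℝ ∞ V) (i : Fin d) :
    D (Sum.inl i) (liftX (d' := d') V hV) = liftX (pd i V) (contDiff_pd hV i) := by
  ext X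
  refine (pd_eq_of_hasFDerivAt (hasFDerivAt_comp_xPart hV X) _).trans ?_
  simp [xPart_single_inl, pd]

theorem D_inr_liftX {V : EuclideanSpace ℝ (Fin d) → ℝ} (hV : ContDiff ℝ ∞ V) (j : Fin d') :
    D (Sum.inr j) (liftX (d' := d') V hV) = 0 := by
  ext X
  refine (pd_eq_of_hasFDerivAt (hasFDerivAt_comp_xPart hV X) _).trans ?_
  simp [xPart_single_inr]

/-- The coordinate functions. -/
abbrev coo (i : ι) : Sm ι := coord 0 i

variable (Sg : Matrix (Fin d') (Fin d') ℝ)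

/-- The components of `ΣᵀΣ v`. -/
def fric (d : ℕ) (j : Fin d') : Sm (Fin d ⊕ Fin d') :=
  ∑ k, (Sg.transpose * Sg) j k • coo (Sum.inr k)

theorem fric_apply (j : Fin d') (X : Phase d d') : (fric Sg d j).1 X = frictionVec Sg X j := by
  simp [fric, frictionVec, Matrix.mulVec, dotProduct]

theorem D_inr_fric (j k : Fin d') :
    D (Sum.inr k) (fric Sg d j) = algebraMap ℝ _ ((Sg.transpose * Sg) j k) := by
  simp only [fric, map_sum, Derivation.map_smul, D_coord, Sum.inr.injEq, smul_ite, smul_zero]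
  rw [Finset.sum_ite_eq]
  simp [Algebra.algebraMap_eq_smul_one]

theorem D_inl_fric (j : Fin d') (i : Fin d) : D (Sum.inl i) (fric Sg d j) = 0 := by
  simp [fric, D_coord]

/-- The energy `f` as a smooth function. -/
def en {V : EuclideanSpace ℝ (Fin d) → ℝ} (hV : ContDiff ℝ ∞ V) : Sm (Fin d ⊕ Fin d') :=
  liftX V hV + ∑ j, coo (Sum.inr j) * fric Sg d j

theorem en_eq {V : EuclideanSpace ℝ (Fin d) → ℝ} (hV : ContDiff ℝ ∞ V) :
    (en Sg hV).1 = energy Sg V := by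
  ext X
  simp only [en, energy, Sm.add_apply, liftX_apply, Sm.sum_apply, Sm.mul_apply, coord_apply,
    fric_apply, frictionVec]
  congr 1
  set v : Fin d' → ℝ := fun j => X (Sum.inr j)
  have h1 : ∑ i, (Sg.mulVec v i) ^ 2 = dotProduct (Sg.mulVec v) (Sg.mulVec v) := by
    simp [dotProduct, sq]
  rw [h1, Matrix.dotProduct_mulVec, Matrix.vecMul_mulVec, dotProduct_comm,
    ← Matrix.mulVec_transpose, Matrix.transpose_mul, Matrix.transpose_transpose]
  simp [dotProduct, v]

theorem D_inl_en {V : EuclideanSpace ℝ (Fin d) → ℝ} (hV : ContDiff ℝ ∞ V) (i : Fin d) :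
    D (Sum.inl i) (en Sg hV) = liftX (pd i V) (contDiff_pd hV i) := by
  simp [en, D_inl_liftX, D_coord, D_inl_fric]

theorem gram_symm (j k : Fin d') : (Sg.transpose * Sg) j k = (Sg.transpose * Sg) k j := by
  have : (Sg.transpose * Sg).transpose = Sg.transpose * Sg := by simp
  conv_lhs => rw [← this]
  rfl

theorem D_inr_en {V : EuclideanSpace ℝ (Fin d) → ℝ} (hV : ContDiff ℝ ∞ V) (j : Fin d') :
    D (Sum.inr j) (en Sg hV) = (2 : ℝ) • fric Sg d j := by
  simp only [en, map_add, D_inr_liftX, map_sum, D_mul, D_coord, D_inr_fric, zero_add,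
    Sum.inr.injEq, mul_ite, mul_one, mul_zero]
  rw [Finset.sum_add_distrib, Finset.sum_ite_eq]
  simp only [Finset.mem_univ, if_true, two_smul]
  congr 1
  rw [fric]
  refine Finset.sum_congr rfl fun k _ => ?_
  rw [gram_symm, mul_comm, ← Algebra.smul_def]

end Calculus

/-! ### Conjugation of the operator by the Gaussian quasimode. -/

section

variable {d d' : ℕ}

/-- The coefficient of `P (χ e^{-f/h})`. -/
def wkbW (Sg : Matrix (Fin d') (Fin d') ℝ) (h : ℝ) (a : Phase d d' → EuclideanSpace ℝ (Fin d))
    (b : Phase d d' → EuclideanSpace ℝ (Fin d')) (u : Phase d d' → ℝ) (X : Phase d d') : ℝ :=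
  dotDx (a X) u X + dotDv (b X) u X + 4 * dotDv (frictionVec Sg X) u X
    + u X * gradVDot u u X - h * lapV u X

theorem exists_primitive {g : ℝ → ℝ} (hg : ContDiff ℝ ∞ g) :
    ContDiff ℝ ∞ (fun y => ∫ t in (0 : ℝ)..y, g t) ∧
      ∀ y, HasDerivAt (fun y => ∫ t in (0 : ℝ)..y, g t) (g y) y := by
  have h1 : ∀ y, HasDerivAt (fun y => ∫ t in (0 : ℝ)..y, g t) (g y) y := fun y =>
    intervalIntegral.integral_hasDerivAt_right (hg.continuous.intervalIntegrable _ _)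
      (hg.continuous.stronglyMeasurableAtFilter _ _) hg.continuous.continuousAt
  refine ⟨?_, h1⟩
  rw [contDiff_infty_iff_deriv]
  refine ⟨fun y => (h1 y).differentiableAt, ?_⟩
  rwa [show deriv (fun y => ∫ t in (0 : ℝ)..y, g t) = g from funext fun y => (h1 y).deriv]

/-- Terms with χ undifferentiated cancel: the skew relation removes those of the transport part, and
the zeroth-order terms of N are exactly those produced by -h²Δ_v on e^{-f/h}. In the rest, ∂χ =
g(ℓ)∂ℓ with g(t) = ζ(t/τ)e^{-t²/(2h)}; the factor -t/h in g' creates ℓ|∂_vℓ|², and the derivative of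
ζ creates the last term. -/
theorem kineticOp_chi {Sg : Matrix (Fin d') (Fin d') ℝ} {V : EuclideanSpace ℝ (Fin d) → ℝ}
    (hV : ContDiff ℝ ∞ V) {h : ℝ} (hh : 0 < h) {a : Phase d d' → EuclideanSpace ℝ (Fin d)}
    {b : Phase d d' → EuclideanSpace ℝ (Fin d')} (hskew : SkewRelation Sg V h a b)
    {ζ : ℝ → ℝ} (hζ : ContDiff ℝ ∞ ζ) {τ : ℝ} {ℓ : Phase d d' → ℝ}
    (hℓ : ContDiff ℝ ∞ ℓ) (X : Phase d d') :
    kineticOp Sg h a b (fun Y => chi ζ τ h ℓ Y * Real.exp (-energy Sg V Y / h)) X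
      = h * Real.exp (-(energy Sg V X + ℓ X ^ 2 / 2) / h) *
        (ζ (ℓ X / τ) * wkbW Sg h a b ℓ X
          - h * (deriv ζ (ℓ X / τ) / τ) * gradVDot ℓ ℓ X) := by
  set g : ℝ → ℝ := fun t => ζ (t / τ) * Real.exp (-t ^ 2 / (2 * h)) with hg
  have hgs : ContDiff ℝ ∞ g := by
    refine (hζ.comp (contDiff_id.div_const τ)).mul ?_
    exact Real.contDiff_exp.comp (by fun_prop)
  have hζ' : ContDiff ℝ ∞ (deriv ζ) := (contDiff_infty_iff_deriv.1 hζ).2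
  set g' : ℝ → ℝ := fun t => (deriv ζ (t / τ) / τ - ζ (t / τ) * (t / h)) *
    Real.exp (-t ^ 2 / (2 * h)) with hg'
  have hgs' : ContDiff ℝ ∞ g' := by
    refine (((hζ'.comp (contDiff_id.div_const τ)).div_const τ).sub
      ((hζ.comp (contDiff_id.div_const τ)).mul (contDiff_id.div_const h))).mul ?_
    exact Real.contDiff_exp.comp (by fun_prop)
  have hgd : ∀ t, HasDerivAt g (g' t) t := by
    intro t
    have h1 : HasDerivAt (fun t => ζ (t / τ)) (deriv ζ (t / τ) * (1 / τ)) t :=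
      ((hζ.differentiable (by simp) (t / τ)).hasDerivAt).comp t ((hasDerivAt_id t).div_const τ)
    have h2 : HasDerivAt (fun t : ℝ => Real.exp (-t ^ 2 / (2 * h)))
        (Real.exp (-t ^ 2 / (2 * h)) * (-(2 * t) / (2 * h))) t := by
      have h3 : HasDerivAt (fun t : ℝ => -t ^ 2 / (2 * h)) (-(2 * t) / (2 * h)) t := by
        simpa using ((hasDerivAt_pow 2 t).neg).div_const (2 * h)
      exact h3.exp
    refine (h1.mul h2).congr_deriv ?_
    simp only [hg']
    field_simp
    ring
  obtain ⟨hGs, hGd⟩ := exists_primitive hgs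
  set G : ℝ → ℝ := fun y => ∫ t in (0 : ℝ)..y, g t with hG
  let L : Sm (Fin d ⊕ Fin d') := Sm.mk ℓ hℓ
  let F : Sm (Fin d ⊕ Fin d') := en Sg hV
  let χ := Sm.post G hGs L
  let e := Sm.post Real.exp Real.contDiff_exp ((-h⁻¹) • F)
  have he : ∀ i, D i e = (-h⁻¹) • (e * D i F) := fun i => by
    rw [D_post Real.contDiff_exp Real.contDiff_exp Real.hasDerivAt_exp, Derivation.map_smul,
      mul_smul_comm]
  have hχ : ∀ i, D i χ = Sm.post g hgs L * D i L := fun i => D_post _ _ hGd L i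
  have hg1 : ∀ i, D i (Sm.post g hgs L) = Sm.post g' hgs' L * D i L :=
    fun i => D_post _ _ hgd L i
  have hu : (fun Y => chi ζ τ h ℓ Y * Real.exp (-energy Sg V Y / h)) = (χ * e).1 := by
    ext Y
    simp only [chi, Sm.mul_apply, χ, e, Sm.post_apply, Sm.smul_apply, F, en_eq, L, Sm.mk_apply]
    congr 2
    ring
  have hD : ∀ i, D i (χ * e) = (Sm.post g hgs L * e) * D i L + (-h⁻¹) • ((χ * e) * D i F) := by
    intro i
    rw [D_mul, he, hχ]
    simp only [Algebra.smul_def]; ring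
  have hD2 : ∀ i, D i (D i (χ * e)) = (Sm.post g' hgs' L * e) * (D i L * D i L)
      + (Sm.post g hgs L * e) * D i (D i L)
      + (-(2 * h⁻¹)) • (Sm.post g hgs L * e * (D i L * D i F))
      + (h⁻¹ * h⁻¹) • ((χ * e) * (D i F * D i F)) + (-h⁻¹) • ((χ * e) * D i (D i F)) := by
    intro i
    rw [hD, map_add, Derivation.map_smul, D_mul, D_mul _ (χ * e), hD, D_mul, hg1, he]
    simp only [Algebra.smul_def, map_neg, map_mul, map_ofNat]
    ring
  have hLv : L.1 = ℓ := rfl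
  have hpd1 : ∀ i, pd i (χ * e).1 X =
      (g (ℓ X) * e.1 X) * pd i ℓ X + (-h⁻¹) * (((χ * e).1 X) * (D i F).1 X) := fun i => by
    exact congrArg (fun u : Sm _ => u.1 X) (hD i)
  have hpd2 : ∀ i, pd i (pd i (χ * e).1) X = (g' (ℓ X) * e.1 X) * (pd i ℓ X * pd i ℓ X)
      + (g (ℓ X) * e.1 X) * pd i (pd i ℓ) X
      + (-(2 * h⁻¹)) * ((g (ℓ X) * e.1 X) * (pd i ℓ X * (D i F).1 X))
      + (h⁻¹ * h⁻¹) * ((χ * e).1 X * ((D i F).1 X * (D i F).1 X))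
      + (-h⁻¹) * ((χ * e).1 X * (D i (D i F)).1 X) := fun i => by
    exact congrArg (fun u : Sm _ => u.1 X) (hD2 i)
  have hFx : ∀ i : Fin d, (D (Sum.inl i) F).1 X = pd i V (xPart X) := fun i => by
    rw [D_inl_en]; rfl
  have hFv : ∀ j : Fin d', (D (Sum.inr j) F).1 X = 2 * frictionVec Sg X j := fun j => by
    rw [D_inr_en, Sm.smul_apply, fric_apply]
  have hFvv : ∀ j : Fin d', (D (Sum.inr j) (D (Sum.inr j) F)).1 X
      = 2 * (Sg.transpose * Sg) j j := fun j => by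
    rw [D_inr_en, Derivation.map_smul, D_inr_fric]; rfl
  set U := (χ * e).1 X with hU
  set ge := g (ℓ X) * e.1 X with hge
  have e1 : dotDx (a X) (χ * e).1 X = ge * dotDx (a X) ℓ X
      - h⁻¹ * U * ∑ i, a X i * pd i V (xPart X) := by
    simp only [dotDx, hpd1, hFx, Finset.mul_sum, ← Finset.sum_sub_distrib]
    exact Finset.sum_congr rfl fun i _ => by ring
  have e2 : dotDv (b X) (χ * e).1 X = ge * dotDv (b X) ℓ X
      - 2 * h⁻¹ * U * ∑ j, b X j * frictionVec Sg X j := by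
    simp only [dotDv, hpd1, hFv, Finset.mul_sum, ← Finset.sum_sub_distrib]
    exact Finset.sum_congr rfl fun i _ => by ring
  have e3 : lapV (χ * e).1 X = (g' (ℓ X) * e.1 X) * gradVDot ℓ ℓ X + ge * lapV ℓ X
      - 4 * h⁻¹ * ge * dotDv (frictionVec Sg X) ℓ X
      + 4 * (h⁻¹ * h⁻¹) * U * ∑ j, frictionVec Sg X j ^ 2
      - 2 * h⁻¹ * U * (Sg.transpose * Sg).trace := by
    simp only [lapV, hpd2, hFv, hFvv, gradVDot, dotDv, Matrix.trace, Matrix.diag_apply,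
      Finset.mul_sum, ← Finset.sum_sub_distrib, ← Finset.sum_add_distrib]
    exact Finset.sum_congr rfl fun i _ => by ring
  have hee : Real.exp (-(energy Sg V X + ℓ X ^ 2 / 2) / h)
      = e.1 X * Real.exp (-ℓ X ^ 2 / (2 * h)) := by
    simp only [e, Sm.post_apply, Sm.smul_apply, F, en_eq]
    rw [← Real.exp_add]
    congr 1
    field_simp
    ring
  have hs := hskew X
  -- The skew relation trades the divergence for the first-order terms in ∇f, which then cancel
  -- those coming from e^{-f/h}.
  have hs' : divXV a b X * (h / 2) = (∑ i, a X i * pd i V (xPart X))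
      + 2 * (∑ j, b X j * frictionVec Sg X j) := by linarith
  rw [hu, hee, kineticOp, e1, e2, e3]
  have hne := hh.ne'
  have e4 : h / 2 * divXV a b X * (χ * e).1 X = ((∑ i, a X i * pd i V (xPart X))
      + 2 * (∑ j, b X j * frictionVec Sg X j)) * U := by rw [← hs']; ring
  rw [e4]
  simp only [wkbW, hge, hg, hg']
  field_simp
  ring

end

/-! ### Algebra of uniform asymptotic expansions. -/

section Asymptotics

/-- The family `g h` of functions has on `K` the uniform asymptotic expansion `∑ h^j c_j`. -/
def Asym {E : Type} (h₁ : ℝ) (K : Set E) (g : ℝ → E → ℝ) (c : ℕ → E → ℝ) : Prop :=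
  (∀ j, ∃ B : ℝ, ∀ X ∈ K, |c j X| ≤ B) ∧
    ∀ N, ∃ C : ℝ, ∀ h ∈ Set.Ioc 0 h₁, ∀ X ∈ K,
      |g h X - ∑ j ∈ Finset.range N, h ^ j * c j X| ≤ C * h ^ N

variable {E : Type} {h₁ : ℝ} {K : Set E} {g k : ℝ → E → ℝ} {c e : ℕ → E → ℝ}

theorem Asym.add (hg : Asym h₁ K g c) (hk : Asym h₁ K k e) :
    Asym h₁ K (fun h X => g h X + k h X) (fun j X => c j X + e j X) := by
  refine ⟨fun j => ?_, fun N => ?_⟩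
  · obtain ⟨B, hB⟩ := hg.1 j
    obtain ⟨B', hB'⟩ := hk.1 j
    exact ⟨B + B', fun X hX => (abs_add_le _ _).trans (add_le_add (hB X hX) (hB' X hX))⟩
  · obtain ⟨B, hB⟩ := hg.2 N
    obtain ⟨B', hB'⟩ := hk.2 N
    refine ⟨B + B', fun h hh X hX => ?_⟩
    have h1 : g h X + k h X - ∑ j ∈ Finset.range N, h ^ j * (c j X + e j X)
        = (g h X - ∑ j ∈ Finset.range N, h ^ j * c j X)
          + (k h X - ∑ j ∈ Finset.range N, h ^ j * e j X) := by
      simp only [mul_add, Finset.sum_add_distrib]; ring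
    rw [h1, add_mul]
    exact (abs_add_le _ _).trans (add_le_add (hB h hh X hX) (hB' h hh X hX))

theorem Asym.bounded (hg : Asym h₁ K g c) :
    ∃ C : ℝ, ∀ h ∈ Set.Ioc 0 h₁, ∀ X ∈ K, |g h X| ≤ C := by
  obtain ⟨C, hC⟩ := hg.2 0
  exact ⟨C, fun h hh X hX => by simpa using hC h hh X hX⟩

theorem Asym.const_mul {a : E → ℝ} (ha : ∃ B : ℝ, ∀ X ∈ K, |a X| ≤ B) (hg : Asym h₁ K g c) :
    Asym h₁ K (fun h X => a X * g h X) (fun j X => a X * c j X) := by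
  obtain ⟨A, hA⟩ := ha
  refine ⟨fun j => ?_, fun N => ?_⟩
  · obtain ⟨B, hB⟩ := hg.1 j
    refine ⟨A * B, fun X hX => ?_⟩
    rw [abs_mul]
    exact mul_le_mul (hA X hX) (hB X hX) (abs_nonneg _) ((abs_nonneg _).trans (hA X hX))
  · obtain ⟨B, hB⟩ := hg.2 N
    refine ⟨A * B, fun h hh X hX => ?_⟩
    have h1 : a X * g h X - ∑ j ∈ Finset.range N, h ^ j * (a X * c j X)
        = a X * (g h X - ∑ j ∈ Finset.range N, h ^ j * c j X) := by
      rw [mul_sub, Finset.mul_sum]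
      congr 1
      exact Finset.sum_congr rfl fun _ _ => by ring
    rw [h1, abs_mul, mul_assoc]
    exact mul_le_mul (hA X hX) (hB h hh X hX) (abs_nonneg _) ((abs_nonneg _).trans (hA X hX))

theorem Asym.zero : Asym h₁ K (fun _ _ => 0) (fun _ _ => 0) :=
  ⟨fun _ => ⟨0, fun _ _ => by simp⟩, fun _ => ⟨0, fun _ _ _ _ => by simp⟩⟩

theorem Asym.sum {κ : Type} (A : Finset κ) {g : κ → ℝ → E → ℝ} {c : κ → ℕ → E → ℝ}
    (hg : ∀ i, Asym h₁ K (g i) (c i)) :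
    Asym h₁ K (fun h X => ∑ i ∈ A, g i h X) (fun j X => ∑ i ∈ A, c i j X) := by
  classical
  induction A using Finset.induction_on with
  | empty => simpa using Asym.zero
  | insert i A hi ih =>
    simp only [Finset.sum_insert hi]
    exact (hg i).add ih

theorem Asym.tail (hg : Asym h₁ K g c) :
    Asym h₁ K (fun h X => (g h X - c 0 X) / h) (fun j => c (j + 1)) := by
  refine ⟨fun j => hg.1 (j + 1), fun N => ?_⟩
  obtain ⟨C, hC⟩ := hg.2 (N + 1)
  refine ⟨C, fun h hh X hX => ?_⟩
  have h1 := hC h hh X hX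
  rw [Finset.sum_range_succ'] at h1
  have h2 : g h X - (∑ j ∈ Finset.range N, h ^ (j + 1) * c (j + 1) X + h ^ 0 * c 0 X)
      = h * ((g h X - c 0 X) / h - ∑ j ∈ Finset.range N, h ^ j * c (j + 1) X) := by
    rw [mul_sub, mul_div_cancel₀ _ hh.1.ne', Finset.mul_sum]
    have : ∑ j ∈ Finset.range N, h ^ (j + 1) * c (j + 1) X
        = ∑ j ∈ Finset.range N, h * (h ^ j * c (j + 1) X) :=
      Finset.sum_congr rfl fun _ _ => by ring
    rw [this]; ring
  rw [h2, abs_mul, abs_of_pos hh.1, pow_succ] at h1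
  refine le_of_mul_le_mul_left (h1.trans (le_of_eq ?_)) hh.1
  ring

/-- Write g = c₀ + hg₁ and k = e₀ + hk₁. Then gk - c₀e₀ = h(c₀k₁ + g₁k), and the induction
hypothesis applies to the product g₁k with the same second factor. -/
theorem Asym.mul_bound (N : ℕ) : ∀ {g k : ℝ → E → ℝ} {c e : ℕ → E → ℝ}, Asym h₁ K g c →
    Asym h₁ K k e → ∃ C : ℝ, ∀ h ∈ Set.Ioc 0 h₁, ∀ X ∈ K,
      |g h X * k h X - ∑ j ∈ Finset.range N, h ^ j *
        ∑ p ∈ Finset.HasAntidiagonal.antidiagonal j, c p.1 X * e p.2 X| ≤ C * h ^ N := by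
  induction N with
  | zero =>
    intro g k c e hg hk
    obtain ⟨B, hB⟩ := hg.bounded
    obtain ⟨B', hB'⟩ := hk.bounded
    refine ⟨B * B', fun h hh X hX => ?_⟩
    simp only [Finset.range_zero, Finset.sum_empty, sub_zero, pow_zero, mul_one, abs_mul]
    exact mul_le_mul (hB h hh X hX) (hB' h hh X hX) (abs_nonneg _)
      ((abs_nonneg _).trans (hB h hh X hX))
  | succ N ih =>
    intro g k c e hg hk
    obtain ⟨C, hC⟩ := ih hg.tail hk
    obtain ⟨C', hC'⟩ := hk.tail.2 N
    obtain ⟨B, hB⟩ := hg.1 0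
    refine ⟨B * C' + C, fun h hh X hX => ?_⟩
    have h0 := hh.1.ne'
    set g1 := (g h X - c 0 X) / h with hg1
    set k1 := (k h X - e 0 X) / h with hk1
    have hgg : g h X = c 0 X + h * g1 := by rw [hg1, mul_div_cancel₀ _ h0]; ring
    have hkk : k h X = e 0 X + h * k1 := by rw [hk1, mul_div_cancel₀ _ h0]; ring
    have h1 : ∑ j ∈ Finset.range (N + 1), h ^ j *
        ∑ p ∈ Finset.HasAntidiagonal.antidiagonal j, c p.1 X * e p.2 X
        = c 0 X * e 0 X + h * (c 0 X * ∑ j ∈ Finset.range N, h ^ j * e (j + 1) X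
          + ∑ j ∈ Finset.range N, h ^ j *
            ∑ p ∈ Finset.HasAntidiagonal.antidiagonal j, c (p.1 + 1) X * e p.2 X) := by
      rw [Finset.sum_range_succ', add_comm]
      congr 1
      · simp
      rw [Finset.mul_sum, ← Finset.sum_add_distrib, Finset.mul_sum]
      refine Finset.sum_congr rfl fun j _ => ?_
      rw [Finset.Nat.sum_antidiagonal_succ]
      ring
    have h2 : g h X * k h X - ∑ j ∈ Finset.range (N + 1), h ^ j *
        ∑ p ∈ Finset.HasAntidiagonal.antidiagonal j, c p.1 X * e p.2 X
        = h * (c 0 X * (k1 - ∑ j ∈ Finset.range N, h ^ j * e (j + 1) X)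
          + (g1 * k h X - ∑ j ∈ Finset.range N, h ^ j *
            ∑ p ∈ Finset.HasAntidiagonal.antidiagonal j, c (p.1 + 1) X * e p.2 X)) := by
      rw [h1, hgg]
      linear_combination c 0 X * hkk
    rw [h2, abs_mul, abs_of_pos hh.1]
    have h3 : |c 0 X * (k1 - ∑ j ∈ Finset.range N, h ^ j * e (j + 1) X)| ≤ B * (C' * h ^ N) := by
      rw [abs_mul]
      exact mul_le_mul (hB X hX) (hC' h hh X hX) (abs_nonneg _)
        ((abs_nonneg _).trans (hB X hX))
    have h4 := mul_le_mul_of_nonneg_left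
      ((abs_add_le _ _).trans (add_le_add h3 (hC h hh X hX))) hh.1.le
    refine h4.trans (le_of_eq ?_)
    ring

theorem Asym.mul (hg : Asym h₁ K g c) (hk : Asym h₁ K k e) :
    Asym h₁ K (fun h X => g h X * k h X)
      (fun j X => ∑ p ∈ Finset.HasAntidiagonal.antidiagonal j, c p.1 X * e p.2 X) := by
  refine ⟨fun j => ?_, fun N => Asym.mul_bound N hg hk⟩
  choose B hB using hg.1
  choose B' hB' using hk.1
  refine ⟨∑ p ∈ Finset.HasAntidiagonal.antidiagonal j, B p.1 * B' p.2, fun X hX => ?_⟩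
  refine (Finset.abs_sum_le_sum_abs _ _).trans (Finset.sum_le_sum fun p _ => ?_)
  rw [abs_mul]
  exact mul_le_mul (hB _ X hX) (hB' _ X hX) (abs_nonneg _) ((abs_nonneg _).trans (hB _ X hX))

theorem Asym.h_mul (hg : Asym h₁ K g c) :
    Asym h₁ K (fun h X => h * g h X) (fun j X => if j = 0 then 0 else c (j - 1) X) := by
  refine ⟨fun j => ?_, fun N => ?_⟩
  · obtain ⟨B, hB⟩ := hg.1 (j - 1)
    refine ⟨max B 0, fun X hX => ?_⟩
    beta_reduce
    split_ifs
    · simp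
    · exact (hB X hX).trans (le_max_left _ _)
  · cases N with
    | zero =>
      obtain ⟨C, hC⟩ := hg.bounded
      refine ⟨h₁ * C, fun h hh X hX => ?_⟩
      simp only [Finset.range_zero, Finset.sum_empty, sub_zero, pow_zero, mul_one, abs_mul,
        abs_of_pos hh.1]
      exact mul_le_mul hh.2 (hC h hh X hX) (abs_nonneg _) (hh.1.le.trans hh.2)
    | succ N =>
      obtain ⟨C, hC⟩ := hg.2 N
      refine ⟨C, fun h hh X hX => ?_⟩
      rw [Finset.sum_range_succ']
      simp only [Nat.add_eq_zero_iff, one_ne_zero, and_false, if_false, if_true, mul_zero,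
        add_zero, Nat.add_sub_cancel]
      have h1 : h * g h X - ∑ j ∈ Finset.range N, h ^ (j + 1) * c j X
          = h * (g h X - ∑ j ∈ Finset.range N, h ^ j * c j X) := by
        rw [mul_sub, Finset.mul_sum]
        congr 1
        exact Finset.sum_congr rfl fun _ _ => by ring
      rw [h1, abs_mul, abs_of_pos hh.1]
      refine (mul_le_mul_of_nonneg_left (hC h hh X hX) hh.1.le).trans (le_of_eq ?_)
      ring

theorem Asym.congr_coeff {c' : ℕ → E → ℝ} (hg : Asym h₁ K g c) (h : ∀ j, ∀ X, c j X = c' j X) :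
    Asym h₁ K g c' := by
  have : c = c' := funext fun j => funext fun X => h j X
  rwa [← this]

theorem Asym.congr {g' : ℝ → E → ℝ} (hg : Asym h₁ K g c) (h : ∀ t X, g t X = g' t X) :
    Asym h₁ K g' c := by
  have : g = g' := funext fun j => funext fun X => h j X
  rwa [← this]

theorem sum_antidiagonal_eq (n : ℕ) (f : ℕ → ℕ → ℝ) (N : ℕ) (hN : n < N) :
    ∑ p ∈ Finset.HasAntidiagonal.antidiagonal n, f p.1 p.2
      = ∑ p ∈ Finset.range N, ∑ q ∈ Finset.range N, if p + q = n then f p q else 0 := by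
  rw [← Finset.sum_product' (f := fun p q => if p + q = n then f p q else 0),
    ← Finset.sum_filter]
  refine Finset.sum_congr ?_ fun _ _ => rfl
  ext ⟨p, q⟩
  simp only [Finset.HasAntidiagonal.mem_antidiagonal, Finset.mem_filter, Finset.mem_product, Finset.mem_range]
  omega

theorem sum_antidiagonal_antidiagonal (n : ℕ) (T : ℕ → ℕ → ℕ → ℝ) :
    ∑ p ∈ Finset.HasAntidiagonal.antidiagonal n, ∑ q ∈ Finset.HasAntidiagonal.antidiagonal p.2, T p.1 q.1 q.2
      = ∑ p ∈ Finset.range (n + 1), ∑ q ∈ Finset.range (n + 1), ∑ r ∈ Finset.range (n + 1),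
        if p + q + r = n then T p q r else 0 := by
  rw [sum_antidiagonal_eq n (fun a b => ∑ q ∈ Finset.HasAntidiagonal.antidiagonal b, T a q.1 q.2) (n + 1)
    (by omega)]
  refine Finset.sum_congr rfl fun p hp => ?_
  rw [Finset.mem_range] at hp
  rw [Finset.sum_eq_single (n - p)]
  · rw [if_pos (by omega), sum_antidiagonal_eq (n - p) (T p) (n + 1) (by omega)]
    refine Finset.sum_congr rfl fun q _ => Finset.sum_congr rfl fun r _ => ?_
    refine if_congr (by omega) rfl rfl
  · intro m _ hm
    rw [if_neg (by omega)]
  · intro h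
    exact absurd (Finset.mem_range.2 (by omega)) h

/-- Separates the terms containing the unknown of index n from those in earlier ones: an index equal
to n forces the other two to be 0, and n ≥ 1 makes the three cases distinct. -/
theorem sum_triple_split (n : ℕ) (hn : 1 ≤ n) (T : ℕ → ℕ → ℕ → ℝ) :
    (∑ p ∈ Finset.range (n + 1), ∑ q ∈ Finset.range (n + 1), ∑ r ∈ Finset.range (n + 1),
        if p + q + r = n then T p q r else 0)
      = (∑ p ∈ Finset.range n, ∑ q ∈ Finset.range n, ∑ r ∈ Finset.range n,
        if p + q + r = n then T p q r else 0) + T 0 0 n + T 0 n 0 + T n 0 0 := by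
  have key : ∀ (N M : ℕ) (F : ℕ → ℕ → ℝ), 1 ≤ N → 1 ≤ M →
      (∀ a b, (a ≠ 0 ∨ b ≠ 0) → F a b = 0) →
      ∑ a ∈ Finset.range N, ∑ b ∈ Finset.range M, F a b = F 0 0 := by
    intro N M F hN hM hF
    rw [Finset.sum_eq_single 0, Finset.sum_eq_single 0]
    · intro b _ hb; exact hF _ _ (Or.inr hb)
    · intro h; exact absurd (Finset.mem_range.2 (by omega)) h
    · intro a _ ha
      exact Finset.sum_eq_zero fun b _ => hF _ _ (Or.inl ha)
    · intro h; exact absurd (Finset.mem_range.2 (by omega)) h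
  simp only [Finset.sum_range_succ _ n, Finset.sum_add_distrib]
  have e1 := key n n (fun p q => if p + q + n = n then T p q n else 0) hn hn
    (fun a b h => if_neg (by omega))
  have e2 := key n n (fun p r => if p + n + r = n then T p n r else 0) hn hn
    (fun a b h => if_neg (by omega))
  have e3 := key n n (fun q r => if n + q + r = n then T n q r else 0) hn hn
    (fun a b h => if_neg (by omega))
  have e4 : ∑ p ∈ Finset.range n, (if p + n + n = n then T p n n else 0) = 0 :=
    Finset.sum_eq_zero fun p _ => if_neg (by omega)
  have e5 : ∑ q ∈ Finset.range n, (if n + q + n = n then T n q n else 0) = 0 :=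
    Finset.sum_eq_zero fun p _ => if_neg (by omega)
  have e6 : ∑ q ∈ Finset.range n, (if n + n + q = n then T n n q else 0) = 0 :=
    Finset.sum_eq_zero fun p _ => if_neg (by omega)
  have e7 : ¬ (n + n + n = n) := by omega
  rw [e1, e2, e3, e4, e5, e6, if_neg e7]
  simp only [zero_add, add_zero, if_true]

end Asymptotics

/-! ### Stability of classical expansions under linear maps and derivatives. -/

section ExpansionCalculus

variable {ι : Type} [Fintype ι] [DecidableEq ι]

theorem HasClassicalExpansion.smooth {E F : Type} [NormedAddCommGroup E] [NormedSpace ℝ E]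
    [NormedAddCommGroup F] [NormedSpace ℝ F] {h₀ : ℝ} {a : ℝ → E → F} {c : ℕ → E → F}
    (H : HasClassicalExpansion Set.univ h₀ a c) {h : ℝ} (hh : h ∈ Set.Ioc 0 h₀) :
    ContDiff ℝ ∞ (a h) := contDiffOn_univ.1 (H.1 h hh)

theorem HasClassicalExpansion.smooth_coeff {E F : Type} [NormedAddCommGroup E] [NormedSpace ℝ E]
    [NormedAddCommGroup F] [NormedSpace ℝ F] {h₀ : ℝ} {a : ℝ → E → F} {c : ℕ → E → F}
    (H : HasClassicalExpansion Set.univ h₀ a c) (j : ℕ) :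
    ContDiff ℝ ∞ (c j) := contDiffOn_univ.1 (H.2.1 j)

theorem HasClassicalExpansion.mono {E F : Type} [NormedAddCommGroup E] [NormedSpace ℝ E]
    [NormedAddCommGroup F] [NormedSpace ℝ F] {h₀ h₁ : ℝ} {a : ℝ → E → F} {c : ℕ → E → F}
    (H : HasClassicalExpansion Set.univ h₀ a c) (h : h₁ ≤ h₀) (U : Set E) :
    HasClassicalExpansion U h₁ a c := by
  refine ⟨fun t ht => (H.1 t ⟨ht.1, ht.2.trans h⟩).mono (Set.subset_univ _),
    fun j => (H.2.1 j).mono (Set.subset_univ _), fun K _ hK N k => ?_⟩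
  obtain ⟨C, hC⟩ := H.2.2 K (Set.subset_univ _) hK N k
  exact ⟨C, fun t ht => hC t ⟨ht.1, ht.2.trans h⟩⟩

theorem HasClassicalExpansion.clm {E F G : Type} [NormedAddCommGroup E] [NormedSpace ℝ E]
    [NormedAddCommGroup F] [NormedSpace ℝ F] [NormedAddCommGroup G] [NormedSpace ℝ G]
    {h₀ : ℝ} {a : ℝ → E → F} {c : ℕ → E → F}
    (H : HasClassicalExpansion Set.univ h₀ a c) (L : F →L[ℝ] G) :
    HasClassicalExpansion Set.univ h₀ (fun h X => L (a h X)) (fun j X => L (c j X)) := by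
  refine ⟨fun t ht => (L.contDiff.comp (H.smooth ht)).contDiffOn,
    fun j => (L.contDiff.comp (H.smooth_coeff j)).contDiffOn, fun K hKU hK N k => ?_⟩
  obtain ⟨C, hC⟩ := H.2.2 K hKU hK N k
  refine ⟨‖L‖ * C, fun h hh X hX => ?_⟩
  have h1 : (fun Y => L (a h Y) - ∑ j ∈ Finset.range N, h ^ j • L (c j Y))
      = L ∘ fun Y => a h Y - ∑ j ∈ Finset.range N, h ^ j • c j Y := by
    ext Y; simp
  have h2 : ContDiff ℝ ∞ fun Y => a h Y - ∑ j ∈ Finset.range N, h ^ j • c j Y :=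
    (H.smooth hh).sub (ContDiff.sum fun j _ => (H.smooth_coeff j).const_smul _)
  rw [h1, mul_assoc]
  exact (L.norm_iteratedFDeriv_comp_left h2.contDiffAt (by exact_mod_cast le_top)).trans
    (mul_le_mul_of_nonneg_left (hC h hh X hX) (norm_nonneg _))

theorem HasClassicalExpansion.pd {h₀ : ℝ} {a : ℝ → EuclideanSpace ℝ ι → ℝ}
    {c : ℕ → EuclideanSpace ℝ ι → ℝ} (H : HasClassicalExpansion Set.univ h₀ a c) (i : ι) :
    HasClassicalExpansion Set.univ h₀ (fun h => pd i (a h)) (fun j => KFP.pd i (c j)) := by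
  refine ⟨fun t ht => (contDiff_pd (H.smooth ht) i).contDiffOn,
    fun j => (contDiff_pd (H.smooth_coeff j) i).contDiffOn, fun K hKU hK N k => ?_⟩
  obtain ⟨C, hC⟩ := H.2.2 K hKU hK N (k + 1)
  refine ⟨C, fun h hh X hX => ?_⟩
  have h2 : ContDiff ℝ ∞ fun Y => a h Y - ∑ j ∈ Finset.range N, h ^ j • c j Y :=
    (H.smooth hh).sub (ContDiff.sum fun j _ => (H.smooth_coeff j).const_smul _)
  have h1 : (fun Y => KFP.pd i (a h) Y - ∑ j ∈ Finset.range N, h ^ j • KFP.pd i (c j) Y)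
      = fun Y => fderiv ℝ (fun Y => a h Y - ∑ j ∈ Finset.range N, h ^ j • c j Y) Y
        (EuclideanSpace.single i 1) := by
    have := congrArg Subtype.val (show
      D i (Sm.mk _ (H.smooth hh) - ∑ j ∈ Finset.range N, h ^ j • Sm.mk _ (H.smooth_coeff j))
        = D i (Sm.mk _ (H.smooth hh))
          - ∑ j ∈ Finset.range N, h ^ j • D i (Sm.mk _ (H.smooth_coeff j)) by
      simp only [map_sub, map_sum, Derivation.map_smul])
    ext Y
    have hY := congrFun this Y
    rw [D_apply] at hY
    have e1 : (Sm.mk _ (H.smooth hh) - ∑ j ∈ Finset.range N,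
        h ^ j • Sm.mk _ (H.smooth_coeff j)).1
        = fun Y => a h Y - ∑ j ∈ Finset.range N, h ^ j • c j Y := by
      ext Z; simp
    rw [e1] at hY
    refine Eq.trans ?_ hY.symm
    rw [Sm.sub_apply, Sm.sum_apply]
    rfl
  rw [h1]
  have h3 : ContDiff ℝ ∞ (fderiv ℝ fun Y => a h Y - ∑ j ∈ Finset.range N, h ^ j • c j Y) :=
    h2.fderiv_right (m := ∞) (by simp)
  refine (norm_iteratedFDeriv_clm_apply_const h3.contDiffAt (by exact_mod_cast le_top)).trans ?_
  rw [norm_iteratedFDeriv_fderiv, PiLp.norm_single, norm_one, one_mul]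
  exact hC h hh X hX

theorem HasClassicalExpansion.asym {E : Type} [NormedAddCommGroup E] [NormedSpace ℝ E]
    {h₀ : ℝ} {a : ℝ → E → ℝ} {c : ℕ → E → ℝ}
    (H : HasClassicalExpansion Set.univ h₀ a c) {K : Set E} (hK : IsCompact K) :
    Asym h₀ K a c := by
  refine ⟨fun j => ?_, fun N => ?_⟩
  · exact hK.exists_bound_of_continuousOn (H.smooth_coeff j).continuous.continuousOn
  · obtain ⟨C, hC⟩ := H.2.2 K (Set.subset_univ _) hK N 0
    refine ⟨C, fun h hh X hX => ?_⟩
    have := hC h hh X hX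
    rwa [norm_iteratedFDeriv_zero] at this

end ExpansionCalculus

/-! ### The expansion of w: eikonal and transport expressions. -/

section Coefficients

variable {d d' : ℕ}

/-- The coefficient of `h^n` in `w`: the eikonal (`n = 0`) or transport (`n ≥ 1`) expression. -/
def wkbCoeff (Sg : Matrix (Fin d') (Fin d') ℝ)
    (αc : ℕ → Phase d d' → EuclideanSpace ℝ (Fin d))
    (βc : ℕ → Phase d d' → EuclideanSpace ℝ (Fin d'))
    (ℓc : ℕ → Phase d d' → ℝ) (n : ℕ) (X : Phase d d') : ℝ :=
  if n = 0 then eikonal Sg αc βc ℓc X else transport Sg αc βc ℓc n X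

theorem sum_antidiagonal_eq_range (n : ℕ) (f : ℕ → ℕ → ℝ) :
    ∑ p ∈ Finset.HasAntidiagonal.antidiagonal n, f p.1 p.2
      = (∑ k ∈ Finset.range n, f (n - k) k) + f 0 n := by
  rw [← Finset.Nat.sum_antidiagonal_swap]
  have := Finset.Nat.sum_antidiagonal_eq_sum_range_succ (fun k m => f m k) n
  simp only [Prod.fst_swap, Prod.snd_swap]
  rw [this, Finset.sum_range_succ, Nat.sub_self]

/-- Cauchy products of the expansions. The prefactor h of Δ_v shifts its index by one, hence the
term -Δ_vℓ_{n-1}; the three cubic terms of index n give 2ℓ₀∂_vℓ₀·∂_vℓ_n + |∂_vℓ₀|²ℓ_n. -/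
theorem wkbW_asym {Sg : Matrix (Fin d') (Fin d') ℝ} {h₁ : ℝ}
    {α : ℝ → Phase d d' → EuclideanSpace ℝ (Fin d)}
    {β : ℝ → Phase d d' → EuclideanSpace ℝ (Fin d')}
    {αc : ℕ → Phase d d' → EuclideanSpace ℝ (Fin d)}
    {βc : ℕ → Phase d d' → EuclideanSpace ℝ (Fin d')}
    {ℓ : ℝ → Phase d d' → ℝ} {ℓc : ℕ → Phase d d' → ℝ}
    (hα : HasClassicalExpansion Set.univ h₁ α αc) (hβ : HasClassicalExpansion Set.univ h₁ β βc)
    (hℓ : HasClassicalExpansion Set.univ h₁ ℓ ℓc) {K : Set (Phase d d')} (hK : IsCompact K) :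
    Asym h₁ K (fun h => wkbW Sg h (α h) (β h) (ℓ h)) (wkbCoeff Sg αc βc ℓc) := by
  have hpd : ∀ i, Asym h₁ K (fun h => pd i (ℓ h)) (fun j => pd i (ℓc j)) :=
    fun i => (hℓ.pd i).asym hK
  have hα' : ∀ i, Asym h₁ K (fun h X => α h X i) (fun j X => αc j X i) :=
    fun i => (hα.clm (EuclideanSpace.proj i)).asym hK
  have hβ' : ∀ i, Asym h₁ K (fun h X => β h X i) (fun j X => βc j X i) :=
    fun i => (hβ.clm (EuclideanSpace.proj i)).asym hK
  have hA := Asym.sum Finset.univ fun i : Fin d => (hα' i).mul (hpd (Sum.inl i))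
  have hB := Asym.sum Finset.univ fun i : Fin d' => (hβ' i).mul (hpd (Sum.inr i))
  have hC := Asym.sum Finset.univ fun j : Fin d' =>
    Asym.const_mul (a := fun X => 4 * frictionVec Sg X j)
      (hK.exists_bound_of_continuousOn (f := fun X => 4 * frictionVec Sg X j) (by
        have h1 := ((4 : ℝ) • fric (d := d) Sg j).contDiff.continuous.continuousOn (s := K)
        refine h1.congr fun X _ => ?_
        simp [fric_apply])) (hpd (Sum.inr j))
  have hG := Asym.sum Finset.univ fun j : Fin d' => (hpd (Sum.inr j)).mul (hpd (Sum.inr j))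
  have hE := (hℓ.asym hK).mul hG
  have hL := (Asym.sum Finset.univ fun j : Fin d' =>
    Asym.const_mul (a := fun _ => (-1 : ℝ)) ⟨1, fun _ _ => by simp⟩
      (((hℓ.pd (Sum.inr j)).pd (Sum.inr j)).asym hK)).h_mul
  refine Asym.congr_coeff (Asym.congr ((((hA.add hB).add hC).add hE).add hL) ?_) ?_
  · intro h X
    simp only [wkbW, dotDx, dotDv, gradVDot, lapV, neg_one_mul,
      Finset.sum_neg_distrib, mul_neg, Finset.mul_sum, mul_assoc]
    ring
  · intro n X
    have e1 : ∑ i, ∑ p ∈ Finset.HasAntidiagonal.antidiagonal n,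
        αc p.1 X i * pd (Sum.inl i) (ℓc p.2) X
        = (∑ k ∈ Finset.range n, dotDx (αc (n - k) X) (ℓc k) X) + dotDx (αc 0 X) (ℓc n) X := by
      rw [Finset.sum_comm, ← sum_antidiagonal_eq_range n fun a b => dotDx (αc a X) (ℓc b) X]
      rfl
    have e2 : ∑ i, ∑ p ∈ Finset.HasAntidiagonal.antidiagonal n,
        βc p.1 X i * pd (Sum.inr i) (ℓc p.2) X
        = (∑ k ∈ Finset.range n, dotDv (βc (n - k) X) (ℓc k) X) + dotDv (βc 0 X) (ℓc n) X := by
      rw [Finset.sum_comm, ← sum_antidiagonal_eq_range n fun a b => dotDv (βc a X) (ℓc b) X]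
      rfl
    have e3 : ∑ i, 4 * frictionVec Sg X i * pd (Sum.inr i) (ℓc n) X
        = 4 * dotDv (frictionVec Sg X) (ℓc n) X := by
      simp only [dotDv, Finset.mul_sum, mul_assoc]
    have e4 : ∑ p ∈ Finset.HasAntidiagonal.antidiagonal n, ℓc p.1 X *
        ∑ i, ∑ q ∈ Finset.HasAntidiagonal.antidiagonal p.2,
          pd (Sum.inr i) (ℓc q.1) X * pd (Sum.inr i) (ℓc q.2) X
        = ∑ p ∈ Finset.range (n + 1), ∑ q ∈ Finset.range (n + 1), ∑ r ∈ Finset.range (n + 1),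
        if p + q + r = n then ℓc p X * gradVDot (ℓc q) (ℓc r) X else 0 := by
      rw [← sum_antidiagonal_antidiagonal n fun p q r => ℓc p X * gradVDot (ℓc q) (ℓc r) X]
      refine Finset.sum_congr rfl fun p _ => ?_
      rw [Finset.sum_comm, Finset.mul_sum]
      rfl
    rw [e1, e2, e3, e4]
    by_cases hn : n = 0
    · subst hn
      simp [wkbCoeff, eikonal]
    · simp only [wkbCoeff, if_neg hn, transport, transportRem]
      rw [sum_triple_split n (by omega) fun p q r => ℓc p X * gradVDot (ℓc q) (ℓc r) X]
      have e5 : gradVDot (ℓc n) (ℓc 0) X = gradVDot (ℓc 0) (ℓc n) X := by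
        simp only [gradVDot, mul_comm]
      rw [e5, Finset.sum_add_distrib]
      simp only [lapV, neg_one_mul, Finset.sum_neg_distrib]
      ring

end Coefficients

/-! ### The bound on P(χ e^{-f/h}). -/

section Remainder

variable {d d' : ℕ}

theorem IsCutoff.bounds {ζ : ℝ → ℝ} (hζ : IsCutoff ζ) : ∃ B : ℝ, 0 ≤ B ∧ (∀ t, |ζ t| ≤ B) ∧
    (∀ t, |deriv ζ t| ≤ B) ∧ ∀ t, |t| < 1 → deriv ζ t = 0 := by
  obtain ⟨h1, -, h3, h4⟩ := hζ
  have hc : HasCompactSupport ζ := HasCompactSupport.of_support_subset_isCompact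
    isCompact_Icc ((subset_tsupport _).trans h4)
  have h1' : ContDiff ℝ ∞ (deriv ζ) := (contDiff_infty_iff_deriv.1 h1).2
  obtain ⟨B, hB⟩ := h1.continuous.bounded_above_of_compact_support hc
  obtain ⟨B', hB'⟩ := h1'.continuous.bounded_above_of_compact_support hc.deriv
  refine ⟨max 0 (max B B'), le_max_left _ _, fun t => ?_, fun t => ?_, fun t ht => ?_⟩
  · exact (hB t).trans ((le_max_left _ _).trans (le_max_right _ _))
  · exact (hB' t).trans ((le_max_right _ _).trans (le_max_right _ _))
  · have : ζ =ᶠ[nhds t] fun _ => 1 := by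
      have hm : Set.Ioo (-1 : ℝ) 1 ∈ nhds t := Ioo_mem_nhds (abs_lt.1 ht).1 (abs_lt.1 ht).2
      filter_upwards [hm] with y hy using h3 y ⟨hy.1.le, hy.2.le⟩
    rw [this.deriv_eq]; simp

/-- The factor w is O(|X - S|^N + h^N) by flatness of its coefficients and its expansion. The
derivative of ζ is nonzero only where |ℓ| ≥ τ; since ℓ₀(S) = 0, this bounds |X - S| + h below, so a
bounded term is also O(|X - S|^N + h^N). -/
theorem kineticOp_chi_bound {Sg : Matrix (Fin d') (Fin d') ℝ}
    {V : EuclideanSpace ℝ (Fin d) → ℝ} (hV : ContDiff ℝ ∞ V) {h₁ : ℝ} (h₁1 : h₁ ≤ 1)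
    {α : ℝ → Phase d d' → EuclideanSpace ℝ (Fin d)}
    {β : ℝ → Phase d d' → EuclideanSpace ℝ (Fin d')}
    {αc : ℕ → Phase d d' → EuclideanSpace ℝ (Fin d)}
    {βc : ℕ → Phase d d' → EuclideanSpace ℝ (Fin d')}
    {ℓ : ℝ → Phase d d' → ℝ} {ℓc : ℕ → Phase d d' → ℝ}
    (hα : HasClassicalExpansion Set.univ h₁ α αc) (hβ : HasClassicalExpansion Set.univ h₁ β βc)
    (hℓ : HasClassicalExpansion Set.univ h₁ ℓ ℓc)
    (hskew : ∀ h ∈ Set.Ioc 0 h₁, SkewRelation Sg V h (α h) (β h))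
    {S : Phase d d'} (h0 : ℓc 0 S = 0)
    (hflat : ∀ n, FlatAt (Metric.closedBall S 1) S (wkbCoeff Sg αc βc ℓc n))
    {ζ : ℝ → ℝ} (hζ : IsCutoff ζ) {τ : ℝ} (hτ : 0 < τ) (N : ℕ) :
    ∃ C : ℝ, ∀ h ∈ Set.Ioc 0 h₁, ∀ X ∈ Metric.closedBall S 1,
      |kineticOp Sg h (α h) (β h)
          (fun Y => chi ζ τ h (ℓ h) Y * Real.exp (-energy Sg V Y / h)) X|
        ≤ h * (C * (‖X - S‖ ^ N + h ^ N))
          * Real.exp (-(energy Sg V X + ℓ h X ^ 2 / 2) / h) := by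
  obtain ⟨B, hB0, hB1, hB2, hB3⟩ := hζ.bounds
  have hK : IsCompact (Metric.closedBall S 1) := isCompact_closedBall _ _
  obtain ⟨Cw, hCw⟩ := (wkbW_asym (Sg := Sg) hα hβ hℓ hK).2 N
  choose Cj hCj using fun j => hflat j N
  obtain ⟨G, hG⟩ := (Asym.sum Finset.univ fun j : Fin d' =>
    ((hℓ.pd (Sum.inr j)).asym hK).mul ((hℓ.pd (Sum.inr j)).asym hK)).bounded
  obtain ⟨Cl, hCl⟩ := (hℓ.asym hK).2 1
  have h0I : Sm.mk _ (hℓ.smooth_coeff 0) ∈ I S 1 := mem_I_one.2 h0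
  obtain ⟨C0, hC00, hC0⟩ := exists_bound_of_mem_I h0I 1
  set A : ℝ := max C0 (max Cl 0) with hA
  have hA0 : 0 ≤ A := (le_max_right _ _).trans (le_max_right _ _)
  set Q : ℝ := ∑ j ∈ Finset.range N, |Cj j| + |Cw| with hQ
  have hQ0 : 0 ≤ Q := add_nonneg (Finset.sum_nonneg fun _ _ => abs_nonneg _) (abs_nonneg _)
  refine ⟨B * Q + B / τ * |G| * (2 * A / τ) ^ N, fun h hh X hX => ?_⟩
  have hX1 : ‖X - S‖ ≤ 1 := by simpa [dist_eq_norm] using hX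
  have hh1 : h ≤ 1 := hh.2.trans h₁1
  set Z := ‖X - S‖ ^ N + h ^ N with hZ
  have hXN : 0 ≤ ‖X - S‖ ^ N := by positivity
  have hhN : 0 ≤ h ^ N := pow_nonneg hh.1.le N
  have hw : |wkbW Sg h (α h) (β h) (ℓ h) X| ≤ Q * Z := by
    have h1 := hCw h hh X hX
    have h2 : |∑ j ∈ Finset.range N, h ^ j * wkbCoeff Sg αc βc ℓc j X|
        ≤ (∑ j ∈ Finset.range N, |Cj j|) * ‖X - S‖ ^ N := by
      rw [Finset.sum_mul]
      refine (Finset.abs_sum_le_sum_abs _ _).trans (Finset.sum_le_sum fun j _ => ?_)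
      rw [abs_mul, abs_of_nonneg (pow_nonneg hh.1.le _)]
      refine (mul_le_of_le_one_left (abs_nonneg _) (pow_le_one₀ hh.1.le hh1)).trans ?_
      exact (hCj j X hX).trans (mul_le_mul_of_nonneg_right (le_abs_self _) hXN)
    have h3 : |wkbW Sg h (α h) (β h) (ℓ h) X| ≤
        |wkbW Sg h (α h) (β h) (ℓ h) X - ∑ j ∈ Finset.range N, h ^ j * wkbCoeff Sg αc βc ℓc j X|
        + |∑ j ∈ Finset.range N, h ^ j * wkbCoeff Sg αc βc ℓc j X| := by
      have := abs_add_le (wkbW Sg h (α h) (β h) (ℓ h) X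
        - ∑ j ∈ Finset.range N, h ^ j * wkbCoeff Sg αc βc ℓc j X)
        (∑ j ∈ Finset.range N, h ^ j * wkbCoeff Sg αc βc ℓc j X)
      rwa [sub_add_cancel] at this
    have h4 : Cw * h ^ N ≤ |Cw| * h ^ N := mul_le_mul_of_nonneg_right (le_abs_self _) hhN
    have h5 : 0 ≤ ∑ j ∈ Finset.range N, |Cj j| := Finset.sum_nonneg fun _ _ => abs_nonneg _
    have h6 := mul_nonneg h5 hhN
    have h7 := mul_nonneg (abs_nonneg Cw) hXN
    simp only [hQ, hZ]
    nlinarith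
  have hr : |h * (deriv ζ (ℓ h X / τ) / τ) * gradVDot (ℓ h) (ℓ h) X|
      ≤ B / τ * |G| * (2 * A / τ) ^ N * Z := by
    by_cases hl : |ℓ h X / τ| < 1
    · rw [hB3 _ hl]
      have : 0 ≤ B / τ * |G| * (2 * A / τ) ^ N * Z := by positivity
      simpa using this
    · have h1 : τ ≤ |ℓ h X| := by
        rw [abs_div, abs_of_pos hτ, not_lt, le_div_iff₀ hτ, one_mul] at hl
        exact hl
      have h2 : |ℓ h X| ≤ A * (‖X - S‖ + h) := by
        have h3 := hCl h hh X hX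
        simp only [Finset.range_one, Finset.sum_singleton, pow_zero, one_mul, pow_one] at h3
        have h4 := hC0 X hX1
        simp only [Sm.mk_apply, pow_one] at h4
        have h5 : |ℓ h X| ≤ |ℓ h X - ℓc 0 X| + |ℓc 0 X| := by
          have := abs_add_le (ℓ h X - ℓc 0 X) (ℓc 0 X)
          rwa [sub_add_cancel] at this
        have h6 : C0 * ‖X - S‖ ≤ A * ‖X - S‖ :=
          mul_le_mul_of_nonneg_right (le_max_left _ _) (norm_nonneg _)
        have h7 : Cl * h ≤ A * h := mul_le_mul_of_nonneg_right
          ((le_max_left _ _).trans (le_max_right _ _)) hh.1.le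
        linarith
      -- From τ ≤ A(‖X - S‖ + h) ≤ 2A max(‖X - S‖, h), raised to the power N.
      have h3 : 1 ≤ (2 * A / τ) ^ N * Z := by
        have h4 : τ ≤ 2 * A * max ‖X - S‖ h := by
          have h5 : ‖X - S‖ + h ≤ 2 * max ‖X - S‖ h := by
            linarith [le_max_left ‖X - S‖ h, le_max_right ‖X - S‖ h]
          nlinarith [mul_le_mul_of_nonneg_left h5 hA0]
        have h5 : 1 ≤ (2 * A / τ * max ‖X - S‖ h) ^ N := by
          refine one_le_pow₀ ?_
          rw [div_mul_eq_mul_div, le_div_iff₀ hτ, one_mul]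
          exact h4
        rw [mul_pow] at h5
        refine h5.trans (mul_le_mul_of_nonneg_left ?_ (by positivity))
        rcases max_cases ‖X - S‖ h with h6 | h6 <;> rw [h6.1] <;> simp only [hZ] <;> linarith
      have h4 : |gradVDot (ℓ h) (ℓ h) X| ≤ |G| := (hG h hh X hX).trans (le_abs_self _)
      have h5 : |deriv ζ (ℓ h X / τ) / τ| ≤ B / τ := by
        rw [abs_div, abs_of_pos hτ]
        exact div_le_div_of_nonneg_right (hB2 _) hτ.le
      have h6 : |h * (deriv ζ (ℓ h X / τ) / τ) * gradVDot (ℓ h) (ℓ h) X| ≤ B / τ * |G| := by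
        rw [abs_mul, abs_mul, abs_of_pos hh.1]
        refine mul_le_mul ?_ h4 (abs_nonneg _) (by positivity)
        exact (mul_le_of_le_one_left (abs_nonneg _) hh1).trans h5
      calc _ ≤ B / τ * |G| := h6
        _ ≤ B / τ * |G| * ((2 * A / τ) ^ N * Z) := le_mul_of_one_le_right (by positivity) h3
        _ = _ := by ring
  rw [kineticOp_chi hV hh.1 (hskew h hh) hζ.1 (hℓ.smooth hh) X, abs_mul, abs_mul,
    abs_of_pos hh.1, abs_of_pos (Real.exp_pos _)]
  have hfin : |ζ (ℓ h X / τ) * wkbW Sg h (α h) (β h) (ℓ h) X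
      - h * (deriv ζ (ℓ h X / τ) / τ) * gradVDot (ℓ h) (ℓ h) X|
      ≤ (B * Q + B / τ * |G| * (2 * A / τ) ^ N) * Z := by
    refine (abs_sub _ _).trans ?_
    rw [add_mul]
    refine add_le_add ?_ hr
    rw [abs_mul, mul_assoc]
    exact mul_le_mul (hB1 _) hw (abs_nonneg _) hB0
  have := mul_le_mul_of_nonneg_left hfin
    (mul_nonneg hh.1.le (Real.exp_pos (-(energy Sg V X + ℓ h X ^ 2 / 2) / h)).le)
  refine this.trans (le_of_eq ?_)
  ring

end Remainder

/-! ### Quadratic forms with one negative direction and rank one updates. -/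

section LinearAlgebra

variable {ι : Type} [Fintype ι] [DecidableEq ι]

theorem dotProduct_mulVec_comm {A : Matrix ι ι ℝ} (hA : A.transpose = A) (x y : ι → ℝ) :
    x ⬝ᵥ A.mulVec y = y ⬝ᵥ A.mulVec x := by
  rw [Matrix.dotProduct_mulVec, dotProduct_comm, ← Matrix.mulVec_transpose, hA]

/-- A form positive on a hyperplane is positive on the orthogonal of a negative vector. -/
theorem pos_on_orthogonal {A : Matrix ι ι ℝ} (hA : A.transpose = A) {φ : (ι → ℝ) →ₗ[ℝ] ℝ}
    (hφ : ∀ x, φ x = 0 → x ≠ 0 → 0 < x ⬝ᵥ A.mulVec x) {w η : ι → ℝ} (hw : A.mulVec w = η)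
    (hneg : w ⬝ᵥ η < 0) {y : ι → ℝ} (hy : y ⬝ᵥ η = 0) (hy0 : y ≠ 0) :
    0 < y ⬝ᵥ A.mulVec y := by
  have hw0 : w ≠ 0 := by
    rintro rfl
    simp at hneg
  have hφw : φ w ≠ 0 := fun h => by
    have := hφ w h hw0
    rw [hw] at this
    linarith
  -- This combination lies in ker φ, and y, w are A-orthogonal, so 0 < z·Az = φ(w)² y·Ay + φ(y)²
  -- w·η, in which the last term is nonpositive.
  set z := φ w • y - φ y • w with hz
  have hφz : φ z = 0 := by simp [hz]; ring
  have hyw : y ⬝ᵥ A.mulVec w = 0 := by rw [hw, hy]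
  have hwy : w ⬝ᵥ A.mulVec y = 0 := by rw [dotProduct_mulVec_comm hA, hyw]
  have hzz : z ⬝ᵥ A.mulVec z = φ w ^ 2 * (y ⬝ᵥ A.mulVec y) + φ y ^ 2 * (w ⬝ᵥ η) := by
    simp only [hz, Matrix.mulVec_sub, Matrix.mulVec_smul, sub_dotProduct, dotProduct_sub,
      smul_dotProduct, dotProduct_smul, hyw, hwy, smul_eq_mul]
    rw [hw]; ring
  have hz0 : z ≠ 0 := by
    intro h
    have h1 : φ w • y = φ y • w := sub_eq_zero.1 h
    have h2 : φ y * (w ⬝ᵥ η) = 0 := by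
      rw [← smul_eq_mul, ← smul_dotProduct, ← h1, smul_dotProduct, hy, smul_zero]
    have h3 : φ y = 0 := (mul_eq_zero.1 h2).resolve_right hneg.ne
    rw [h3, zero_smul] at h1
    exact hy0 ((smul_eq_zero.1 h1).resolve_left hφw)
  have h1 := hφ z hφz hz0
  rw [hzz] at h1
  have h2 : 0 < φ w ^ 2 := by positivity
  have h3 : φ y ^ 2 * (w ⬝ᵥ η) ≤ 0 := mul_nonpos_of_nonneg_of_nonpos (sq_nonneg _) hneg.le
  by_contra h4
  have := mul_nonpos_of_nonneg_of_nonpos h2.le (not_lt.1 h4)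
  linarith

/-- Split z = y + tw with y ⊥ η, an A-orthogonal splitting. On the w component A contributes -2t²
and the square of z·η contributes 4t², leaving y·Ay + 2t². -/
theorem pos_of_rank_one_update {A : Matrix ι ι ℝ} (hA : A.transpose = A) {w η : ι → ℝ}
    (hw : A.mulVec w = η) (hneg : w ⬝ᵥ η = -2)
    (hpos : ∀ y, y ⬝ᵥ η = 0 → y ≠ 0 → 0 < y ⬝ᵥ A.mulVec y) {z : ι → ℝ} (hz : z ≠ 0) :
    0 < z ⬝ᵥ A.mulVec z + (z ⬝ᵥ η) ^ 2 := by
  set t : ℝ := -(z ⬝ᵥ η) / 2 with ht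
  set y := z - t • w with hy
  have hyη : y ⬝ᵥ η = 0 := by
    rw [hy, sub_dotProduct, smul_dotProduct, hneg, ht, smul_eq_mul]; ring
  have hzy : z = y + t • w := by simp [hy]
  have hyw : y ⬝ᵥ A.mulVec w = 0 := by rw [hw, hyη]
  have hwy : w ⬝ᵥ A.mulVec y = 0 := by rw [dotProduct_mulVec_comm hA, hyw]
  have hzz : z ⬝ᵥ A.mulVec z = y ⬝ᵥ A.mulVec y + t ^ 2 * (w ⬝ᵥ η) := by
    rw [hzy]
    simp only [Matrix.mulVec_add, Matrix.mulVec_smul, add_dotProduct, dotProduct_add,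
      smul_dotProduct, dotProduct_smul, hyw, hwy, smul_eq_mul]
    rw [hw]; ring
  have hzη : z ⬝ᵥ η = -2 * t := by rw [ht]; ring
  rw [hzz, hneg, hzη]
  by_cases hy0 : y = 0
  · have ht0 : t ≠ 0 := by
      rintro h
      rw [hy0, h] at hzy
      simp at hzy
      exact hz hzy
    have : 0 < t ^ 2 := by positivity
    rw [hy0]
    simp only [Matrix.mulVec_zero, dotProduct_zero]
    linarith
  · have := hpos y hyη hy0
    nlinarith [sq_nonneg t]

/-- A + ηηᵀ = A(1 + wηᵀ), and the second factor has determinant 1 + η·w = -1. -/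
theorem det_rank_one_update {A : Matrix ι ι ℝ} {w η : ι → ℝ} (hw : A.mulVec w = η)
    (hneg : w ⬝ᵥ η = -2) : (A + Matrix.vecMulVec η η).det = -A.det := by
  have h1 : A + Matrix.vecMulVec η η = A * (1 + Matrix.vecMulVec w η) := by
    rw [mul_add, mul_one, Matrix.mul_vecMulVec, hw]
  rw [h1, Matrix.det_mul, Matrix.vecMulVec_eq Unit,
    Matrix.det_one_add_replicateCol_mul_replicateRow, dotProduct_comm, hneg]
  ring

/-- A symmetric matrix with exactly one negative eigenvalue, counted with multiplicity, and
nonzero determinant. -/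
theorem saddle_matrix {A : Matrix ι ι ℝ} (hA : A.transpose = A) (hdet : A.det ≠ 0)
    (hone : (A.charpoly.roots.filter fun r => r < 0).card = 1) :
    (∃ φ : (ι → ℝ) →ₗ[ℝ] ℝ, ∀ x, φ x = 0 → x ≠ 0 → 0 < x ⬝ᵥ A.mulVec x) ∧ A.det < 0 := by
  have hH : A.IsHermitian := by
    rw [Matrix.IsHermitian, Matrix.conjTranspose_eq_transpose_of_trivial, hA]
  set lam := hH.eigenvalues with hlam
  have hroots : A.charpoly.roots = Multiset.map lam Finset.univ.val := by
    simpa using hH.roots_charpoly_eq_eigenvalues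
  have hcard : (Finset.univ.filter fun i => lam i < 0).card = 1 := by
    rw [hroots, Multiset.filter_map, Multiset.card_map] at hone
    simpa [Finset.card_def, Finset.filter_val, Function.comp_def] using hone
  obtain ⟨i₀, hi₀⟩ := Finset.card_eq_one.1 hcard
  have hdet' : A.det = ∏ i, lam i := by simpa using hH.det_eq_prod_eigenvalues
  have hne : ∀ i, lam i ≠ 0 := by
    intro i hi
    exact hdet (by rw [hdet']; exact Finset.prod_eq_zero (Finset.mem_univ i) hi)
  have hneg : lam i₀ < 0 := by
    have : i₀ ∈ Finset.univ.filter fun i => lam i < 0 := by rw [hi₀]; simp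
    simpa using this
  have hpos : ∀ i, i ≠ i₀ → 0 < lam i := by
    intro i hi
    rcases lt_or_gt_of_ne (hne i) with h | h
    · have : i ∈ Finset.univ.filter fun i => lam i < 0 := by simpa using h
      rw [hi₀] at this
      exact absurd (by simpa using this) hi
    · exact h
  refine ⟨?_, ?_⟩
  · set U : Matrix ι ι ℝ := (hH.eigenvectorUnitary : Matrix ι ι ℝ) with hU
    have hUU : U * U.transpose = 1 := by
      have := (Matrix.mem_unitaryGroup_iff).1 hH.eigenvectorUnitary.2
      simpa [Matrix.star_eq_conjTranspose, Matrix.conjTranspose_eq_transpose_of_trivial] using this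
    have hspec : A = U * Matrix.diagonal lam * U.transpose := by
      have := hH.spectral_theorem
      simpa [Unitary.conjStarAlgAut_apply, Matrix.star_eq_conjTranspose,
        Matrix.conjTranspose_eq_transpose_of_trivial, Function.comp_def] using this
    -- The functional is the coordinate along the eigenvector of the negative eigenvalue; on its
    -- kernel the diagonalized form only sees positive eigenvalues.
    refine ⟨(LinearMap.proj i₀).comp (Matrix.mulVecLin U.transpose), fun x hx hx0 => ?_⟩
    set y := U.transpose.mulVec x with hy
    have hyi : y i₀ = 0 := hx
    have hxy : x ⬝ᵥ A.mulVec x = ∑ i, lam i * y i ^ 2 := by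
      rw [hspec, ← Matrix.mulVec_mulVec, ← Matrix.mulVec_mulVec, Matrix.dotProduct_mulVec,
        ← Matrix.mulVec_transpose, ← hy]
      simp only [dotProduct, Matrix.mulVec_diagonal]
      exact Finset.sum_congr rfl fun i _ => by ring
    have hy0 : y ≠ 0 := by
      intro h
      apply hx0
      have : U.mulVec y = x := by rw [hy, Matrix.mulVec_mulVec, hUU, Matrix.one_mulVec]
      rw [← this, h, Matrix.mulVec_zero]
    obtain ⟨k, hk⟩ := Function.ne_iff.1 hy0
    rw [hxy]
    refine Finset.sum_pos' (fun i _ => ?_) ⟨k, Finset.mem_univ _, ?_⟩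
    · by_cases hi : i = i₀
      · rw [hi, hyi]; simp
      · exact mul_nonneg (hpos i hi).le (sq_nonneg _)
    · have hki : k ≠ i₀ := by rintro rfl; exact hk hyi
      have : y k ≠ 0 := hk
      exact mul_pos (hpos k hki) (by positivity)
  · rw [hdet', ← Finset.mul_prod_erase _ _ (Finset.mem_univ i₀)]
    exact mul_neg_of_neg_of_pos hneg (Finset.prod_pos fun i hi => hpos i (Finset.ne_of_mem_erase hi))

end LinearAlgebra

/-! ### Hessians, second-order Taylor expansion and strict minima on hyperplanes. -/

section Hessian

variable {ι : Type} [Fintype ι] [DecidableEq ι] {s : EuclideanSpace ℝ ι}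

theorem hess_apply (u : Sm ι) (X : EuclideanSpace ℝ ι) (i j : ι) :
    hess u.1 X i j = ev X (D i (D j u)) := rfl

theorem hess_transpose (u : Sm ι) (X : EuclideanSpace ℝ ι) :
    (hess u.1 X).transpose = hess u.1 X := by
  ext i j
  rw [Matrix.transpose_apply, hess_apply, hess_apply, D_comm]

theorem D_quadratic {A : Matrix ι ι ℝ} (hA : A.transpose = A) (k : ι) :
    D k (∑ i, ∑ j, (A i j / 2) • (coord s i * coord s j)) = ∑ j, A k j • coord s j := by
  have hs : ∀ i j, A i j = A j i := fun i j => (congrFun (congrFun hA j) i)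
  simp only [map_sum, Derivation.map_smul, D_mul, D_coord, mul_ite, mul_one, mul_zero, smul_add,
    smul_ite, smul_zero, Finset.sum_add_distrib, Finset.sum_ite_eq, Finset.mem_univ, if_true]
  rw [Finset.sum_comm]
  simp only [Finset.sum_ite_eq, Finset.mem_univ, if_true]
  rw [← Finset.sum_add_distrib]
  refine Finset.sum_congr rfl fun j _ => ?_
  rw [hs j k, ← add_smul]
  congr 1
  ring

theorem quadratic_expansion {F : Sm ι} (hcrit : ∀ i, pd i F.1 s = 0) :
    F - algebraMap ℝ _ (F.1 s)
      - ∑ i, ∑ j, (hess F.1 s i j / 2) • (coord s i * coord s j) ∈ I s 3 := by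
  have hA := hess_transpose F s
  refine mem_I_succ.2 ⟨by simp, fun k => ?_⟩
  rw [map_sub, D_quadratic hA, map_sub, Derivation.map_algebraMap, sub_zero]
  refine mem_I_succ.2 ⟨by simp [hcrit], fun l => mem_I_one.2 ?_⟩
  simp only [map_sub, map_sum, Derivation.map_smul, D_coord, smul_ite, smul_zero,
    Finset.sum_ite_eq, Finset.mem_univ, if_true, map_smul, map_one, smul_eq_mul, mul_one]
  rw [hess_apply, D_comm, sub_self]

theorem exists_lower_bound {A : Matrix ι ι ℝ} {η : ι → ℝ}
    (hpos : ∀ y, y ⬝ᵥ η = 0 → y ≠ 0 → 0 < y ⬝ᵥ A.mulVec y) :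
    ∃ c : ℝ, 0 < c ∧ ∀ Y : EuclideanSpace ℝ ι, Y.ofLp ⬝ᵥ η = 0 →
      c * ‖Y‖ ^ 2 ≤ Y.ofLp ⬝ᵥ A.mulVec Y.ofLp := by
  set K : Set (EuclideanSpace ℝ ι) := Metric.sphere 0 1 ∩ {Y | Y.ofLp ⬝ᵥ η = 0} with hK
  have hcl : IsClosed {Y : EuclideanSpace ℝ ι | Y.ofLp ⬝ᵥ η = 0} := by
    refine isClosed_eq ?_ continuous_const
    simp only [dotProduct]
    fun_prop
  have hKc : IsCompact K := (isCompact_sphere _ _).inter_right hcl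
  have hcont : Continuous fun Y : EuclideanSpace ℝ ι => Y.ofLp ⬝ᵥ A.mulVec Y.ofLp := by
    simp only [dotProduct, Matrix.mulVec]
    fun_prop
  have hkey : ∃ c : ℝ, 0 < c ∧ ∀ Y ∈ K, c ≤ Y.ofLp ⬝ᵥ A.mulVec Y.ofLp := by
    rcases K.eq_empty_or_nonempty with h | h
    · exact ⟨1, one_pos, by simp [h]⟩
    · obtain ⟨Y₀, hY₀, hmin⟩ := hKc.exists_isMinOn h hcont.continuousOn
      refine ⟨_, hpos Y₀.ofLp hY₀.2 ?_, fun Y hY => hmin hY⟩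
      intro h0
      have : Y₀ = 0 := by ext i; exact congrFun h0 i
      have h1 := hY₀.1
      rw [this] at h1
      simp at h1
  obtain ⟨c, hc, hcK⟩ := hkey
  refine ⟨c, hc, fun Y hY => ?_⟩
  by_cases hY0 : Y = 0
  · simp [hY0]
  · have hn : 0 < ‖Y‖ := norm_pos_iff.2 hY0
    have h1 := hcK (‖Y‖⁻¹ • Y) ⟨by simp [norm_smul, hn.ne'], by
      show (‖Y‖⁻¹ • Y.ofLp) ⬝ᵥ η = 0
      rw [smul_dotProduct, hY, smul_zero]⟩
    have h2 : (‖Y‖⁻¹ • Y).ofLp = ‖Y‖⁻¹ • Y.ofLp := rfl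
    rw [h2, Matrix.mulVec_smul, smul_dotProduct, dotProduct_smul, smul_eq_mul, smul_eq_mul] at h1
    have h3 := mul_le_mul_of_nonneg_right h1 (sq_nonneg ‖Y‖)
    refine h3.trans (le_of_eq ?_)
    field_simp

/-- On the hyperplane the quadratic part of F is at least (c/2)‖X - s‖², by compactness of the
sphere. The radius c/(2(C + 1)) makes the cubic remainder C‖X - s‖³ smaller than this. -/
theorem strict_min_on_hyperplane {F : Sm ι} (hcrit : ∀ i, pd i F.1 s = 0) {η : ι → ℝ}
    (hpos : ∀ y, y ⬝ᵥ η = 0 → y ≠ 0 → 0 < y ⬝ᵥ (hess F.1 s).mulVec y) :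
    ∃ r : ℝ, 0 < r ∧ ∀ X, ‖X - s‖ < r → X ≠ s → (X - s).ofLp ⬝ᵥ η = 0 → F.1 s < F.1 X := by
  obtain ⟨c, hc, hcY⟩ := exists_lower_bound hpos
  obtain ⟨C, hC0, hC⟩ := exists_bound_of_mem_I (quadratic_expansion hcrit) 1
  refine ⟨min 1 (c / (2 * (C + 1))), lt_min one_pos (by positivity), fun X hX hXs hη => ?_⟩
  have hX1 : ‖X - s‖ ≤ 1 := hX.le.trans (min_le_left _ _)
  have hX2 : ‖X - s‖ < c / (2 * (C + 1)) := hX.trans_le (min_le_right _ _)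
  have hn : 0 < ‖X - s‖ := norm_pos_iff.2 (sub_ne_zero.2 hXs)
  rw [lt_div_iff₀ (by positivity)] at hX2
  have h1 := hC X hX1
  have h2 := hcY (X - s) hη
  have h3 : (∑ i, ∑ j, (hess F.1 s i j / 2) • (coord s i * coord s j)).1 X
      = (X - s).ofLp ⬝ᵥ (hess F.1 s).mulVec (X - s).ofLp / 2 := by
    simp only [Sm.sum_apply, Sm.smul_apply, Sm.mul_apply, coord_apply, dotProduct,
      Matrix.mulVec, Finset.mul_sum, Finset.sum_div]
    refine Finset.sum_congr rfl fun i _ => Finset.sum_congr rfl fun j _ => ?_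
    simp only [PiLp.sub_apply]
    ring
  rw [Sm.sub_apply, Sm.sub_apply, Sm.algebraMap_apply, h3] at h1
  have h4 := (abs_le.1 h1).1
  have h5 : C * ‖X - s‖ ^ 3 < c / 2 * ‖X - s‖ ^ 2 := by
    have : C * ‖X - s‖ < c / 2 := by nlinarith
    calc C * ‖X - s‖ ^ 3 = (C * ‖X - s‖) * ‖X - s‖ ^ 2 := by ring
      _ < c / 2 * ‖X - s‖ ^ 2 := by gcongr
  linarith

end Hessian

/-! ### The Hessian of the energy at the saddle point. -/

section Energy

variable {d d' : ℕ} {Sg : Matrix (Fin d') (Fin d') ℝ} {V : EuclideanSpace ℝ (Fin d) → ℝ}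

@[simp] theorem xPart_atRest (s : EuclideanSpace ℝ (Fin d)) : xPart (atRest d' s) = s := rfl

@[simp] theorem frictionVec_atRest (s : EuclideanSpace ℝ (Fin d)) (j : Fin d') :
    frictionVec Sg (atRest d' s) j = 0 := by
  have : (fun j => atRest d' s (Sum.inr j)) = (0 : Fin d' → ℝ) := rfl
  simp [frictionVec, this]

theorem energy_crit (hV : ContDiff ℝ ∞ V) {s : EuclideanSpace ℝ (Fin d)}
    (hs : ∀ i, pd i V s = 0) (i : Fin d ⊕ Fin d') : pd i (en Sg hV).1 (atRest d' s) = 0 := by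
  rw [← D_apply]
  cases i with
  | inl i => rw [D_inl_en]; exact hs i
  | inr j => rw [D_inr_en, Sm.smul_apply, fric_apply, frictionVec_atRest, mul_zero]

theorem hess_energy (hV : ContDiff ℝ ∞ V) (s : EuclideanSpace ℝ (Fin d)) :
    hess (en Sg hV).1 (atRest d' s) = Matrix.fromBlocks (hess V s) 0 0
      ((2 : ℝ) • (Sg.transpose * Sg)) := by
  ext i j
  rw [hess_apply]
  rcases i with i | i <;> rcases j with j | j
  · rw [D_inl_en, D_inl_liftX]; rfl
  · rw [D_inr_en, Derivation.map_smul, D_inl_fric]; simp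
  · rw [D_inl_en, D_inr_liftX]; simp
  · rw [D_inr_en, Derivation.map_smul, D_inr_fric]
    simp [gram_symm Sg i j]

theorem dotProduct_gram (v : Fin d' → ℝ) :
    v ⬝ᵥ (Sg.transpose * Sg).mulVec v = Sg.mulVec v ⬝ᵥ Sg.mulVec v := by
  rw [← Matrix.mulVec_mulVec, Matrix.dotProduct_mulVec, ← Matrix.mulVec_transpose,
    Matrix.transpose_transpose]

theorem gram_pos (hSg : IsUnit Sg.det) {v : Fin d' → ℝ} (hv : v ≠ 0) :
    0 < v ⬝ᵥ (Sg.transpose * Sg).mulVec v := by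
  rw [dotProduct_gram]
  have h1 : Sg.mulVec v ≠ 0 := by
    intro h
    have : (Sg⁻¹ * Sg).mulVec v = 0 := by rw [← Matrix.mulVec_mulVec, h, Matrix.mulVec_zero]
    rw [Matrix.nonsing_inv_mul _ hSg, Matrix.one_mulVec] at this
    exact hv this
  obtain ⟨k, hk⟩ := Function.ne_iff.1 h1
  have hk' : Sg.mulVec v k ≠ 0 := hk
  exact Finset.sum_pos' (fun i _ => mul_self_nonneg _) ⟨k, Finset.mem_univ _, mul_self_pos.2 hk'⟩

theorem hessEnergy_form (H : Matrix (Fin d) (Fin d) ℝ) (z : Fin d ⊕ Fin d' → ℝ) :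
    z ⬝ᵥ (Matrix.fromBlocks H 0 0 ((2 : ℝ) • (Sg.transpose * Sg))).mulVec z
      = (z ∘ Sum.inl) ⬝ᵥ H.mulVec (z ∘ Sum.inl)
        + 2 * ((z ∘ Sum.inr) ⬝ᵥ (Sg.transpose * Sg).mulVec (z ∘ Sum.inr)) := by
  rw [Matrix.fromBlocks_mulVec]
  simp only [Matrix.zero_mulVec, add_zero, zero_add, Matrix.smul_mulVec]
  conv_lhs => rw [← Sum.elim_comp_inl_inr z]
  simp [dotProduct, Fintype.sum_sum_type, Finset.mul_sum, mul_left_comm]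

/-- The Hessian of f is block diagonal with positive definite velocity block 2ΣᵀΣ, so the functional
found for Hess V, read on the position component, still cuts out a positive hyperplane. -/
theorem saddle_energy (hSg : IsUnit Sg.det) (hV : ContDiff ℝ ∞ V)
    {s : EuclideanSpace ℝ (Fin d)} (hs : IsSaddle V s) :
    (∃ φ : (Fin d ⊕ Fin d' → ℝ) →ₗ[ℝ] ℝ, ∀ x, φ x = 0 → x ≠ 0 →
      0 < x ⬝ᵥ (hess (en Sg hV).1 (atRest d' s)).mulVec x) ∧
      (hess V s).det < 0 := by
  have hT : (hess V s).transpose = hess V s := hess_transpose (Sm.mk V hV) s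
  obtain ⟨⟨φ, hφ⟩, hdet⟩ := saddle_matrix hT hs.2.1 hs.2.2
  refine ⟨⟨φ.comp (LinearMap.funLeft ℝ ℝ Sum.inl), fun z hz hz0 => ?_⟩, hdet⟩
  have hz' : φ (z ∘ Sum.inl) = 0 := hz
  rw [hess_energy, hessEnergy_form]
  have hv0 : 0 ≤ (z ∘ Sum.inr) ⬝ᵥ (Sg.transpose * Sg).mulVec (z ∘ Sum.inr) := by
    by_cases h : z ∘ Sum.inr = 0
    · rw [h]; simp
    · exact (gram_pos hSg h).le
  by_cases hx : z ∘ Sum.inl = 0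
  · have hv : z ∘ Sum.inr ≠ 0 := by
      intro hv
      apply hz0
      rw [← Sum.elim_comp_inl_inr z, hx, hv]
      ext i; cases i <;> rfl
    rw [hx]
    have := gram_pos hSg hv
    simp only [zero_dotProduct, zero_add]
    linarith
  · have := hφ _ hz' hx
    linarith

end Energy

/-! ### The eikonal and transport equations inside the smooth algebra. -/

section Operators

variable {d d' : ℕ}

/-- The derivative of `u` along the vector field with components `a i`. -/
def vecDot {ι : Type} [Fintype ι] [DecidableEq ι] (a : ι → Sm ι) : Sm ι →ₗ[ℝ] Sm ι where
  toFun u := ∑ i, a i * D i u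
  map_add' u w := by simp only [map_add, mul_add, Finset.sum_add_distrib]
  map_smul' c u := by
    simp only [Derivation.map_smul, mul_smul_comm, Finset.smul_sum, RingHom.id_apply]

theorem vecDot_eq {ι : Type} [Fintype ι] [DecidableEq ι] (a : ι → Sm ι) (u : Sm ι) :
    vecDot a u = ∑ i, a i * D i u := rfl

/-- The smooth function `∂_v u · ∂_v w`. -/
def gradV (u w : Sm (Fin d ⊕ Fin d')) : Sm (Fin d ⊕ Fin d') :=
  ∑ j, D (Sum.inr j) u * D (Sum.inr j) w

/-- The smooth function `Δ_v u`. -/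
def lapSm (u : Sm (Fin d ⊕ Fin d')) : Sm (Fin d ⊕ Fin d') :=
  ∑ j, D (Sum.inr j) (D (Sum.inr j) u)

/-- The drift `(α⁰, β⁰ + 4 ΣᵀΣ v)`. -/
def drift (Sg : Matrix (Fin d') (Fin d') ℝ) (a : ℕ → Fin d ⊕ Fin d' → Sm (Fin d ⊕ Fin d')) :
    Fin d ⊕ Fin d' → Sm (Fin d ⊕ Fin d') :=
  Sum.elim (fun i => a 0 (Sum.inl i)) (fun j => a 0 (Sum.inr j) + (4 : ℝ) • fric Sg d j)

/-- The term of the `j`-th transport equation that involves the previous coefficients. -/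
def remSm (a : ℕ → Fin d ⊕ Fin d' → Sm (Fin d ⊕ Fin d')) (ℓ : ℕ → Sm (Fin d ⊕ Fin d')) (j : ℕ) :
    Sm (Fin d ⊕ Fin d') :=
  (∑ k ∈ Finset.range j, vecDot (a (j - k)) (ℓ k))
    + (∑ p ∈ Finset.range j, ∑ q ∈ Finset.range j, ∑ r ∈ Finset.range j,
        if p + q + r = j then ℓ p * gradV (ℓ q) (ℓ r) else 0)
    - lapSm (ℓ (j - 1))

/-- The eikonal expression. -/
def eikSm (Sg : Matrix (Fin d') (Fin d') ℝ) (a : ℕ → Fin d ⊕ Fin d' → Sm (Fin d ⊕ Fin d'))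
    (u : Sm (Fin d ⊕ Fin d')) : Sm (Fin d ⊕ Fin d') :=
  vecDot (drift Sg a) u + u * gradV u u

/-- The linearization at `u₀` of the eikonal expression, applied to `u`. -/
def linSm (Sg : Matrix (Fin d') (Fin d') ℝ) (a : ℕ → Fin d ⊕ Fin d' → Sm (Fin d ⊕ Fin d'))
    (u₀ u : Sm (Fin d ⊕ Fin d')) : Sm (Fin d ⊕ Fin d') :=
  vecDot (drift Sg a) u + 2 * u₀ * gradV u₀ u + gradV u₀ u₀ * u

/-- The left-hand sides of the eikonal (`n = 0`) and transport (`n ≥ 1`) equations. -/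
def wkbSm (Sg : Matrix (Fin d') (Fin d') ℝ) (a : ℕ → Fin d ⊕ Fin d' → Sm (Fin d ⊕ Fin d'))
    (ℓ : ℕ → Sm (Fin d ⊕ Fin d')) (n : ℕ) : Sm (Fin d ⊕ Fin d') :=
  if n = 0 then eikSm Sg a (ℓ 0) else linSm Sg a (ℓ 0) (ℓ n) + remSm a ℓ n

theorem remSm_congr {a : ℕ → Fin d ⊕ Fin d' → Sm (Fin d ⊕ Fin d')}
    {ℓ ℓ' : ℕ → Sm (Fin d ⊕ Fin d')} {n : ℕ} (hn : n ≠ 0) (h : ∀ k < n, ℓ k = ℓ' k) :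
    remSm a ℓ n = remSm a ℓ' n := by
  unfold remSm
  rw [h (n - 1) (by omega)]
  congr 2
  · exact Finset.sum_congr rfl fun k hk => by rw [h k (Finset.mem_range.1 hk)]
  · refine Finset.sum_congr rfl fun p hp => Finset.sum_congr rfl fun q hq =>
      Finset.sum_congr rfl fun r hr => ?_
    rw [h p (Finset.mem_range.1 hp), h q (Finset.mem_range.1 hq), h r (Finset.mem_range.1 hr)]

/-- The components of the coefficients `αc` and `βc`, as smooth functions. -/
def coeffSm {αc : ℕ → Phase d d' → EuclideanSpace ℝ (Fin d)}
    {βc : ℕ → Phase d d' → EuclideanSpace ℝ (Fin d')} (hα : ∀ j, ContDiff ℝ ∞ (αc j))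
    (hβ : ∀ j, ContDiff ℝ ∞ (βc j)) (j : ℕ) : Fin d ⊕ Fin d' → Sm (Fin d ⊕ Fin d') :=
  Sum.elim
    (fun i => Sm.mk (fun X => αc j X i) ((EuclideanSpace.proj (𝕜 := ℝ) i).contDiff.comp (hα j)))
    (fun i => Sm.mk (fun X => βc j X i) ((EuclideanSpace.proj (𝕜 := ℝ) i).contDiff.comp (hβ j)))

variable {Sg : Matrix (Fin d') (Fin d') ℝ} {V : EuclideanSpace ℝ (Fin d) → ℝ}
  {αc : ℕ → Phase d d' → EuclideanSpace ℝ (Fin d)}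
  {βc : ℕ → Phase d d' → EuclideanSpace ℝ (Fin d')}

theorem gradV_apply (u w : Sm (Fin d ⊕ Fin d')) : (gradV u w).1 = gradVDot u.1 w.1 := by
  ext X; simp [gradV, gradVDot]

theorem lapSm_apply (u : Sm (Fin d ⊕ Fin d')) : (lapSm u).1 = lapV u.1 := by
  ext X; simp [lapSm, lapV]

theorem vecDot_coeffSm (hα : ∀ j, ContDiff ℝ ∞ (αc j)) (hβ : ∀ j, ContDiff ℝ ∞ (βc j)) (j : ℕ)
    (u : Sm (Fin d ⊕ Fin d')) (X : Phase d d') :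
    (vecDot (coeffSm hα hβ j) u).1 X = dotDx (αc j X) u.1 X + dotDv (βc j X) u.1 X := by
  simp only [vecDot_eq, coeffSm, dotDx, dotDv, Fintype.sum_sum_type, Sm.add_apply, Sm.sum_apply,
    Sm.mul_apply, D_apply, Sum.elim_inl, Sum.elim_inr]
  rfl

theorem vecDot_drift (hα : ∀ j, ContDiff ℝ ∞ (αc j)) (hβ : ∀ j, ContDiff ℝ ∞ (βc j))
    (u : Sm (Fin d ⊕ Fin d')) (X : Phase d d') :
    (vecDot (drift Sg (coeffSm hα hβ)) u).1 X
      = dotDx (αc 0 X) u.1 X + dotDv (βc 0 X) u.1 X + 4 * dotDv (frictionVec Sg X) u.1 X := by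
  simp only [vecDot_eq, drift, coeffSm, dotDx, dotDv, Fintype.sum_sum_type, Sm.add_apply,
    Sm.sum_apply, Sm.mul_apply, Sm.smul_apply, D_apply, Sum.elim_inl, Sum.elim_inr, add_mul,
    Finset.sum_add_distrib, Finset.mul_sum, mul_assoc, add_assoc, fric_apply]
  rfl

theorem wkbSm_apply (hα : ∀ j, ContDiff ℝ ∞ (αc j)) (hβ : ∀ j, ContDiff ℝ ∞ (βc j))
    (ℓ : ℕ → Sm (Fin d ⊕ Fin d')) (n : ℕ) (X : Phase d d') :
    (wkbSm Sg (coeffSm hα hβ) ℓ n).1 X = wkbCoeff Sg αc βc (fun j => (ℓ j).1) n X := by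
  unfold wkbSm wkbCoeff
  split_ifs with h
  · simp only [eikSm, eikonal, Sm.add_apply, Sm.mul_apply, vecDot_drift, gradV_apply]
  · have h2 : ((2 : Sm (Fin d ⊕ Fin d'))).1 X = 2 := by
      have : (2 : Sm (Fin d ⊕ Fin d')) = algebraMap ℝ _ 2 := (map_ofNat _ 2).symm
      rw [this, Sm.algebraMap_apply]
    have hite : ∀ p q r : ℕ, ((if p + q + r = n then ℓ p * gradV (ℓ q) (ℓ r) else 0 :
        Sm (Fin d ⊕ Fin d'))).1 X
        = if p + q + r = n then (ℓ p).1 X * gradVDot (ℓ q).1 (ℓ r).1 X else 0 := by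
      intro p q r
      split_ifs
      · rw [Sm.mul_apply, gradV_apply]
      · rfl
    simp only [linSm, transport, transportRem, remSm, Sm.add_apply, Sm.sub_apply, Sm.mul_apply,
      Sm.sum_apply, vecDot_drift, vecDot_coeffSm, gradV_apply, lapSm_apply, h2, hite]

theorem flatAt_of_mem_Flat {S : Phase d d'} {u : Sm (Fin d ⊕ Fin d')} (hu : u ∈ Flat S) :
    FlatAt (Metric.closedBall S 1) S u.1 := by
  intro N
  obtain ⟨C, -, hC⟩ := exists_bound_of_mem_I (mem_Flat.1 hu N) 1
  exact ⟨C, fun X hX => hC X (by rwa [← dist_eq_norm])⟩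

theorem FlatAt.mono {W W' : Set (Phase d d')} {S : Phase d d'} {u : Phase d d' → ℝ}
    (h : FlatAt W S u) (hW : W' ⊆ W) : FlatAt W' S u := fun N =>
  let ⟨C, hC⟩ := h N
  ⟨C, fun X hX => hC X (hW hX)⟩

/-- Recursive choice in which the n-th condition involves all entries of index at most n; the
locality hypothesis keeps earlier conditions valid when later entries are changed. -/
theorem exists_seq {T : Type} [Inhabited T] (P : ℕ → (ℕ → T) → Prop)
    (hloc : ∀ n ℓ ℓ', (∀ k ≤ n, ℓ k = ℓ' k) → P n ℓ → P n ℓ')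
    (step : ∀ n ℓ, (∀ k < n, P k ℓ) → ∃ u, P n (Function.update ℓ n u)) :
    ∃ ℓ, ∀ n, P n ℓ := by
  have hstep : ∀ n (ℓ : {ℓ : ℕ → T // ∀ k < n, P k ℓ}),
      ∃ ℓ' : {ℓ : ℕ → T // ∀ k < n + 1, P k ℓ}, ∀ k < n, ℓ'.1 k = ℓ.1 k := by
    intro n ℓ
    obtain ⟨u, hu⟩ := step n ℓ.1 ℓ.2
    have hupd : ∀ k < n, Function.update ℓ.1 n u k = ℓ.1 k := fun k hk => by
      rw [Function.update_of_ne hk.ne]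
    refine ⟨⟨Function.update ℓ.1 n u, fun k hk => ?_⟩, hupd⟩
    rcases Nat.lt_succ_iff_lt_or_eq.1 hk with h | h
    · exact hloc k ℓ.1 _ (fun j hj => (hupd j (by omega)).symm) (ℓ.2 k h)
    · rw [h]; exact hu
  choose next hnext using hstep
  let F : (n : ℕ) → {ℓ : ℕ → T // ∀ k < n, P k ℓ} := fun n =>
    Nat.rec ⟨fun _ => default, fun k hk => absurd hk (Nat.not_lt_zero k)⟩ (fun n ℓ => next n ℓ) n
  have hF : ∀ n, F (n + 1) = next n (F n) := fun n => rfl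
  have hagree : ∀ m n k, k < m → m ≤ n → (F n).1 k = (F m).1 k := by
    intro m n k hk hmn
    induction n, hmn using Nat.le_induction with
    | base => rfl
    | succ n hmn ih => rw [hF, hnext n (F n) k (by omega), ih]
  refine ⟨fun n => (F (n + 1)).1 n, fun n => ?_⟩
  refine hloc n (F (n + 1)).1 _ (fun k hk => ?_) ((F (n + 1)).2 n (by omega))
  exact hagree (k + 1) (n + 1) k (by omega) (by omega)

end Operators

/-! ### From a formal solution to the full conclusion. -/

section Conclusion

variable {d d' : ℕ} {Sg : Matrix (Fin d') (Fin d') ℝ} {V : EuclideanSpace ℝ (Fin d) → ℝ}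

theorem inner_gradient (u : Sm (Fin d ⊕ Fin d')) (S Y : Phase d d') :
    inner ℝ (gradient u.1 S) Y = Y.ofLp ⬝ᵥ fun i => pd i u.1 S := by
  rw [gradient, InnerProductSpace.toDual_symm_apply, fderiv_eq_sum_pd]
  rfl

theorem hess_add_half_sq {F u : Sm (Fin d ⊕ Fin d')} {S : Phase d d'} (hu : u.1 S = 0) :
    hess (fun Y => F.1 Y + u.1 Y ^ 2 / 2) S
      = hess F.1 S + Matrix.vecMulVec (fun i => pd i u.1 S) (fun i => pd i u.1 S) := by
  have h1 : (fun Y => F.1 Y + u.1 Y ^ 2 / 2) = (F + (1 / 2 : ℝ) • (u * u)).1 := by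
    ext Y; simp; ring
  rw [h1]
  ext i j
  rw [hess_apply, Matrix.add_apply, Matrix.vecMulVec_apply, hess_apply]
  simp only [map_add, Derivation.map_smul, D_mul, map_smul, map_mul, ev_apply, hu, D_apply]
  simp only [smul_eq_mul]
  ring

theorem norm_sub_atRest_le (X : Phase d d') (s : EuclideanSpace ℝ (Fin d)) :
    ‖X - atRest d' s‖ ≤ ‖xPart X - s‖ + ‖vPart X‖ := by
  have h : ‖X - atRest d' s‖ ^ 2 = ‖xPart X - s‖ ^ 2 + ‖vPart X‖ ^ 2 := by
    simp [EuclideanSpace.norm_sq_eq, Fintype.sum_sum_type, xPart, vPart, atRest]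
  nlinarith [norm_nonneg (X - atRest d' s), norm_nonneg (xPart X - s), norm_nonneg (vPart X),
    mul_nonneg (norm_nonneg (xPart X - s)) (norm_nonneg (vPart X)),
    abs_le_of_sq_le_sq' (show ‖X - atRest d' s‖ ^ 2 ≤ (‖xPart X - s‖ + ‖vPart X‖) ^ 2 by
      nlinarith [mul_nonneg (norm_nonneg (xPart X - s)) (norm_nonneg (vPart X))])
      (by positivity)]

/-- Once the equations hold to infinite order, everything else follows from one vector w with Aw = η
and w·η = -2: it shows η ≠ 0, gives positivity of A on η^⊥, and gives the sign change of the
determinant since Hess(f + ℓ₀²/2) = A + ηηᵀ. It serves all three situations. -/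
theorem WKBConclusion.of_formal (hSg : IsUnit Sg.det) (hV : ContDiff ℝ ∞ V)
    {s : EuclideanSpace ℝ (Fin d)} (hs : IsSaddle V s) {h₀ : ℝ} (hh₀ : 0 < h₀)
    {α : ℝ → Phase d d' → EuclideanSpace ℝ (Fin d)}
    {β : ℝ → Phase d d' → EuclideanSpace ℝ (Fin d')}
    {αc : ℕ → Phase d d' → EuclideanSpace ℝ (Fin d)}
    {βc : ℕ → Phase d d' → EuclideanSpace ℝ (Fin d')}
    (hα : HasClassicalExpansion Set.univ h₀ α αc) (hβ : HasClassicalExpansion Set.univ h₀ β βc)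
    (hskew : ∀ h ∈ Set.Ioc 0 h₀, SkewRelation Sg V h (α h) (β h))
    (hαs : ∀ j, ContDiff ℝ ∞ (αc j)) (hβs : ∀ j, ContDiff ℝ ∞ (βc j))
    (ℓc : ℕ → Sm (Fin d ⊕ Fin d')) (h0 : (ℓc 0).1 (atRest d' s) = 0)
    (hflat : ∀ n, wkbSm Sg (coeffSm hαs hβs) ℓc n ∈ Flat (atRest d' s))
    {w η : Fin d ⊕ Fin d' → ℝ} (hη : η = fun i => pd i (ℓc 0).1 (atRest d' s))
    (hw : (hess (en Sg hV).1 (atRest d' s)).mulVec w = η) (hwη : w ⬝ᵥ η = -2)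
    {r : ℝ} (hr : 0 < r)
    (hA : gradVDot (ℓc 0).1 (ℓc 0).1 (atRest d' s) ≠ 0 ∨
      ∃ A : Matrix (Fin d ⊕ Fin d') (Fin d ⊕ Fin d') ℝ, A ≠ 0 ∧ A.PosSemidef ∧
        (∃ ρ : Phase d d' → ℝ,
          (∃ C : ℝ, ∀ X, ‖X - atRest d' s‖ < r → |ρ X| ≤ C * ‖X - atRest d' s‖) ∧
          ∀ X, ‖X - atRest d' s‖ < r →
            gradVDot (ℓc 0).1 (ℓc 0).1 X = 4 * gradForm A (energy Sg V) X * (1 + ρ X)) ∧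
        ¬ ∀ᶠ X in nhds (atRest d' s), gradForm A (energy Sg V) X = 0) :
    WKBConclusion Sg V α β αc βc s := by
  set S := atRest d' s with hS
  set h₁ := min h₀ 1 with hh₁
  have h₁le : h₁ ≤ h₀ := min_le_left _ _
  have h₁1 : h₁ ≤ 1 := min_le_right _ _
  have hflat' : ∀ n, FlatAt (Metric.closedBall S 1) S
      (wkbCoeff Sg αc βc (fun j => (ℓc j).1) n) := by
    intro n
    have := flatAt_of_mem_Flat (hflat n)
    exact fun N => (this N).imp fun C hC X hX => by
      rw [← wkbSm_apply hαs hβs]; exact hC X hX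
  obtain ⟨ℓ, hℓ⟩ := exists_classical_sum (fun j => (ℓc j).contDiff)
  have hℓ₁ := hℓ.mono h₁1 (Set.univ)
  obtain ⟨⟨φ, hφ⟩, hdet⟩ := saddle_energy (d' := d') hSg hV hs
  have hT := hess_transpose (en Sg hV) S
  have hpos : ∀ y, y ⬝ᵥ η = 0 → y ≠ 0 → 0 < y ⬝ᵥ (hess (en Sg hV).1 S).mulVec y :=
    fun y hy hy0 => pos_on_orthogonal hT hφ hw (by rw [hwη]; norm_num) hy hy0
  obtain ⟨r₁, hr₁, hmin⟩ := strict_min_on_hyperplane (F := en Sg hV) (s := S)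
    (energy_crit hV hs.1) hpos
  set R := min (min r r₁) 1 / 2 with hR
  have hR0 : 0 < R := by positivity
  have hWsub : ∀ X ∈ {X : Phase d d' | xPart X ∈ Metric.ball s R ∧ vPart X ∈ Metric.ball 0 R},
      ‖X - S‖ < min (min r r₁) 1 := by
    rintro X ⟨h1, h2⟩
    have := norm_sub_atRest_le X s
    rw [Metric.mem_ball, dist_eq_norm] at h1 h2
    rw [sub_zero] at h2
    rw [hR] at h1 h2
    linarith
  set W := {X : Phase d d' | xPart X ∈ Metric.ball s R ∧ vPart X ∈ Metric.ball 0 R} with hW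
  have hWball : W ⊆ Metric.closedBall S 1 := fun X hX => by
    rw [Metric.mem_closedBall, dist_eq_norm]
    exact ((hWsub X hX).trans_le (min_le_right _ _)).le
  have hWr : ∀ X ∈ W, ‖X - S‖ < r := fun X hX =>
    (hWsub X hX).trans_le ((min_le_left _ _).trans (min_le_left _ _))
  have hWr₁ : ∀ X ∈ W, ‖X - S‖ < r₁ := fun X hX =>
    (hWsub X hX).trans_le ((min_le_left _ _).trans (min_le_right _ _))
  refine ⟨Metric.ball s R, Metric.ball 0 R, W, h₁, ℓ, fun j => (ℓc j).1, Metric.isOpen_ball,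
    Metric.isOpen_ball, Metric.mem_ball_self hR0, Metric.mem_ball_self hR0, rfl,
    lt_min hh₀ one_pos, hℓ.mono h₁1 W, h0, ?_, ?_, ?_, ?_, ?_, ?_, ?_⟩
  · exact (hflat' 0).mono hWball
  · intro j hj
    have hj0 : j ≠ 0 := by omega
    have h1 : wkbCoeff Sg αc βc (fun j => (ℓc j).1) j
        = transport Sg αc βc (fun j => (ℓc j).1) j := funext fun X => if_neg hj0
    exact h1 ▸ (hflat' j).mono hWball
  · intro ζ hζ τ hτ N
    obtain ⟨C, hC⟩ := kineticOp_chi_bound hV h₁1 (hα.mono h₁le Set.univ) (hβ.mono h₁le Set.univ)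
      hℓ₁ (fun h hh => hskew h ⟨hh.1, hh.2.trans h₁le⟩) h0 hflat' hζ hτ N
    exact ⟨C, fun h hh X hX => hC h hh X (hWball hX)⟩
  · intro hg
    have h1 := inner_gradient (ℓc 0) S (WithLp.toLp 2 w)
    rw [hg, inner_zero_left, ← hη] at h1
    have h2 : (WithLp.toLp 2 w : Phase d d').ofLp ⬝ᵥ η = -2 := hwη
    rw [h2] at h1
    norm_num at h1
  · rcases hA with h | ⟨A, hA0, hAp, ⟨ρ, ⟨C, hC⟩, hρ⟩, hne⟩
    · exact Or.inl h
    · exact Or.inr ⟨A, hA0, hAp, ⟨ρ, ⟨C, fun X hX => hC X (hWr X hX)⟩,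
        fun X hX => hρ X (hWr X hX)⟩, hne⟩
  · have key : ∀ E : Phase d d' → ℝ, E = (en Sg hV).1 →
        (hess (fun Y => E Y + (ℓc 0).1 Y ^ 2 / 2) S).det = -(hess E S).det := by
      rintro _ rfl
      rw [hess_add_half_sq h0, ← hη]
      exact det_rank_one_update hw hwη
    exact key _ (en_eq Sg hV).symm
  · intro X hX hXS hin
    have h1 := inner_gradient (ℓc 0) S (X - S)
    rw [← hη] at h1
    have h2 := hmin X (hWr₁ X hX) hXS (h1.symm.trans hin)
    rwa [en_eq Sg hV] at h2

end Conclusion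

/-! ### Injectivity of the linearized operator on homogeneous polynomials. -/

section

variable {ι : Type} [Fintype ι] [DecidableEq ι] {s : EuclideanSpace ℝ ι}

/-- The derivation along the vector field with components `a i`. -/
def vecDer (a : ι → Sm ι) : Derivation ℝ (Sm ι) (Sm ι) := ∑ i, a i • D i

theorem vecDer_eq (a : ι → Sm ι) (u : Sm ι) : vecDer a u = vecDot a u := by
  have h := congrFun (map_sum (Derivation.coeFnAddMonoidHom (R := ℝ) (A := Sm ι) (M := Sm ι))
    (fun i => a i • D i) Finset.univ) u
  rw [Finset.sum_apply] at h
  exact h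

theorem vecDot_mem_I {b : ι → Sm ι} {k m N : ℕ} {u : Sm ι} (hb : ∀ i, b i ∈ I s k)
    (hu : u ∈ I s N) (hm : m ≤ k + (N - 1)) : vecDot b u ∈ I s m :=
  sum_mem fun i _ => mul_mem_I (hb i) (D_mem_I hu le_rfl i) hm

/-- The linear vector field `X ↦ B (X - s)`. -/
def linField (s : EuclideanSpace ℝ ι) (B : Matrix ι ι ℝ) (i : ι) : Sm ι :=
  ∑ j, B i j • coord s j

theorem linField_apply (B : Matrix ι ι ℝ) (i : ι) (X : EuclideanSpace ℝ ι) :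
    (linField s B i).1 X = B.mulVec (X - s).ofLp i := by
  simp [linField, Matrix.mulVec, dotProduct]

theorem linField_mem_Hom (B : Matrix ι ι ℝ) (i : ι) : linField s B i ∈ Hom s 1 :=
  sum_mem fun j _ => Submodule.smul_mem _ _ (coord_mem_Hom j)

theorem linField_mem_I (B : Matrix ι ι ℝ) (i : ι) : linField s B i ∈ I s 1 :=
  Hom_le_I (linField_mem_Hom B i)

theorem D_linField (B : Matrix ι ι ℝ) (i k : ι) :
    D k (linField s B i) = algebraMap ℝ _ (B i k) := by
  simp only [linField, map_sum, Derivation.map_smul, D_coord, smul_ite, smul_zero,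
    Finset.sum_ite_eq, Finset.mem_univ, if_true]
  rw [Algebra.algebraMap_eq_smul_one]

theorem sub_linField_mem_I {b : ι → Sm ι} (hb : ∀ i, (b i).1 s = 0) (i : ι) :
    b i - linField s (Matrix.of fun i j => pd j (b i).1 s) i ∈ I s 2 := by
  refine mem_I_succ.2 ⟨?_, fun k => mem_I_one.2 ?_⟩
  · rw [map_sub, ev_apply, hb, mem_I_one.1 (linField_mem_I _ i), sub_zero]
  · rw [map_sub, D_linField, map_sub, ev_apply, ev_apply, D_apply, Sm.algebraMap_apply,
      Matrix.of_apply, sub_self]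

theorem vecDot_linField_mem_Hom (B : Matrix ι ι ℝ) {n : ℕ} {p : Sm ι} (hp : p ∈ Hom s n) :
    vecDot (linField s B) p ∈ Hom s n := by
  cases n with
  | zero =>
    simp only [vecDot_eq, D_eq_zero_of_mem_Hom_zero hp, mul_zero, Finset.sum_const_zero]
    exact zero_mem _
  | succ n =>
    refine sum_mem fun i _ => ?_
    rw [add_comm n 1]
    exact mul_mem_Hom (linField_mem_Hom B i) (D_mem_Hom hp i)

theorem pd_eq_zero_of_isMin {u : Sm ι} {X : EuclideanSpace ℝ ι} (h : ∀ Y, u.1 X ≤ u.1 Y) (i : ι) :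
    pd i u.1 X = 0 := by
  have : IsLocalMin u.1 X := Filter.Eventually.of_forall h
  rw [pd, this.fderiv_eq_zero]
  rfl

/-- Let Q = ½ z·Az, whose derivative along the field B is Az·Bz ≥ 0, while p satisfies Bp = -μp. The
quotient p²/Qⁿ has degree 0, hence attains its maximum away from s; stationarity there reads p²(n
Qⁿ⁻¹ BQ + 2μQⁿ) = 0, which forces p = 0 at the maximum and thus everywhere. -/
theorem eq_zero_of_vecDot_linField {A B : Matrix ι ι ℝ} (hA : A.transpose = A)
    (hpos : ∀ z, z ≠ 0 → 0 < z ⬝ᵥ A.mulVec z)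
    (hB : ∀ z, 0 ≤ A.mulVec z ⬝ᵥ B.mulVec z) {μ : ℝ} (hμ : 0 < μ) {n : ℕ} {p : Sm ι}
    (hp : p ∈ Hom s n) (h : vecDot (linField s B) p + μ • p = 0) : p = 0 := by
  set Q : Sm ι := ∑ i, ∑ j, (A i j / 2) • (coord s i * coord s j) with hQ
  have hQ2 : Q ∈ Hom s 2 := sum_mem fun i _ => sum_mem fun j _ =>
    Submodule.smul_mem _ _ (mul_mem_Hom (coord_mem_Hom i) (coord_mem_Hom j))
  have hQv : ∀ X, Q.1 X = (X - s).ofLp ⬝ᵥ A.mulVec (X - s).ofLp / 2 := by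
    intro X
    simp only [hQ, Sm.sum_apply, Sm.smul_apply, Sm.mul_apply, coord_apply, dotProduct,
      Matrix.mulVec, Finset.mul_sum, Finset.sum_div]
    refine Finset.sum_congr rfl fun i _ => Finset.sum_congr rfl fun j _ => ?_
    simp only [PiLp.sub_apply]
    ring
  have hQpos : ∀ X, X ≠ s → 0 < Q.1 X := by
    intro X hX
    rw [hQv]
    have := hpos (X - s).ofLp (fun h0 => hX (sub_eq_zero.1 (by ext i; exact congrFun h0 i)))
    linarith
  have hpv : ∀ X, (vecDot (linField s B) p).1 X = -μ * p.1 X := by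
    intro X
    have h1 := congrArg (fun u : Sm ι => u.1 X) h
    simp only [Sm.add_apply, Sm.smul_apply, Sm.zero_apply] at h1
    linarith
  have hps : p.1 s = 0 := by
    have h1 := hpv s
    have h2 : (vecDot (linField s B) p).1 s = 0 := by
      simp [vecDot_eq, linField_apply]
    rw [h2] at h1
    have : μ * p.1 s = 0 := by linarith
    exact (mul_eq_zero.1 this).resolve_left hμ.ne'
  by_contra hne
  obtain ⟨X₁, hX₁⟩ : ∃ X, p.1 X ≠ 0 := by
    by_contra! hall
    exact hne (Sm.ext fun X => by rw [hall X]; rfl)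
  have hX₁s : X₁ ≠ s := fun h => hX₁ (h ▸ hps)
  have hnorm : ∀ X : EuclideanSpace ℝ ι, X ≠ s → s + ‖X - s‖⁻¹ • (X - s) ∈ Metric.sphere s 1 := by
    intro X hX
    have : 0 < ‖X - s‖ := norm_pos_iff.2 (sub_ne_zero.2 hX)
    simp [norm_smul, this.ne']
  have hback : ∀ X : EuclideanSpace ℝ ι, X ≠ s → X = s + ‖X - s‖ • (‖X - s‖⁻¹ • (X - s)) := by
    intro X hX
    have : ‖X - s‖ ≠ 0 := norm_ne_zero_iff.2 (sub_ne_zero.2 hX)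
    rw [smul_smul, mul_inv_cancel₀ this, one_smul, add_sub_cancel]
  have hsph : ∀ X ∈ Metric.sphere s (1 : ℝ), X ≠ s := by
    rintro X hX rfl
    simp at hX
  obtain ⟨X₀, hX₀, hmax⟩ := (isCompact_sphere s (1 : ℝ)).exists_isMaxOn ⟨_, hnorm X₁ hX₁s⟩
    (f := fun X => p.1 X ^ 2 / Q.1 X ^ n) (by
      refine ContinuousOn.div (p.contDiff.continuous.pow 2).continuousOn
        (Q.contDiff.continuous.pow n).continuousOn fun X hX => ?_
      exact (pow_pos (hQpos X (hsph X hX)) n).ne')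
  have hX₀s := hsph X₀ hX₀
  -- Clearing denominators: maximality of p²/Qⁿ at X₀ on the sphere, extended by homogeneity, says G
  -- ≥ 0 everywhere with G(X₀) = 0, so X₀ is a critical point of G.
  set G : Sm ι := (p.1 X₀ ^ 2) • Q ^ n - (Q.1 X₀ ^ n) • p ^ 2 with hG
  have hGv : ∀ Y, G.1 Y = p.1 X₀ ^ 2 * Q.1 Y ^ n - Q.1 X₀ ^ n * p.1 Y ^ 2 := by
    intro Y
    simp [hG]
  have hG0 : G.1 X₀ = 0 := by rw [hGv]; ring
  have hGnn : ∀ Y, 0 ≤ G.1 Y := by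
    intro Y
    by_cases hY : Y = s
    · rw [hY, hGv, hps]
      have : 0 ≤ Q.1 s ^ n := by
        apply pow_nonneg
        rw [hQv]; simp
      have := mul_nonneg (sq_nonneg (p.1 X₀)) this
      simpa using this
    · have h1 := hmax (hnorm Y hY)
      simp only [Set.mem_ofPred_eq] at h1
      rw [div_le_div_iff₀ (pow_pos (hQpos _ (hsph _ (hnorm Y hY))) n)
        (pow_pos (hQpos _ hX₀s) n)] at h1
      have e1 := hp ‖Y - s‖ (‖Y - s‖⁻¹ • (Y - s))
      have e2 := hQ2 ‖Y - s‖ (‖Y - s‖⁻¹ • (Y - s))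
      rw [← hback Y hY] at e1 e2
      rw [hGv, e1, e2]
      have h2 := mul_le_mul_of_nonneg_left h1 (sq_nonneg (‖Y - s‖ ^ n))
      have h3 : (‖Y - s‖ ^ 2 * Q.1 (s + ‖Y - s‖⁻¹ • (Y - s))) ^ n
          = (‖Y - s‖ ^ n) ^ 2 * Q.1 (s + ‖Y - s‖⁻¹ • (Y - s)) ^ n := by
        rw [mul_pow, ← pow_mul, ← pow_mul, mul_comm 2 n]
      rw [h3]
      nlinarith [h2]
  have hD : (vecDer (linField s B) G).1 X₀ = 0 := by
    rw [vecDer_eq, vecDot_eq, Sm.sum_apply]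
    refine Finset.sum_eq_zero fun i _ => ?_
    rw [Sm.mul_apply, D_apply, pd_eq_zero_of_isMin (fun Y => by rw [hG0]; exact hGnn Y), mul_zero]
  have hDQ : (vecDer (linField s B) Q).1 X₀
      = A.mulVec (X₀ - s).ofLp ⬝ᵥ B.mulVec (X₀ - s).ofLp := by
    rw [vecDer_eq, vecDot_eq, Sm.sum_apply, dotProduct]
    refine Finset.sum_congr rfl fun i _ => ?_
    have : D i Q = linField s A i := D_quadratic hA i
    rw [Sm.mul_apply, this, linField_apply, linField_apply, mul_comm]
  have hc := hB (X₀ - s).ofLp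
  rw [← hDQ] at hc
  have hDp : (vecDer (linField s B) p).1 X₀ = -μ * p.1 X₀ := by rw [vecDer_eq, hpv]
  rw [hG, map_sub, Derivation.map_smul, Derivation.map_smul, Derivation.leibniz_pow,
    Derivation.leibniz_pow] at hD
  simp only [Sm.sub_apply, Sm.smul_apply, smul_eq_mul, Sm.mul_apply, Sm.pow_apply, nsmul_eq_mul,
    Nat.cast_ofNat] at hD
  have hcast : ∀ k : ℕ, ((k : Sm ι)).1 X₀ = k := fun k => by
    rw [← map_natCast (algebraMap ℝ (Sm ι)) k, Sm.algebraMap_apply]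
  have h2 : ((2 : Sm ι)).1 X₀ = 2 := by exact_mod_cast hcast 2
  rw [hcast, h2, hDp] at hD
  have hQn : 0 < Q.1 X₀ ^ n := pow_pos (hQpos _ hX₀s) n
  have hQn1 : 0 < Q.1 X₀ ^ (n - 1) := pow_pos (hQpos _ hX₀s) _
  have hp0 : p.1 X₀ = 0 := by
    have h3 : p.1 X₀ ^ 2 * (n * (Q.1 X₀ ^ (n - 1) * (vecDer (linField s B) Q).1 X₀)
        + 2 * μ * Q.1 X₀ ^ n) = 0 := by
      rw [show (2 : ℕ) - 1 = 1 from rfl, pow_one] at hD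
      linarith
    have h4 : 0 < n * (Q.1 X₀ ^ (n - 1) * (vecDer (linField s B) Q).1 X₀)
        + 2 * μ * Q.1 X₀ ^ n := by positivity
    exact pow_eq_zero_iff (two_ne_zero) |>.1 ((mul_eq_zero.1 h3).resolve_right h4.ne')
  have h5 := hGnn X₁
  rw [hGv, hp0] at h5
  have : 0 < Q.1 X₀ ^ n * p.1 X₁ ^ 2 := mul_pos hQn (by positivity)
  linarith

end

/-! ### Linearization of the eikonal equation and its homogeneous part. -/

section Formal

variable {d d' : ℕ} {Sg : Matrix (Fin d') (Fin d') ℝ}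
  {a : ℕ → Fin d ⊕ Fin d' → Sm (Fin d ⊕ Fin d')} {S : Phase d d'}

theorem gradV_add_left (u w q : Sm (Fin d ⊕ Fin d')) :
    gradV (u + w) q = gradV u q + gradV w q := by
  simp only [gradV, map_add, add_mul, Finset.sum_add_distrib]

theorem gradV_comm (u w : Sm (Fin d ⊕ Fin d')) : gradV u w = gradV w u := by
  simp only [gradV, mul_comm]

theorem gradV_add_right (u w q : Sm (Fin d ⊕ Fin d')) :
    gradV q (u + w) = gradV q u + gradV q w := by
  rw [gradV_comm, gradV_add_left, gradV_comm u, gradV_comm w]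

theorem gradV_mem_I {u w : Sm (Fin d ⊕ Fin d')} {M N m : ℕ} (hu : u ∈ I S M) (hw : w ∈ I S N)
    (hm : m ≤ (M - 1) + (N - 1)) : gradV u w ∈ I S m :=
  sum_mem fun _ _ => mul_mem_I (D_mem_I hu le_rfl _) (D_mem_I hw le_rfl _) hm

theorem gradV_mem_I_right {u w : Sm (Fin d ⊕ Fin d')} {N : ℕ} (hw : w ∈ I S N) :
    gradV u w ∈ I S (N - 1) := gradV_mem_I (mem_I_zero u) hw (by omega)

/-- The eikonal expression is a polynomial of degree three in u and its gradient, so the expansion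
is exact; the bracket collects what is at least quadratic in q. -/
theorem eikSm_add (u q : Sm (Fin d ⊕ Fin d')) :
    eikSm Sg a (u + q) = eikSm Sg a u + linSm Sg a u q
      + (u * gradV q q + 2 * q * gradV u q + q * gradV q q) := by
  simp only [eikSm, linSm, map_add, gradV_add_left, gradV_add_right, gradV_comm q u]
  ring

theorem linSm_add (u q q' : Sm (Fin d ⊕ Fin d')) :
    linSm Sg a u (q + q') = linSm Sg a u q + linSm Sg a u q' := by
  simp only [linSm, map_add, gradV_add_right]
  ring

theorem linSm_mem_I {u q : Sm (Fin d ⊕ Fin d')} {N : ℕ} (hq : q ∈ I S N) :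
    linSm Sg a u q ∈ I S (N - 1) := by
  refine add_mem (add_mem (vecDot_mem_I (fun i => mem_I_zero _) hq (by omega)) ?_) ?_
  · exact Ideal.mul_mem_left _ _ (gradV_mem_I_right hq)
  · exact Ideal.mul_mem_left _ _ (I_anti (by omega) hq)

theorem eikSm_mem_of_sub_mem {u w : Sm (Fin d ⊕ Fin d')} {N : ℕ} (h : u - w ∈ I S N)
    (hw : eikSm Sg a w ∈ I S (N - 1)) : eikSm Sg a u ∈ I S (N - 1) := by
  have : u = w + (u - w) := by ring
  rw [this, eikSm_add]
  refine add_mem (add_mem hw (linSm_mem_I h)) (add_mem (add_mem ?_ ?_) ?_)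
  all_goals exact Ideal.mul_mem_left _ _ (gradV_mem_I_right h)

/-- The linear function `η · (X - S)`. -/
def linFun (S : Phase d d') (η : Fin d ⊕ Fin d' → ℝ) : Sm (Fin d ⊕ Fin d') :=
  ∑ i, η i • coord S i

theorem D_linFun (η : Fin d ⊕ Fin d' → ℝ) (k : Fin d ⊕ Fin d') :
    D k (linFun S η) = algebraMap ℝ _ (η k) := by
  simp only [linFun, map_sum, Derivation.map_smul, D_coord, smul_ite, smul_zero,
    Finset.sum_ite_eq, Finset.mem_univ, if_true]
  rw [Algebra.algebraMap_eq_smul_one]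

theorem linFun_mem_I (η : Fin d ⊕ Fin d' → ℝ) : linFun S η ∈ I S 1 :=
  sum_mem fun i _ => smul_mem_I _ (coord_mem_I i)

/-- The linear part at `S` of the drift. -/
def driftMat (Sg : Matrix (Fin d') (Fin d') ℝ) (a : ℕ → Fin d ⊕ Fin d' → Sm (Fin d ⊕ Fin d'))
    (S : Phase d d') : Matrix (Fin d ⊕ Fin d') (Fin d ⊕ Fin d') ℝ :=
  Matrix.of fun i j => pd j (drift Sg a i).1 S

/-- The vector `(0, η_v)`. -/
def vProj (η : Fin d ⊕ Fin d' → ℝ) : Fin d ⊕ Fin d' → ℝ := Sum.elim 0 (η ∘ Sum.inr)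

/-- The linear part of the linearized eikonal equation. -/
def linMat (Sg : Matrix (Fin d') (Fin d') ℝ) (a : ℕ → Fin d ⊕ Fin d' → Sm (Fin d ⊕ Fin d'))
    (S : Phase d d') (η : Fin d ⊕ Fin d' → ℝ) : Matrix (Fin d ⊕ Fin d') (Fin d ⊕ Fin d') ℝ :=
  driftMat Sg a S + (2 : ℝ) • Matrix.vecMulVec (vProj η) η

/-- The action on homogeneous functions of the linearized eikonal equation. -/
def homOp (Sg : Matrix (Fin d') (Fin d') ℝ) (a : ℕ → Fin d ⊕ Fin d' → Sm (Fin d ⊕ Fin d'))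
    (S : Phase d d') (η : Fin d ⊕ Fin d' → ℝ) : Sm (Fin d ⊕ Fin d') →ₗ[ℝ] Sm (Fin d ⊕ Fin d') :=
  vecDot (linField S (linMat Sg a S η)) + (∑ k, η (Sum.inr k) ^ 2) • LinearMap.id

theorem gradV_linFun_right (η : Fin d ⊕ Fin d' → ℝ) (q : Sm (Fin d ⊕ Fin d')) :
    gradV (linFun S η) q = ∑ k, η (Sum.inr k) • D (Sum.inr k) q := by
  simp only [gradV, D_linFun, ← Algebra.smul_def]

theorem gradV_linFun_self (η : Fin d ⊕ Fin d' → ℝ) :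
    gradV (linFun S η) (linFun S η) = algebraMap ℝ _ (∑ k, η (Sum.inr k) ^ 2) := by
  simp only [gradV, D_linFun, ← map_mul, ← map_sum, sq]

theorem homOp_eq (η : Fin d ⊕ Fin d' → ℝ) (q : Sm (Fin d ⊕ Fin d')) :
    homOp Sg a S η q = vecDot (linField S (driftMat Sg a S)) q
      + 2 * linFun S η * gradV (linFun S η) q + gradV (linFun S η) (linFun S η) * q := by
  have h1 : ∀ i, linField S (linMat Sg a S η) i
      = linField S (driftMat Sg a S) i + (2 * vProj η i) • linFun S η := by
    intro i
    simp only [linField, linMat, linFun, Matrix.add_apply, Matrix.smul_apply,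
      Matrix.vecMulVec_apply, add_smul, Finset.sum_add_distrib, Finset.smul_sum, smul_smul,
      smul_eq_mul, mul_assoc]
  have h2 : vecDot (linField S (linMat Sg a S η)) q
      = vecDot (linField S (driftMat Sg a S)) q + 2 * linFun S η * gradV (linFun S η) q := by
    simp only [vecDot_eq, h1, add_mul, Finset.sum_add_distrib]
    congr 1
    rw [gradV_linFun_right, Fintype.sum_sum_type]
    simp only [vProj, Sum.elim_inl, Sum.elim_inr, Pi.zero_apply, mul_zero, zero_smul, zero_mul,
      Finset.sum_const_zero, zero_add, Finset.mul_sum, Function.comp_apply]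
    refine Finset.sum_congr rfl fun k _ => ?_
    simp only [Algebra.smul_def, map_mul, map_ofNat]
    ring
  rw [homOp, LinearMap.add_apply, h2, gradV_linFun_self, LinearMap.smul_apply, LinearMap.id_apply,
    Algebra.smul_def]

/-- Replacing the drift by its linear part and u by η·(X - S) changes each coefficient by one order
more than its own, so the error gains one order. -/
theorem linSm_sub_homOp_mem {η : Fin d ⊕ Fin d' → ℝ} (hb : ∀ i, (drift Sg a i).1 S = 0)
    {u q : Sm (Fin d ⊕ Fin d')} {N : ℕ} (hu : u - linFun S η ∈ I S 2) (hq : q ∈ I S N) :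
    linSm Sg a u q - homOp Sg a S η q ∈ I S (N + 1) := by
  set u₀ := linFun S η with hu₀
  set δ := u - u₀ with hδ
  have hue : u = u₀ + δ := by rw [hδ]; ring
  have h1 : linSm Sg a u q - homOp Sg a S η q
      = vecDot (fun i => drift Sg a i - linField S (driftMat Sg a S) i) q
        + 2 * (δ * gradV u q + u₀ * gradV δ q) + (gradV δ u + gradV u₀ δ) * q := by
    have hv : vecDot (fun i => drift Sg a i - linField S (driftMat Sg a S) i) q
        = vecDot (drift Sg a) q - vecDot (linField S (driftMat Sg a S)) q := by
      simp only [vecDot_eq, sub_mul, Finset.sum_sub_distrib]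
    rw [hv, homOp_eq, ← hu₀, linSm, hue]
    simp only [gradV_add_left, gradV_add_right]
    ring
  have hu1 : u ∈ I S 1 := by
    rw [hue]; exact add_mem (linFun_mem_I η) (I_anti (by omega) hu)
  rw [h1]
  refine add_mem (add_mem (vecDot_mem_I (sub_linField_mem_I hb) hq (by omega))
    (Ideal.mul_mem_left _ _ (add_mem ?_ ?_))) ?_
  · exact mul_mem_I hu (gradV_mem_I hu1 hq le_rfl) (by omega)
  · exact mul_mem_I (linFun_mem_I η) (gradV_mem_I hu hq le_rfl) (by omega)
  · refine mul_mem_I (m := 1) (add_mem ?_ ?_) hq (by omega)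
    · exact gradV_mem_I hu hu1 (by omega)
    · exact gradV_mem_I (linFun_mem_I η) hu (by omega)

theorem homOp_mem_Hom {η : Fin d ⊕ Fin d' → ℝ} {n : ℕ} {p : Sm (Fin d ⊕ Fin d')}
    (hp : p ∈ Hom S n) : homOp Sg a S η p ∈ Hom S n :=
  add_mem (vecDot_linField_mem_Hom _ hp) (Submodule.smul_mem _ _ hp)

/-! ### Formal solution of the eikonal and transport equations. -/

section Solve

variable {η : Fin d ⊕ Fin d' → ℝ}

/-- The leading part of R is removed by inverting the homogeneous operator, which is bijective in
each degree since it is injective on a finite dimensional space. -/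
theorem exists_homogeneous_correction
    (hb : ∀ i, (drift Sg a i).1 S = 0)
    (inj : ∀ n, ∀ p ∈ Hom S n, homOp Sg a S η p = 0 → p = 0) {u R : Sm (Fin d ⊕ Fin d')} {N : ℕ}
    (hu : u - linFun S η ∈ I S 2) (hR : R ∈ I S N) :
    ∃ q ∈ Hom S N, R + linSm Sg a u q ∈ I S (N + 1) := by
  obtain ⟨p, hp, hRp⟩ := exists_leading hR
  obtain ⟨q, hq, hqp⟩ := exists_mem_Hom_eq (homOp Sg a S η) (fun _ h => homOp_mem_Hom h) (inj N)
    (neg_mem hp)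
  refine ⟨q, hq, ?_⟩
  have h1 := add_mem hRp (linSm_sub_homOp_mem hb hu (Hom_le_I hq))
  rw [hqp] at h1
  convert h1 using 1
  ring

theorem exists_eikonal_solution
    (hb : ∀ i, (drift Sg a i).1 S = 0)
    (inj : ∀ n, ∀ p ∈ Hom S n, homOp Sg a S η p = 0 → p = 0)
    (hη : ∀ j, ∑ i, η i * driftMat Sg a S i j = -(∑ k, η (Sum.inr k) ^ 2) * η j) :
    ∃ u : Sm (Fin d ⊕ Fin d'), u - linFun S η ∈ I S 2 ∧ eikSm Sg a u ∈ Flat S := by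
  obtain ⟨u, hu, hu'⟩ := exists_formal_solution (s := S) (eikSm Sg a) (fun _ => True) 2
    (linFun S η) trivial (by
      -- The linear terms cancel precisely because η is an eigenvector for -|η_v|²; the error of the
      -- linear ansatz is the part of the drift of order two.
      have h1 : eikSm Sg a (linFun S η) = ∑ i, η i • (drift Sg a i
          - linField S (driftMat Sg a S) i) := by
        simp only [smul_sub, Finset.sum_sub_distrib, linField, Finset.smul_sum, smul_smul]
        rw [Finset.sum_comm (f := fun i j => (η i * driftMat Sg a S i j) • coord S j)]
        simp only [← Finset.sum_smul, hη]
        rw [eikSm, gradV_linFun_self, vecDot_eq]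
        simp only [D_linFun]
        simp only [mul_comm _ (algebraMap ℝ (Sm (Fin d ⊕ Fin d')) _),
          ← Algebra.smul_def, linFun, Finset.smul_sum, smul_smul, neg_mul, neg_smul,
          Finset.sum_neg_distrib, sub_neg_eq_add]
      rw [h1]
      exact sum_mem fun i _ => smul_mem_I _ (sub_linField_mem_I hb i))
    (fun N hN u hu _ hΦ => by
      obtain ⟨q, hq, hqR⟩ := exists_homogeneous_correction hb inj hu hΦ
      refine ⟨q, hq, trivial, ?_⟩
      rw [eikSm_add]
      have hqI := Hom_le_I hq
      have hu1 : u ∈ I S 1 := by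
        have := add_mem (I_anti (m := 1) (by omega) hu) (linFun_mem_I (S := S) η)
        simpa using this
      -- The terms quadratic in q have order at least 2N - 1, which is at least N + 1 because the
      -- corrections start at N = 2.
      refine add_mem hqR (add_mem (add_mem ?_ ?_) ?_)
      · exact mul_mem_I hu1 (gradV_mem_I hqI hqI le_rfl) (by omega)
      · rw [mul_assoc]
        exact Ideal.mul_mem_left _ _ (mul_mem_I hqI (gradV_mem_I hu1 hqI le_rfl) (by omega))
      · exact mul_mem_I hqI (gradV_mem_I hqI hqI le_rfl) (by omega))
  refine ⟨u, hu, mem_Flat.2 fun N => ?_⟩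
  -- One extra order of approximation, since the first-order expression loses one.
  obtain ⟨w, -, huw, hw⟩ := hu' (N + 1)
  exact eikSm_mem_of_sub_mem (N := N + 1) huw (I_anti (by omega) hw)

/-- The equation is affine in the unknown and the homogeneous operator is invertible in every
degree, so the corrections can start at degree 0, with no condition on R. -/
theorem exists_transport_solution
    (hb : ∀ i, (drift Sg a i).1 S = 0)
    (inj : ∀ n, ∀ p ∈ Hom S n, homOp Sg a S η p = 0 → p = 0) {u : Sm (Fin d ⊕ Fin d')} (hu : u - linFun S η ∈ I S 2)
    (R : Sm (Fin d ⊕ Fin d')) : ∃ q, linSm Sg a u q + R ∈ Flat S := by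
  obtain ⟨q, -, hq'⟩ := exists_formal_solution (s := S) (fun q => linSm Sg a u q + R)
    (fun _ => True) 0 0 trivial (mem_I_zero _)
    (fun N _ w _ _ hΦ => by
      obtain ⟨q, hq, hqR⟩ := exists_homogeneous_correction hb inj hu hΦ
      refine ⟨q, hq, trivial, ?_⟩
      rw [linSm_add]
      convert hqR using 1
      ring)
  refine ⟨q, mem_Flat.2 fun N => ?_⟩
  obtain ⟨w, -, hqw, hw⟩ := hq' (N + 1)
  have h1 : linSm Sg a u q + R = linSm Sg a u (q - w) + (linSm Sg a u w + R) := by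
    rw [← add_assoc, ← linSm_add, sub_add_cancel]
  rw [h1]
  exact add_mem (linSm_mem_I (N := N + 1) hqw) (I_anti (by omega) hw)

theorem exists_wkb_solution
    (hb : ∀ i, (drift Sg a i).1 S = 0)
    (inj : ∀ n, ∀ p ∈ Hom S n, homOp Sg a S η p = 0 → p = 0)
    (hη : ∀ j, ∑ i, η i * driftMat Sg a S i j = -(∑ k, η (Sum.inr k) ^ 2) * η j) :
    ∃ ℓ : ℕ → Sm (Fin d ⊕ Fin d'), ℓ 0 - linFun S η ∈ I S 2 ∧ ∀ n, wkbSm Sg a ℓ n ∈ Flat S := by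
  have : Inhabited (Sm (Fin d ⊕ Fin d')) := ⟨0⟩
  obtain ⟨ℓ, hℓ⟩ := exists_seq
    (fun n ℓ => ℓ 0 - linFun S η ∈ I S 2 ∧ wkbSm Sg a ℓ n ∈ Flat S) (by
      rintro n ℓ ℓ' h ⟨h1, h2⟩
      rw [h 0 (Nat.zero_le _)] at h1
      refine ⟨h1, ?_⟩
      unfold wkbSm at h2 ⊢
      split_ifs at h2 ⊢ with hn
      · rwa [← h 0 (Nat.zero_le _)]
      · rwa [← h 0 (Nat.zero_le _), ← h n le_rfl,
          ← remSm_congr hn (fun k hk => h k hk.le)]) (by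
      intro n ℓ hprev
      by_cases hn : n = 0
      · subst hn
        obtain ⟨u, hu, hu'⟩ := exists_eikonal_solution hb inj hη
        exact ⟨u, by simpa using hu, by simpa [wkbSm] using hu'⟩
      · have h0 := (hprev 0 (Nat.pos_of_ne_zero hn)).1
        obtain ⟨q, hq⟩ := exists_transport_solution hb inj h0 (remSm a ℓ n)
        refine ⟨q, ?_, ?_⟩
        · rwa [Function.update_of_ne (Ne.symm hn)]
        · unfold wkbSm
          rw [if_neg hn, Function.update_of_ne (Ne.symm hn), Function.update_self,
            remSm_congr (ℓ' := ℓ) hn (fun k hk => Function.update_of_ne hk.ne _ _)]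
          exact hq)
  exact ⟨ℓ, (hℓ 0).1, fun n => (hℓ n).2⟩

end Solve

end Formal

/-! ### The skew relation at h = 0 and its quadratic part at the saddle. -/

section SkewLimit

variable {d d' : ℕ} {Sg : Matrix (Fin d') (Fin d') ℝ} {V : EuclideanSpace ℝ (Fin d) → ℝ}

theorem eq_zero_of_abs_le_mul {c C h₀ : ℝ} (hh₀ : 0 < h₀) (h : ∀ t ∈ Set.Ioc 0 h₀, |c| ≤ C * t) :
    c = 0 := by
  by_contra hc
  have hc' : 0 < |c| := abs_pos.2 hc
  set t := min h₀ (|c| / (2 * (|C| + 1))) with ht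
  have ht0 : 0 < t := lt_min hh₀ (by positivity)
  have h1 := h t ⟨ht0, min_le_left _ _⟩
  have h2 : t * (2 * (|C| + 1)) ≤ |c| := by
    rw [← le_div_iff₀ (by positivity)]
    exact min_le_right _ _
  nlinarith [mul_le_mul_of_nonneg_right (le_abs_self C) ht0.le, abs_nonneg C,
    mul_nonneg (abs_nonneg C) ht0.le]

/-- At a fixed point the divergence is bounded, so its prefactor h makes it disappear in the limit;
the left-hand side does not depend on h and is O(h). -/
theorem skewRelation_limit {h₀ : ℝ} (hh₀ : 0 < h₀)
    {α : ℝ → Phase d d' → EuclideanSpace ℝ (Fin d)}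
    {β : ℝ → Phase d d' → EuclideanSpace ℝ (Fin d')}
    {αc : ℕ → Phase d d' → EuclideanSpace ℝ (Fin d)}
    {βc : ℕ → Phase d d' → EuclideanSpace ℝ (Fin d')}
    (hα : HasClassicalExpansion Set.univ h₀ α αc) (hβ : HasClassicalExpansion Set.univ h₀ β βc)
    (hskew : ∀ h ∈ Set.Ioc 0 h₀, SkewRelation Sg V h (α h) (β h)) (X : Phase d d') :
    (∑ i, αc 0 X i * pd i V (xPart X)) + 2 * (∑ j, βc 0 X j * frictionVec Sg X j) = 0 := by
  have hK : IsCompact ({X} : Set (Phase d d')) := isCompact_singleton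
  have hb : ∀ c : ℝ, ∃ B : ℝ, ∀ Y ∈ ({X} : Set (Phase d d')), |(fun _ => c) Y| ≤ B :=
    fun c => ⟨|c|, fun _ _ => le_rfl⟩
  have hα' : ∀ i, HasClassicalExpansion Set.univ h₀ (fun h X => α h X i) (fun j X => αc j X i) :=
    fun i => hα.clm (EuclideanSpace.proj i)
  have hβ' : ∀ i, HasClassicalExpansion Set.univ h₀ (fun h X => β h X i) (fun j X => βc j X i) :=
    fun i => hβ.clm (EuclideanSpace.proj i)
  have h1 := Asym.sum Finset.univ fun i : Fin d =>
    Asym.const_mul (hb (pd i V (xPart X))) ((hα' i).asym hK)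
  have h2 := Asym.sum Finset.univ fun i : Fin d' =>
    Asym.const_mul (hb (2 * frictionVec Sg X i)) ((hβ' i).asym hK)
  have h3 := Asym.sum Finset.univ fun i : Fin d => ((hα' i).pd (Sum.inl i)).asym hK
  have h4 := Asym.sum Finset.univ fun i : Fin d' => ((hβ' i).pd (Sum.inr i)).asym hK
  have h5 := (Asym.const_mul (hb (-(1 / 2))) (h3.add h4)).h_mul
  obtain ⟨C, hC⟩ := ((h1.add h2).add h5).2 1
  refine eq_zero_of_abs_le_mul hh₀ (C := C) fun t ht => ?_
  have h6 := hC t ht X rfl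
  have h7 := hskew t ht X
  simp only [Finset.sum_range_one, pow_zero, one_mul, pow_one, if_true, add_zero] at h6
  rw [← abs_neg]
  convert h6 using 2
  simp only [divXV, Finset.mul_sum] at h7 ⊢
  have e1 : ∀ i, α t X i * pd i V (xPart X) = pd i V (xPart X) * α t X i := fun i => mul_comm _ _
  have e2 : ∀ i, αc 0 X i * pd i V (xPart X) = pd i V (xPart X) * αc 0 X i :=
    fun i => mul_comm _ _
  have e3 : ∀ i, 2 * (β t X i * frictionVec Sg X i) = 2 * frictionVec Sg X i * β t X i :=
    fun i => by ring
  have e4 : ∀ i, 2 * (βc 0 X i * frictionVec Sg X i) = 2 * frictionVec Sg X i * βc 0 X i :=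
    fun i => by ring
  simp only [e1, e3] at h7
  simp only [e2, e4]
  linarith

/-- Along (α⁰, β⁰) the energy is constant by the limiting skew relation, so only the friction term
4ΣᵀΣv·∂_v f = 8|ΣᵀΣv|² remains. -/
theorem vecDot_drift_energy (hV : ContDiff ℝ ∞ V)
    {αc : ℕ → Phase d d' → EuclideanSpace ℝ (Fin d)}
    {βc : ℕ → Phase d d' → EuclideanSpace ℝ (Fin d')}
    (hαs : ∀ j, ContDiff ℝ ∞ (αc j)) (hβs : ∀ j, ContDiff ℝ ∞ (βc j))
    (hskew : ∀ X, (∑ i, αc 0 X i * pd i V (xPart X))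
      + 2 * (∑ j, βc 0 X j * frictionVec Sg X j) = 0) :
    vecDot (drift Sg (coeffSm hαs hβs)) (en Sg hV)
      = (2 : ℝ) • gradV (en Sg hV) (en Sg hV) := by
  ext X
  rw [vecDot_drift, Sm.smul_apply, gradV_apply]
  have e1 : ∀ i, pd (Sum.inl i) (en Sg hV).1 X = pd i V (xPart X) := fun i => by
    rw [← D_apply, D_inl_en]; rfl
  have e2 : ∀ j, pd (Sum.inr j) (en Sg hV).1 X = 2 * frictionVec Sg X j := fun j => by
    rw [← D_apply, D_inr_en, Sm.smul_apply, fric_apply]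
  have h := hskew X
  simp only [dotDx, dotDv, gradVDot, e1, e2]
  have e3 : ∑ j, βc 0 X j * (2 * frictionVec Sg X j) = 2 * ∑ j, βc 0 X j * frictionVec Sg X j := by
    rw [Finset.mul_sum]; exact Finset.sum_congr rfl fun j _ => by ring
  have e4 : ∑ j, frictionVec Sg X j * (2 * frictionVec Sg X j)
      = 2 * ∑ j, frictionVec Sg X j ^ 2 := by
    rw [Finset.mul_sum]; exact Finset.sum_congr rfl fun j _ => by ring
  have e5 : ∑ j, 2 * frictionVec Sg X j * (2 * frictionVec Sg X j)
      = 4 * ∑ j, frictionVec Sg X j ^ 2 := by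
    rw [Finset.mul_sum]; exact Finset.sum_congr rfl fun j _ => by ring
  rw [e3, e4, e5]
  linarith

/-- The quadratic part of the identity `b · ∇f = 2 |∂_v f|²`. -/
theorem driftMat_form (a : ℕ → Fin d ⊕ Fin d' → Sm (Fin d ⊕ Fin d')) {S : Phase d d'}
    (hb : ∀ i, (drift Sg a i).1 S = 0) {F : Sm (Fin d ⊕ Fin d')} (hF : ∀ i, pd i F.1 S = 0)
    (h : vecDot (drift Sg a) F = (2 : ℝ) • gradV F F) (z : Fin d ⊕ Fin d' → ℝ) :
    (hess F.1 S).mulVec z ⬝ᵥ (driftMat Sg a S).mulVec z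
      = 2 * ∑ k, (hess F.1 S).mulVec z (Sum.inr k) ^ 2 := by
  have hH : hess F.1 S = Matrix.of fun i j => pd j (D i F).1 S := by
    rw [← hess_transpose]; rfl
  have h1 : ∀ i, D i F - linField S (hess F.1 S) i ∈ I S 2 := by
    intro i
    have := sub_linField_mem_I (s := S) (b := fun i => D i F) hF i
    rwa [← hH] at this
  have h2 : ∀ i, drift Sg a i - linField S (driftMat Sg a S) i ∈ I S 2 := sub_linField_mem_I hb
  have hmul : ∀ {u w u' w' : Sm (Fin d ⊕ Fin d')}, u - u' ∈ I S 2 → w - w' ∈ I S 2 → u' ∈ I S 1 →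
      w' ∈ I S 1 → u * w - u' * w' ∈ I S 3 := by
    intro u w u' w' hu hw hu' hw'
    have : u * w - u' * w' = (u - u') * (w - w') + (u - u') * w' + u' * (w - w') := by ring
    rw [this]
    exact add_mem (add_mem (mul_mem_I hu hw (by omega)) (mul_mem_I hu hw' (by omega)))
      (mul_mem_I hu' hw (by omega))
  -- P compares the two quadratic parts. It is homogeneous of degree 2 and, by the exact identity,
  -- vanishes to order 3, so it is zero.
  set P : Sm (Fin d ⊕ Fin d') :=
    ∑ i, linField S (driftMat Sg a S) i * linField S (hess F.1 S) i
      - (2 : ℝ) • ∑ k : Fin d', linField S (hess F.1 S) (Sum.inr k)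
        * linField S (hess F.1 S) (Sum.inr k) with hP
  have hP2 : P ∈ Hom S 2 := by
    refine sub_mem (sum_mem fun i _ => ?_) (Submodule.smul_mem _ _ (sum_mem fun k _ => ?_))
    all_goals exact mul_mem_Hom (m := 1) (n := 1) (linField_mem_Hom _ _) (linField_mem_Hom _ _)
  have hP3 : P ∈ I S 3 := by
    have e : P = -(∑ i, (drift Sg a i * D i F
          - linField S (driftMat Sg a S) i * linField S (hess F.1 S) i)
        - (2 : ℝ) • ∑ k : Fin d', (D (Sum.inr k) F * D (Sum.inr k) F
          - linField S (hess F.1 S) (Sum.inr k) * linField S (hess F.1 S) (Sum.inr k))) := by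
      have h' := h
      rw [vecDot_eq, gradV] at h'
      rw [Finset.sum_sub_distrib, Finset.sum_sub_distrib, h', hP, smul_sub]
      ring
    rw [e]
    refine neg_mem (sub_mem (sum_mem fun i _ => ?_) (smul_mem_I _ (sum_mem fun k _ => ?_)))
    · exact hmul (h2 i) (h1 i) (linField_mem_I _ _) (linField_mem_I _ _)
    · exact hmul (h1 _) (h1 _) (linField_mem_I _ _) (linField_mem_I _ _)
  have hP0 : P = 0 := eq_zero_of_mem_Hom_of_mem_I hP2 hP3
  have h3 := congrArg (fun u : Sm (Fin d ⊕ Fin d') => u.1 (S + WithLp.toLp 2 z)) hP0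
  have hz : (S + WithLp.toLp 2 z - S).ofLp = z := by rw [add_sub_cancel_left]
  simp only [hP, Sm.sub_apply, Sm.smul_apply, Sm.sum_apply, Sm.mul_apply, linField_apply, hz,
    Sm.zero_apply] at h3
  rw [dotProduct_comm]
  simp only [sq]
  exact sub_eq_zero.1 h3

end SkewLimit

/-! ### The conclusion from an eigenvector of the transposed drift. -/

section Eigenvector

variable {d d' : ℕ} {Sg : Matrix (Fin d') (Fin d') ℝ} {V : EuclideanSpace ℝ (Fin d) → ℝ}

/-- The condition η_v ≠ 0 allows the normalization |η_v|² = μ. The quadratic identity between A and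
B₀ then yields both w·η = -2 and the monotonicity of the form A + ηηᵀ along the linearized field,
which is what injectivity in every degree needs. -/
theorem WKBConclusion.of_eigenvector (hSg : IsUnit Sg.det) (hV : ContDiff ℝ ∞ V)
    {s : EuclideanSpace ℝ (Fin d)} (hs : IsSaddle V s) {h₀ : ℝ} (hh₀ : 0 < h₀)
    {α : ℝ → Phase d d' → EuclideanSpace ℝ (Fin d)}
    {β : ℝ → Phase d d' → EuclideanSpace ℝ (Fin d')}
    {αc : ℕ → Phase d d' → EuclideanSpace ℝ (Fin d)}
    {βc : ℕ → Phase d d' → EuclideanSpace ℝ (Fin d')}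
    (hα : HasClassicalExpansion Set.univ h₀ α αc) (hβ : HasClassicalExpansion Set.univ h₀ β βc)
    (hskew : ∀ h ∈ Set.Ioc 0 h₀, SkewRelation Sg V h (α h) (β h))
    (hαs : ∀ j, ContDiff ℝ ∞ (αc j)) (hβs : ∀ j, ContDiff ℝ ∞ (βc j))
    (hb : ∀ i, (drift Sg (coeffSm hαs hβs) i).1 (atRest d' s) = 0)
    {η : Fin d ⊕ Fin d' → ℝ} {μ : ℝ} (hμ : 0 < μ) (hηv : η ∘ Sum.inr ≠ 0)
    (hη : (driftMat Sg (coeffSm hαs hβs) (atRest d' s)).transpose.mulVec η = -μ • η) :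
    WKBConclusion Sg V α β αc βc s := by
  set S := atRest d' s with hS
  set a := coeffSm hαs hβs with ha
  set B₀ := driftMat Sg a S with hB₀
  set A := hess (en Sg hV).1 S with hA
  -- normalization of the eigenvector
  obtain ⟨η, hμη, hη⟩ : ∃ η : Fin d ⊕ Fin d' → ℝ, ∑ k, η (Sum.inr k) ^ 2 = μ ∧
      B₀.transpose.mulVec η = -μ • η := by
    have hN : 0 < ∑ k, η (Sum.inr k) ^ 2 := by
      obtain ⟨k, hk⟩ := Function.ne_iff.1 hηv
      have hk' : η (Sum.inr k) ≠ 0 := hk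
      exact Finset.sum_pos' (fun _ _ => sq_nonneg _) ⟨k, Finset.mem_univ _, by positivity⟩
    refine ⟨Real.sqrt (μ / ∑ k, η (Sum.inr k) ^ 2) • η, ?_, ?_⟩
    · simp only [Pi.smul_apply, smul_eq_mul, mul_pow, ← Finset.mul_sum]
      rw [Real.sq_sqrt (by positivity)]
      field_simp
    · rw [Matrix.mulVec_smul, hη, smul_comm]
  clear hηv
  have hdetA : IsUnit A.det := by
    rw [hA, hess_energy, Matrix.det_fromBlocks_zero₂₁, isUnit_iff_ne_zero]
    refine mul_ne_zero hs.2.1 ?_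
    rw [Matrix.det_smul, Matrix.det_mul, Matrix.det_transpose]
    exact mul_ne_zero (by positivity) (mul_ne_zero hSg.ne_zero hSg.ne_zero)
  set w := A⁻¹.mulVec η with hw
  have hAw : A.mulVec w = η := by
    rw [hw, Matrix.mulVec_mulVec, Matrix.mul_nonsing_inv _ hdetA, Matrix.one_mulVec]
  have hform : ∀ z, A.mulVec z ⬝ᵥ B₀.mulVec z = 2 * ∑ k, A.mulVec z (Sum.inr k) ^ 2 :=
    driftMat_form a hb (energy_crit hV hs.1)
      (vecDot_drift_energy hV hαs hβs (skewRelation_limit hh₀ hα hβ hskew))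
  have hηB : ∀ z, η ⬝ᵥ B₀.mulVec z = -μ * (z ⬝ᵥ η) := by
    intro z
    rw [Matrix.dotProduct_mulVec, ← Matrix.mulVec_transpose, hη, smul_dotProduct, smul_eq_mul,
      dotProduct_comm]
  -- At z = w the quadratic identity has right-hand side 2|η_v|² = 2μ and left-hand side η·B₀w = -μ
  -- w·η.
  have hwη : w ⬝ᵥ η = -2 := by
    have h1 := hform w
    rw [hAw, hηB, hμη] at h1
    have h2 : μ * (w ⬝ᵥ η + 2) = 0 := by linarith
    have := (mul_eq_zero.1 h2).resolve_left hμ.ne'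
    linarith
  obtain ⟨⟨φ, hφ⟩, -⟩ := saddle_energy (d' := d') hSg hV hs
  have hT : A.transpose = A := hess_transpose (en Sg hV) S
  have hpos : ∀ y, y ⬝ᵥ η = 0 → y ≠ 0 → 0 < y ⬝ᵥ A.mulVec y :=
    fun y hy hy0 => pos_on_orthogonal hT hφ hAw (by rw [hwη]; norm_num) hy hy0
  set A' := A + Matrix.vecMulVec η η with hA'
  have hA'v : ∀ z, A'.mulVec z = A.mulVec z + (z ⬝ᵥ η) • η := by
    intro z
    rw [hA', Matrix.add_mulVec, Matrix.vecMulVec_mulVec, dotProduct_comm]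
    simp
  have hT' : A'.transpose = A' := by
    rw [hA', Matrix.transpose_add, hT, Matrix.transpose_vecMulVec]
  have hpos' : ∀ z, z ≠ 0 → 0 < z ⬝ᵥ A'.mulVec z := by
    intro z hz
    have := pos_of_rank_one_update hT hAw hwη hpos hz
    rw [hA'v, dotProduct_add, dotProduct_smul, smul_eq_mul]
    nlinarith
  have hBform : ∀ z, 0 ≤ A'.mulVec z ⬝ᵥ (linMat Sg a S η).mulVec z := by
    intro z
    have h1 : (linMat Sg a S η).mulVec z = B₀.mulVec z + (2 * (z ⬝ᵥ η)) • vProj η := by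
      rw [linMat, Matrix.add_mulVec, Matrix.smul_mulVec, Matrix.vecMulVec_mulVec, dotProduct_comm,
        mul_smul]
      simp [hB₀]
    have h2 : ∀ y, y ⬝ᵥ vProj η = ∑ k, y (Sum.inr k) * η (Sum.inr k) := by
      intro y
      simp [dotProduct, vProj, Fintype.sum_sum_type]
    have h3 : η ⬝ᵥ vProj η = μ := by rw [h2, ← hμη]; simp only [sq]
    rw [h1, hA'v, add_dotProduct, dotProduct_add, dotProduct_add, hform, smul_dotProduct,
      smul_dotProduct, hηB, dotProduct_smul, dotProduct_smul, h3, h2]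
    simp only [smul_eq_mul]
    set c := z ⬝ᵥ η
    -- The form to be bounded below equals half this sum of squares plus μc²/2.
    have h4 : 0 ≤ ∑ k, (2 * A.mulVec z (Sum.inr k) + c * η (Sum.inr k)) ^ 2 :=
      Finset.sum_nonneg fun _ _ => sq_nonneg _
    have h5 : ∑ k, (2 * A.mulVec z (Sum.inr k) + c * η (Sum.inr k)) ^ 2
        = 4 * ∑ k, A.mulVec z (Sum.inr k) ^ 2
          + 4 * c * ∑ k, A.mulVec z (Sum.inr k) * η (Sum.inr k) + c ^ 2 * μ := by
      rw [← hμη, Finset.mul_sum, Finset.mul_sum, Finset.mul_sum, ← Finset.sum_add_distrib,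
        ← Finset.sum_add_distrib]
      exact Finset.sum_congr rfl fun k _ => by ring
    nlinarith [mul_nonneg (sq_nonneg c) hμ.le]
  have inj : ∀ n, ∀ p ∈ Hom S n, homOp Sg a S η p = 0 → p = 0 := by
    intro n p hp h
    exact eq_zero_of_vecDot_linField hT' hpos' hBform hμ hp (by rw [← hμη]; exact h)
  obtain ⟨ℓ, hℓ0, hℓ⟩ := exists_wkb_solution hb inj (fun j => by
    have h1 := congrFun hη j
    rw [hμη]
    simp only [Matrix.mulVec, dotProduct, Matrix.transpose_apply, Pi.smul_apply, smul_eq_mul]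
      at h1
    rw [← h1]
    exact Finset.sum_congr rfl fun i _ => mul_comm _ _)
  have hval : (ℓ 0).1 S = 0 := by
    have h1 := mem_I_one.1 (add_mem (I_anti (m := 1) (by omega) hℓ0) (linFun_mem_I (S := S) η))
    rwa [sub_add_cancel] at h1
  have hgrad : ∀ i, pd i (ℓ 0).1 S = η i := by
    intro i
    have h1 := mem_I_one.1 (D_mem_I (m := 1) hℓ0 (by omega) i)
    rw [map_sub, D_linFun, map_sub, ev_apply, ev_apply, Sm.algebraMap_apply, D_apply] at h1
    linarith
  refine WKBConclusion.of_formal hSg hV hs hh₀ hα hβ hskew hαs hβs ℓ hval hℓ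
    (funext fun i => (hgrad i).symm) hAw hwη one_pos (Or.inl ?_)
  have h1 : gradVDot (ℓ 0).1 (ℓ 0).1 S = μ := by
    rw [gradVDot, ← hμη]
    exact Finset.sum_congr rfl fun k _ => by rw [hgrad, sq]
  exact fun h => hμ.ne' (h1.symm.trans h)

end Eigenvector

/-! ### Block structure of the drift matrix. -/

section Blocks

variable {d d' : ℕ} {Sg : Matrix (Fin d') (Fin d') ℝ} {V : EuclideanSpace ℝ (Fin d) → ℝ}

/-- Because of the zero block, the position component of the eigenvalue equation is M_βᵀη_v = -μη_x;
if η_v = 0 it gives η_x = 0 too. -/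
theorem inr_ne_zero_of_eigenvector {M : Matrix (Fin d) (Fin d') ℝ} {Mβ : Matrix (Fin d') (Fin d) ℝ}
    {G : Matrix (Fin d') (Fin d') ℝ} {η : Fin d ⊕ Fin d' → ℝ} {μ : ℝ} (hμ : 0 < μ) (hη0 : η ≠ 0)
    (hη : (Matrix.fromBlocks 0 M Mβ G).transpose.mulVec η = -μ • η) : η ∘ Sum.inr ≠ 0 := by
  intro h
  apply hη0
  rw [Matrix.fromBlocks_transpose, Matrix.fromBlocks_mulVec, h] at hη
  ext i
  rcases i with i | i
  · have := congrFun hη (Sum.inl i)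
    simp only [Matrix.transpose_zero, Matrix.zero_mulVec, Matrix.mulVec_zero, add_zero,
      Sum.elim_inl, Pi.zero_apply, Pi.smul_apply, smul_eq_mul] at this
    have h1 : μ * η (Sum.inl i) = 0 := by linarith
    exact (mul_eq_zero.1 h1).resolve_left hμ.ne'
  · exact congrFun h i

theorem eq_zero_and_pd_eq_zero_of_isLittleO {ι : Type} [Fintype ι] [DecidableEq ι]
    {s : EuclideanSpace ℝ ι} {u : Sm ι} (h : u.1 =o[nhds s] fun X => X - s) :
    u.1 s = 0 ∧ ∀ j, pd j u.1 s = 0 := by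
  have h0 : u.1 s = 0 := by
    have := (h.def one_pos).self_of_nhds
    simpa using this
  refine ⟨h0, fun j => ?_⟩
  have h1 : HasFDerivAt u.1 (0 : EuclideanSpace ℝ ι →L[ℝ] ℝ) s := by
    rw [hasFDerivAt_iff_isLittleO]
    simpa [h0] using h
  rw [pd_eq_of_hasFDerivAt h1]
  rfl

theorem driftMat_eq {αc : ℕ → Phase d d' → EuclideanSpace ℝ (Fin d)}
    {βc : ℕ → Phase d d' → EuclideanSpace ℝ (Fin d')}
    (hαs : ∀ j, ContDiff ℝ ∞ (αc j)) (hβs : ∀ j, ContDiff ℝ ∞ (βc j))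
    {s : EuclideanSpace ℝ (Fin d)} {N : Matrix (Fin d ⊕ Fin d') (Fin d ⊕ Fin d') ℝ}
    (h : ∀ i, (coeffSm hαs hβs 0 i - linField (atRest d' s) N i).1
      =o[nhds (atRest d' s)] fun X => X - atRest d' s) :
    (∀ i, (drift Sg (coeffSm hαs hβs) i).1 (atRest d' s) = 0) ∧
      driftMat Sg (coeffSm hαs hβs) (atRest d' s)
        = N + Matrix.fromBlocks 0 0 0 ((4 : ℝ) • (Sg.transpose * Sg)) := by
  have hv : ∀ i, (coeffSm hαs hβs 0 i).1 (atRest d' s) = 0 := by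
    intro i
    have h1 := (eq_zero_and_pd_eq_zero_of_isLittleO (h i)).1
    rw [Sm.sub_apply, linField_apply, sub_self] at h1
    simpa using h1
  have hd : ∀ i j, pd j (coeffSm hαs hβs 0 i).1 (atRest d' s) = N i j := by
    intro i j
    have h1 := (eq_zero_and_pd_eq_zero_of_isLittleO (h i)).2 j
    rw [← D_apply, map_sub, D_linField, Sm.sub_apply, Sm.algebraMap_apply, D_apply] at h1
    linarith
  constructor
  · rintro (i | i)
    · exact hv (Sum.inl i)
    · simp only [drift, Sum.elim_inr, Sm.add_apply, Sm.smul_apply, fric_apply, frictionVec_atRest,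
        mul_zero, add_zero]
      exact hv (Sum.inr i)
  · ext i j
    rw [Matrix.add_apply, ← hd i j]
    simp only [driftMat, Matrix.of_apply]
    rcases i with i | i
    · rcases j with j | j <;> simp [drift]
    · simp only [drift, Sum.elim_inr]
      rw [← D_apply, map_add, Derivation.map_smul, Sm.add_apply, Sm.smul_apply]
      rcases j with j | j
      · simp [D_inl_fric]
      · simp [D_inr_fric]

end Blocks

/-! ### Situation 1: partially degenerate coefficients. -/

section PartiallyDegenerate

variable {d d' : ℕ} {Sg : Matrix (Fin d') (Fin d') ℝ} {V : EuclideanSpace ℝ (Fin d) → ℝ}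

theorem isUnit_det_gram (hSg : IsUnit Sg.det) : IsUnit (Sg.transpose * Sg).det := by
  rw [Matrix.det_mul, Matrix.det_transpose]
  exact hSg.mul hSg

/-- The friction terms of the quadratic identity balance, and the remaining cross terms in (x, v)
give HM + 2M_βᵀΣᵀΣ = 0. This is the relation that identifies the transposed drift matrix with Λ. -/
theorem transpose_eq_of_form {H : Matrix (Fin d) (Fin d) ℝ} (hH : H.transpose = H)
    (hSg : IsUnit Sg.det) {M : Matrix (Fin d) (Fin d') ℝ} {Mβ : Matrix (Fin d') (Fin d) ℝ}
    (h : ∀ z, (Matrix.fromBlocks H 0 0 ((2 : ℝ) • (Sg.transpose * Sg))).mulVec z ⬝ᵥ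
        (Matrix.fromBlocks 0 M Mβ ((4 : ℝ) • (Sg.transpose * Sg))).mulVec z
      = 2 * ∑ k, (Matrix.fromBlocks H 0 0 ((2 : ℝ) • (Sg.transpose * Sg))).mulVec z
          (Sum.inr k) ^ 2) :
    Mβ.transpose = -(1 / 2 : ℝ) • (H * M * (Sg.transpose * Sg)⁻¹) := by
  set G := Sg.transpose * Sg with hG
  have hGT : G.transpose = G := by rw [hG, Matrix.transpose_mul, Matrix.transpose_transpose]
  have key : ∀ (x : Fin d → ℝ) (v : Fin d' → ℝ),
      x ⬝ᵥ (H * M + (2 : ℝ) • (Mβ.transpose * G)).mulVec v = 0 := by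
    intro x v
    have h1 := h (Sum.elim x v)
    have h2 : ∀ y : Fin d' → ℝ, ∀ u : Fin d → ℝ, u ⬝ᵥ Mβ.transpose.mulVec y = y ⬝ᵥ Mβ.mulVec u := by
      intro y u
      rw [Matrix.mulVec_transpose, dotProduct_comm, ← Matrix.dotProduct_mulVec]
    have h3 : x ⬝ᵥ H.mulVec (M.mulVec v) = H.mulVec x ⬝ᵥ M.mulVec v := by
      rw [dotProduct_mulVec_comm hH, dotProduct_comm]
    rw [Matrix.add_mulVec, dotProduct_add, Matrix.smul_mulVec, dotProduct_smul,
      ← Matrix.mulVec_mulVec, ← Matrix.mulVec_mulVec, h2, h3, smul_eq_mul]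
    rw [Matrix.fromBlocks_mulVec, Matrix.fromBlocks_mulVec] at h1
    simp only [Sum.elim_comp_inl, Sum.elim_comp_inr, Matrix.zero_mulVec, add_zero, zero_add,
      Sum.elim_inr, dotProduct, Fintype.sum_sum_type, Sum.elim_inl, Matrix.smul_mulVec,
      Pi.smul_apply, smul_eq_mul, Pi.add_apply] at h1
    simp only [dotProduct]
    have h4 : ∑ k, 2 * G.mulVec v k * (Mβ.mulVec x k + 4 * G.mulVec v k)
        = 2 * ∑ k, G.mulVec v k * Mβ.mulVec x k + 2 * ∑ k, (2 * G.mulVec v k) ^ 2 := by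
      rw [Finset.mul_sum, Finset.mul_sum, ← Finset.sum_add_distrib]
      exact Finset.sum_congr rfl fun k _ => by ring
    rw [h4] at h1
    linarith
  have hzero : H * M + (2 : ℝ) • (Mβ.transpose * G) = 0 := by
    refine Matrix.ext_of_mulVec_single fun j => ?_
    rw [Matrix.zero_mulVec]
    exact dotProduct_eq_zero _ fun x => by rw [dotProduct_comm]; exact key x _
  have h5 : Mβ.transpose * G = -(1 / 2 : ℝ) • (H * M) := by
    have : (2 : ℝ) • (Mβ.transpose * G) = -(H * M) := by
      rw [eq_neg_iff_add_eq_zero, add_comm]; exact hzero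
    rw [neg_smul, ← smul_neg, ← this, smul_smul]
    norm_num
  rw [← Matrix.smul_mul, ← h5, Matrix.mul_assoc, Matrix.mul_nonsing_inv _ (isUnit_det_gram hSg),
    Matrix.mul_one]

theorem IsSimpleSpectrum.exists_eigenvector {ι : Type} [Fintype ι] [DecidableEq ι]
    {L : Matrix ι ι ℝ} (hL : IsSimpleSpectrum L) :
    ∃ μ : ℝ, 0 < μ ∧ ∃ η : ι → ℝ, η ≠ 0 ∧ L.mulVec η = -μ • η := by
  obtain ⟨μ, hμ, hroot, -⟩ := hL
  refine ⟨μ, hμ, ?_⟩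
  have h1 : ((L.map (algebraMap ℝ ℂ)).charpoly).IsRoot (-(μ : ℂ)) := by
    by_contra h
    rw [Polynomial.rootMultiplicity_eq_zero h] at hroot
    exact zero_ne_one hroot
  -- The complex eigenvalue -μ is real, hence a root of the real characteristic polynomial, and a
  -- real eigenvector exists.
  have h2 : L.charpoly.eval (-μ) = 0 := by
    have h3 : (-(μ : ℂ)) = algebraMap ℝ ℂ (-μ) := by simp
    rw [h3, Matrix.charpoly_map, Polynomial.IsRoot, Polynomial.eval_map_algebraMap,
      Polynomial.aeval_algebraMap_apply] at h1
    simpa using h1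
  rw [Matrix.eval_charpoly] at h2
  obtain ⟨η, hη0, hη⟩ := Matrix.exists_mulVec_eq_zero_iff.2 h2
  refine ⟨η, hη0, ?_⟩
  rw [Matrix.sub_mulVec, sub_eq_zero] at hη
  rw [← hη]
  simp [Matrix.scalar_apply]

theorem wkb_partiallyDegenerate (hSg : IsUnit Sg.det) (hV : ContDiff ℝ ∞ V)
    {s : EuclideanSpace ℝ (Fin d)} (hs : IsSaddle V s) {h₀ : ℝ} (hh₀ : 0 < h₀)
    {α : ℝ → Phase d d' → EuclideanSpace ℝ (Fin d)}
    {β : ℝ → Phase d d' → EuclideanSpace ℝ (Fin d')}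
    {αc : ℕ → Phase d d' → EuclideanSpace ℝ (Fin d)}
    {βc : ℕ → Phase d d' → EuclideanSpace ℝ (Fin d')}
    (hα : HasClassicalExpansion Set.univ h₀ α αc) (hβ : HasClassicalExpansion Set.univ h₀ β βc)
    (hskew : ∀ h ∈ Set.Ioc 0 h₀, SkewRelation Sg V h (α h) (β h))
    {M : Matrix (Fin d) (Fin d') ℝ} {Mβ : Matrix (Fin d') (Fin d) ℝ}
    (hM : (fun X => αc 0 X - WithLp.toLp 2 (M.mulVec (vPart X).ofLp))
      =o[nhds (atRest d' s)] fun X => X - atRest d' s)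
    (hMβ : (fun X => βc 0 X - WithLp.toLp 2 (Mβ.mulVec (xPart X - s).ofLp))
      =o[nhds (atRest d' s)] fun X => X - atRest d' s)
    (hΛ : IsSimpleSpectrum (Lam Sg (hess V s) M)) :
    WKBConclusion Sg V α β αc βc s := by
  have hαs := hα.smooth_coeff
  have hβs := hβ.smooth_coeff
  have hcoord : ∀ {n : ℕ} {u : Phase d d' → EuclideanSpace ℝ (Fin n)} (i : Fin n),
      (u =o[nhds (atRest d' s)] fun X => X - atRest d' s) →
      (fun X => u X i) =o[nhds (atRest d' s)] fun X => X - atRest d' s := by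
    intro n u i hu
    refine Asymptotics.IsBigO.trans_isLittleO (Asymptotics.isBigO_of_le _ fun X => ?_) hu
    exact PiLp.norm_apply_le (u X) i
  obtain ⟨hb, hB⟩ := driftMat_eq (Sg := Sg) hαs hβs (s := s)
    (N := Matrix.fromBlocks 0 M Mβ 0) (by
      rintro (i | i)
      · refine (hcoord i hM).congr_left fun X => ?_
        rw [Sm.sub_apply, linField_apply, Matrix.fromBlocks_mulVec]
        have h1 : (X - atRest d' s).ofLp ∘ Sum.inr = (vPart X).ofLp := by
          ext j
          simp [atRest, vPart]
        simp only [Sum.elim_inl, Matrix.zero_mulVec, zero_add, h1]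
        rfl
      · refine (hcoord i hMβ).congr_left fun X => ?_
        rw [Sm.sub_apply, linField_apply, Matrix.fromBlocks_mulVec]
        have h1 : (X - atRest d' s).ofLp ∘ Sum.inl = (xPart X - s).ofLp := rfl
        simp only [Sum.elim_inr, Matrix.zero_mulVec, add_zero, h1]
        rfl)
  rw [Matrix.fromBlocks_add] at hB
  simp only [add_zero, zero_add] at hB
  have hform := driftMat_form (Sg := Sg) (coeffSm hαs hβs) hb (energy_crit hV hs.1)
      (vecDot_drift_energy hV hαs hβs (skewRelation_limit hh₀ hα hβ hskew))
  rw [hess_energy, hB] at hform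
  have hH : (hess V s).transpose = hess V s := hess_transpose (Sm.mk V hV) s
  have hT := transpose_eq_of_form hH hSg hform
  have hLam : (driftMat Sg (coeffSm hαs hβs) (atRest d' s)).transpose = Lam Sg (hess V s) M := by
    rw [hB, Matrix.fromBlocks_transpose, hT, Lam, Matrix.transpose_zero, Matrix.transpose_smul,
      Matrix.transpose_mul, Matrix.transpose_transpose]
  obtain ⟨μ, hμ, η, hη0, hη⟩ := hΛ.exists_eigenvector
  rw [← hLam] at hη
  exact WKBConclusion.of_eigenvector hSg hV hs hh₀ hα hβ hskew hαs hβs hb hμ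
    (inr_ne_zero_of_eigenvector hμ hη0 (by rw [← hB]; exact hη)) hη

end PartiallyDegenerate

/-! ### Situation 3: added magnetic field. -/

section MagneticField

/-- The characteristic polynomial of -L takes the value det L < 0 at 0 and tends to +∞, so it has a
positive root μ. -/
theorem exists_neg_eigenvalue {ι : Type} [Fintype ι] [DecidableEq ι] {L : Matrix ι ι ℝ}
    (h : L.det < 0) : ∃ μ : ℝ, 0 < μ ∧ ∃ η : ι → ℝ, η ≠ 0 ∧ L.mulVec η = -μ • η := by
  have hne : Nonempty ι := by
    by_contra hne
    rw [not_nonempty_iff] at hne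
    rw [Matrix.det_isEmpty] at h
    linarith
  have hdeg : 0 < (-L).charpoly.degree := by
    rw [Matrix.charpoly_degree_eq_dim]
    exact_mod_cast Fintype.card_pos
  have htend := (-L).charpoly.tendsto_atTop_of_leadingCoeff_nonneg hdeg
    (by rw [(Matrix.charpoly_monic _).leadingCoeff]; exact zero_le_one)
  obtain ⟨t, ht⟩ := (htend.eventually_gt_atTop 0).and (Filter.eventually_ge_atTop 0) |>.exists
  have h0 : (-L).charpoly.eval 0 < 0 := by
    rw [Matrix.eval_charpoly]
    simpa using h
  obtain ⟨μ, hμ, hroot⟩ := intermediate_value_Icc ht.2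
    (f := fun t => (-L).charpoly.eval t) (Polynomial.continuous _).continuousOn
    ⟨h0.le, ht.1.le⟩
  have hμ0 : 0 < μ := by
    refine lt_of_le_of_ne hμ.1 fun h1 => ?_
    rw [← h1] at hroot
    exact h0.ne hroot
  have hdet : (Matrix.scalar ι μ - -L).det = 0 := by rw [← Matrix.eval_charpoly]; exact hroot
  obtain ⟨η, hη0, hη⟩ := Matrix.exists_mulVec_eq_zero_iff.2 hdet
  refine ⟨μ, hμ0, η, hη0, ?_⟩
  rw [sub_neg_eq_add, Matrix.add_mulVec, add_comm, ← eq_neg_iff_add_eq_zero] at hη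
  rw [hη]
  simp [Matrix.scalar_apply]

/-- Multiplication by the rotation [[0, -1], [1, 0]], a product of shears and so of determinant 1,
makes the matrix block triangular. -/
theorem det_fromBlocks_zero₁₁ {n : ℕ} (A B E : Matrix (Fin n) (Fin n) ℝ) :
    (Matrix.fromBlocks 0 A B E).det = A.det * (-B).det := by
  let I₁ : Matrix (Fin n) (Fin n) ℝ := 1
  have h1 : Matrix.fromBlocks 0 (-I₁) I₁ 0
      = Matrix.fromBlocks I₁ (-I₁) 0 I₁ * (Matrix.fromBlocks I₁ 0 I₁ I₁
        * Matrix.fromBlocks I₁ (-I₁) 0 I₁) := by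
    simp [Matrix.fromBlocks_multiply, I₁]
  have h2 : (Matrix.fromBlocks 0 (-I₁) I₁ 0).det = 1 := by
    rw [h1, Matrix.det_mul, Matrix.det_mul, Matrix.det_fromBlocks_zero₂₁,
      Matrix.det_fromBlocks_zero₁₂]
    simp [I₁]
  have h3 : Matrix.fromBlocks 0 A B E * Matrix.fromBlocks 0 (-I₁) I₁ 0
      = Matrix.fromBlocks A 0 E (-B) := by
    simp [Matrix.fromBlocks_multiply, I₁]
  rw [← mul_one (Matrix.det _), ← h2, ← Matrix.det_mul, h3, Matrix.det_fromBlocks_zero₁₂]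

theorem hasClassicalExpansion_const {E F : Type} [NormedAddCommGroup E] [NormedSpace ℝ E]
    [NormedAddCommGroup F] [NormedSpace ℝ F] {u : E → F} (hu : ContDiff ℝ ∞ u) {h₀ : ℝ} :
    HasClassicalExpansion Set.univ h₀ (fun _ => u) (constCoeff u) := by
  have h := hasClassicalExpansion_of_finite (c := constCoeff u) (h₀ := h₀) (fun j => by
    cases j with
    | zero => exact hu
    | succ j => exact contDiff_const) 1 (fun j hj => by
    obtain ⟨k, rfl⟩ : ∃ k, j = k + 1 := ⟨j - 1, by omega⟩
    rfl)
  convert h using 3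
  simp [constCoeff]

variable {Sg : Matrix (Fin 3) (Fin 3) ℝ} {V : EuclideanSpace ℝ (Fin 3) → ℝ}
  {b : EuclideanSpace ℝ (Fin 3) → EuclideanSpace ℝ (Fin 3)}

theorem contDiff_coord_comp {E : Type} [NormedAddCommGroup E] [NormedSpace ℝ E] {n : ℕ}
    {u : E → EuclideanSpace ℝ (Fin n)} (hu : ContDiff ℝ ∞ u) (i : Fin n) :
    ContDiff ℝ ∞ fun X => u X i :=
  (EuclideanSpace.proj (𝕜 := ℝ) i).contDiff.comp hu

theorem contDiff_of_sm {ι : Type} [Fintype ι] [DecidableEq ι] {n : ℕ} (c : Fin n → Sm ι)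
    {u : EuclideanSpace ℝ ι → EuclideanSpace ℝ (Fin n)} (h : ∀ X i, u X i = (c i).1 X) :
    ContDiff ℝ ∞ u := by
  rw [contDiff_euclidean]
  intro i
  simp only [h]
  exact (c i).contDiff

/-- The components of `-2 ∂_x V + b ∧ ΣᵀΣ v`. -/
def magSm (Sg : Matrix (Fin 3) (Fin 3) ℝ) (hV : ContDiff ℝ ∞ V) (hb : ContDiff ℝ ∞ b) :
    Fin 3 → Sm (Fin 3 ⊕ Fin 3) :=
  let B := fun i => liftX (d' := 3) (fun x => b x i) (contDiff_coord_comp hb i)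
  let g := fric Sg 3
  fun i => (-2 : ℝ) • liftX (pd i V) (contDiff_pd hV i)
    + ![B 1 * g 2 - B 2 * g 1, B 2 * g 0 - B 0 * g 2, B 0 * g 1 - B 1 * g 0] i

theorem betaMag_apply (hV : ContDiff ℝ ∞ V) (hb : ContDiff ℝ ∞ b) (X : Phase 3 3) (i : Fin 3) :
    betaMag Sg V b X i = (magSm Sg hV hb i).1 X := by
  simp only [betaMag, magSm, Sm.add_apply, Sm.smul_apply, liftX_apply, Pi.add_apply, cross_apply]
  congr 1
  fin_cases i <;> simp [fric_apply]

theorem alphaMag_apply (X : Phase 3 3) (i : Fin 3) :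
    alphaMag Sg X i = ((4 : ℝ) • fric Sg 3 i).1 X := by
  simp [alphaMag, fric_apply]

/-- The magnetic term is orthogonal to ΣᵀΣv and, ΣᵀΣ being symmetric, divergence free in v; the
contributions of 4ΣᵀΣv and -2∂_xV cancel. -/
theorem skewRelation_magnetic (hV : ContDiff ℝ ∞ V) (hb : ContDiff ℝ ∞ b) (h : ℝ) :
    SkewRelation Sg V h (alphaMag Sg) (betaMag Sg V b) := by
  intro X
  have h1 : (∑ i, alphaMag Sg X i * pd i V (xPart X))
      + 2 * (∑ j, betaMag Sg V b X j * frictionVec Sg X j) = 0 := by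
    simp only [alphaMag_apply, betaMag_apply hV hb, magSm, Fin.sum_univ_three, Sm.add_apply,
      Sm.smul_apply, liftX_apply, fric_apply, Matrix.cons_val_zero, Matrix.cons_val_one,
      Matrix.cons_val, Sm.sub_apply, Sm.mul_apply]
    ring
  have h2 : divXV (alphaMag Sg) (betaMag Sg V b) X = 0 := by
    have e1 : ∀ i, (fun Y => alphaMag Sg Y i) = ((4 : ℝ) • fric Sg 3 i).1 :=
      fun i => funext fun Y => alphaMag_apply Y i
    have e2 : ∀ i, (fun Y => betaMag Sg V b Y i) = (magSm Sg hV hb i).1 :=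
      fun i => funext fun Y => betaMag_apply hV hb Y i
    have s10 := gram_symm Sg 1 0
    have s20 := gram_symm Sg 2 0
    have s21 := gram_symm Sg 2 1
    simp only [divXV, e1, e2, ← D_apply, Derivation.map_smul, D_inl_fric, smul_zero, Sm.zero_apply,
      Finset.sum_const_zero, zero_add, magSm, Fin.sum_univ_three, map_add, map_sub, D_inr_liftX,
      Matrix.cons_val_zero, Matrix.cons_val_one, Matrix.cons_val, D_mul, D_inr_fric, mul_zero,
      add_zero, Sm.sub_apply, Sm.mul_apply, liftX_apply, Sm.algebraMap_apply]
    rw [s10, s20, s21]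
    ring
  rw [h1, h2]
  ring

/-- The drift matrix is [[0, 4ΣᵀΣ], [-2H, *]], so its determinant is 4³·2³ det(Σ)² det H < 0
whatever the magnetic field, which only enters the velocity block. -/
theorem wkb_magnetic (hSg : IsUnit Sg.det) (hV : ContDiff ℝ ∞ V) (hb : ContDiff ℝ ∞ b)
    {s : EuclideanSpace ℝ (Fin 3)} (hs : IsSaddle V s) :
    WKBConclusion Sg V (fun _ => alphaMag Sg) (fun _ => betaMag Sg V b)
      (constCoeff (alphaMag Sg)) (constCoeff (betaMag Sg V b)) s := by
  have hα : ContDiff ℝ ∞ (alphaMag Sg) := contDiff_of_sm _ alphaMag_apply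
  have hβ : ContDiff ℝ ∞ (betaMag Sg V b) := contDiff_of_sm _ (betaMag_apply hV hb)
  have hα' := hasClassicalExpansion_const hα (h₀ := 1)
  have hβ' := hasClassicalExpansion_const hβ (h₀ := 1)
  have hskew : ∀ h ∈ Set.Ioc (0 : ℝ) 1, SkewRelation Sg V h (alphaMag Sg) (betaMag Sg V b) :=
    fun h _ => skewRelation_magnetic hV hb h
  have hαs := hα'.smooth_coeff
  have hβs := hβ'.smooth_coeff
  set a := coeffSm hαs hβs
  have ha1 : ∀ i, a 0 (Sum.inl i) = (4 : ℝ) • fric Sg 3 i := fun i => Sm.ext fun X =>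
    alphaMag_apply X i
  have ha2 : ∀ i, a 0 (Sum.inr i) = magSm Sg hV hb i := fun i => Sm.ext fun X =>
    betaMag_apply hV hb X i
  have hb0 : ∀ i, (drift Sg a i).1 (atRest 3 s) = 0 := by
    rintro (i | i)
    · simp [drift, ha1, fric_apply]
    · simp only [drift, Sum.elim_inr, ha2, magSm, Sm.add_apply, Sm.smul_apply, liftX_apply,
        xPart_atRest, hs.1, fric_apply, frictionVec_atRest]
      fin_cases i <;> simp [fric_apply]
  have hB : driftMat Sg a (atRest 3 s) = Matrix.fromBlocks 0 ((4 : ℝ) • (Sg.transpose * Sg))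
      ((-2 : ℝ) • hess V s) (driftMat Sg a (atRest 3 s)).toBlocks₂₂ := by
    ext i j
    rcases i with i | i
    · rw [driftMat, Matrix.of_apply]
      simp only [drift, Sum.elim_inl, ha1]
      rw [← D_apply, Derivation.map_smul]
      rcases j with j | j
      · simp [D_inl_fric]
      · simp [D_inr_fric]
    · rcases j with j | j
      · rw [driftMat, Matrix.of_apply]
        have e : ∀ k, ((fric Sg 3 k).1 (atRest 3 s)) = 0 := fun k => by
          rw [fric_apply, frictionVec_atRest]
        have hH : hess V s i j = pd j (pd i V) s :=
          congrFun (congrFun (hess_transpose (Sm.mk V hV) s) i) j |>.symm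
        simp only [drift, Sum.elim_inr, ha2, magSm]
        rw [← D_apply]
        simp only [map_add, Derivation.map_smul, D_inl_fric, D_inl_liftX, Sm.add_apply,
          Sm.smul_apply, liftX_apply, xPart_atRest, smul_zero, add_zero,
          Matrix.fromBlocks_apply₂₁, Matrix.smul_apply, hH, smul_eq_mul, add_eq_left]
        fin_cases i <;> simp [D_inl_fric, e]
      · rfl
  have hdet : (driftMat Sg a (atRest 3 s)).transpose.det < 0 := by
    rw [Matrix.det_transpose, hB, det_fromBlocks_zero₁₁, Matrix.det_neg, Matrix.det_smul,
      Matrix.det_smul, Matrix.det_mul, Matrix.det_transpose]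
    have h1 := (saddle_energy (d' := 3) hSg hV hs).2
    have h2 : 0 < Sg.det * Sg.det := mul_self_pos.2 hSg.ne_zero
    simp only [Fintype.card_fin]
    nlinarith [mul_neg_of_pos_of_neg h2 h1]
  obtain ⟨μ, hμ, η, hη0, hη⟩ := exists_neg_eigenvalue hdet
  refine WKBConclusion.of_eigenvector hSg hV hs one_pos hα' hβ' hskew hαs hβs hb0 hμ ?_ hη
  rw [hB] at hη
  exact inr_ne_zero_of_eigenvector hμ hη0 hη

end MagneticField

/-! ### Pullback by smooth maps, and division by a coordinate. -/

section Pullback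

variable {ι κ : Type} [Fintype ι] [DecidableEq ι] [Fintype κ] [DecidableEq κ]

/-- The map with components `ψ k`. -/
def Sm.toMap (ψ : κ → Sm ι) (X : EuclideanSpace ℝ ι) : EuclideanSpace ℝ κ :=
  WithLp.toLp 2 fun k => (ψ k).1 X

theorem Sm.contDiff_toMap (ψ : κ → Sm ι) : ContDiff ℝ ∞ (Sm.toMap ψ) := by
  rw [contDiff_euclidean]
  exact fun k => (ψ k).contDiff

/-- Composition with the map with components `ψ k`. -/
def pull (ψ : κ → Sm ι) : Sm κ →ₐ[ℝ] Sm ι where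
  toFun u := Sm.mk (fun X => u.1 (Sm.toMap ψ X)) (u.contDiff.comp (Sm.contDiff_toMap ψ))
  map_one' := rfl
  map_mul' _ _ := rfl
  map_zero' := rfl
  map_add' _ _ := rfl
  commutes' _ := rfl

@[simp] theorem pull_apply (ψ : κ → Sm ι) (u : Sm κ) (X : EuclideanSpace ℝ ι) :
    (pull ψ u).1 X = u.1 (Sm.toMap ψ X) := rfl

theorem D_pull (ψ : κ → Sm ι) (u : Sm κ) (i : ι) :
    D i (pull ψ u) = ∑ k, D i (ψ k) * pull ψ (D k u) := by
  ext X
  have h1 : DifferentiableAt ℝ (Sm.toMap ψ) X :=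
    (Sm.contDiff_toMap ψ).differentiable (by simp) X
  have h2 : HasFDerivAt (pull ψ u).1
      ((fderiv ℝ u.1 (Sm.toMap ψ X)).comp (fderiv ℝ (Sm.toMap ψ) X)) X :=
    (u.differentiable (Sm.toMap ψ X)).hasFDerivAt.comp X h1.hasFDerivAt
  rw [D_apply, pd_eq_of_hasFDerivAt h2, ContinuousLinearMap.comp_apply, fderiv_eq_sum_pd]
  simp only [Sm.sum_apply, Sm.mul_apply, D_apply, pull_apply]
  refine Finset.sum_congr rfl fun k _ => ?_
  congr 1
  have h3 : HasFDerivAt (ψ k).1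
      ((EuclideanSpace.proj (𝕜 := ℝ) k).comp (fderiv ℝ (Sm.toMap ψ) X)) X :=
    (EuclideanSpace.proj (𝕜 := ℝ) k).hasFDerivAt.comp X h1.hasFDerivAt
  rw [pd_eq_of_hasFDerivAt h3]
  rfl

theorem pull_coo (ψ : κ → Sm ι) (k : κ) : pull ψ (coo k) = ψ k := by
  ext X
  simp [Sm.toMap]

theorem pull_mem_I {ψ : κ → Sm ι} {s : EuclideanSpace ℝ ι} {n : ℕ} {u : Sm κ}
    (hu : u ∈ I (Sm.toMap ψ s) n) : pull ψ u ∈ I s n := by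
  induction n generalizing u with
  | zero => exact mem_I_zero _
  | succ n ih =>
    refine mem_I_succ.2 ⟨(mem_I_succ.1 hu).1, fun i => ?_⟩
    rw [D_pull]
    exact sum_mem fun k _ => Ideal.mul_mem_left _ _ (ih ((mem_I_succ.1 hu).2 k))

theorem eq_of_fderiv_eq_zero (u : Sm ι) (Y : EuclideanSpace ℝ ι)
    (h : ∀ X, fderiv ℝ u.1 X Y = 0) (X : EuclideanSpace ℝ ι) (t : ℝ) :
    u.1 (X + t • Y) = u.1 X := by
  have h1 : ∀ t : ℝ, HasDerivAt (fun t : ℝ => u.1 (X + t • Y)) 0 t := by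
    intro t
    have h2 : HasDerivAt (fun t : ℝ => X + t • Y) Y t := by
      simpa using ((hasDerivAt_id t).smul_const Y).const_add X
    have h3 := (u.differentiable (X + t • Y)).hasFDerivAt.comp_hasDerivAt t h2
    rwa [h] at h3
  have h4 := is_const_of_deriv_eq_zero (fun t => (h1 t).differentiableAt) (fun t => (h1 t).deriv)
    t 0
  simpa using h4

/-- A coordinate is not a zero divisor: u vanishes off the hyperplane, which is dense, and u is
continuous. -/
theorem eq_zero_of_coo_mul {i : ι} {u : Sm ι} (h : coo i * u = 0) : u = 0 := by
  have h1 : ∀ X : EuclideanSpace ℝ ι, X i * u.1 X = 0 := fun X => by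
    have := congrArg (fun w : Sm ι => w.1 X) h
    simpa using this
  ext X
  have h2 : Filter.Tendsto (fun t : ℝ => u.1 (X + t • EuclideanSpace.single i 1))
      (nhdsWithin 0 {0}ᶜ) (nhds (u.1 X)) := by
    have : Continuous fun t : ℝ => u.1 (X + t • EuclideanSpace.single i 1) := by
      have := u.contDiff.continuous
      fun_prop
    have h3 := this.tendsto 0
    simp only [zero_smul, add_zero] at h3
    exact h3.mono_left nhdsWithin_le_nhds
  refine tendsto_nhds_unique h2 (tendsto_const_nhds.congr' ?_)
  by_cases hX : X i = 0
  · filter_upwards [self_mem_nhdsWithin] with t ht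
    have h3 := h1 (X + t • EuclideanSpace.single i 1)
    have h4 : (X + t • EuclideanSpace.single i (1 : ℝ)) i = t := by simp [hX]
    rw [h4] at h3
    exact ((mul_eq_zero.1 h3).resolve_left ht).symm
  · have h3 : ∀ᶠ t : ℝ in nhds 0, (X + t • EuclideanSpace.single i (1 : ℝ)) i ≠ 0 := by
      have : Continuous fun t : ℝ => (X + t • EuclideanSpace.single i (1 : ℝ)) i := by
        simp only [PiLp.add_apply, PiLp.smul_apply]
        fun_prop
      refine this.continuousAt.eventually_ne ?_
      simpa using hX
    filter_upwards [h3.filter_mono nhdsWithin_le_nhds] with t ht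
    exact ((mul_eq_zero.1 (h1 _)).resolve_left ht).symm

end Pullback

/-! ### The variables (x, z) with z = v²: formal equations with prescribed trace on z = 0. -/

section Plane

/-- Smooth functions of two real variables, the position and the square of the velocity. -/
abbrev Pl : Type := Sm (Fin 1 ⊕ Fin 1)

/-- The first coordinate. -/
abbrev Xc : Pl := coo (Sum.inl 0)

/-- The second coordinate. -/
abbrev Zc : Pl := coo (Sum.inr 0)

/-- The derivative in the first variable. -/
abbrev Dx : Derivation ℝ Pl Pl := D (Sum.inl 0)

/-- The derivative in the second variable. -/
abbrev Dz : Derivation ℝ Pl Pl := D (Sum.inr 0)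

/-- Restriction to the axis `z = 0`. -/
def trace : Pl →ₐ[ℝ] Pl := pull (Sum.elim (fun _ => Xc) (fun _ => 0))

/-- Composition with `(x, v) ↦ (x, v²)`. -/
def sqv : Pl →ₐ[ℝ] Pl := pull (Sum.elim (fun _ => Xc) (fun _ => Zc * Zc))

theorem Dx_Xc : Dx Xc = 1 := by simp [D_coord]
theorem Dz_Xc : Dz Xc = 0 := by simp [D_coord]
theorem Dx_Zc : Dx Zc = 0 := by simp [D_coord]
theorem Dz_Zc : Dz Zc = 1 := by simp [D_coord]

@[simp] theorem trace_Zc : trace Zc = 0 := pull_coo _ _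

@[simp] theorem sqv_Zc : sqv Zc = Zc * Zc := pull_coo _ _

theorem Dx_trace (u : Pl) : Dx (trace u) = trace (Dx u) := by
  rw [trace, D_pull, Fintype.sum_sum_type]
  simp only [Fin.sum_univ_one, Sum.elim_inl, Sum.elim_inr, Dx_Xc, map_zero, zero_mul, add_zero,
    one_mul]

theorem Dz_trace (u : Pl) : Dz (trace u) = 0 := by
  rw [trace, D_pull, Fintype.sum_sum_type]
  simp only [Fin.sum_univ_one, Sum.elim_inl, Sum.elim_inr, Dz_Xc, map_zero, zero_mul, add_zero]

theorem Dx_sqv (u : Pl) : Dx (sqv u) = sqv (Dx u) := by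
  rw [sqv, D_pull, Fintype.sum_sum_type]
  simp only [Fin.sum_univ_one, Sum.elim_inl, Sum.elim_inr, Dx_Xc, D_mul, Dx_Zc, mul_zero, zero_mul,
    add_zero, one_mul]

theorem Dz_sqv (u : Pl) : Dz (sqv u) = 2 * Zc * sqv (Dz u) := by
  rw [sqv, D_pull, Fintype.sum_sum_type]
  simp only [Fin.sum_univ_one, Sum.elim_inl, Sum.elim_inr, Dz_Xc, D_mul, Dz_Zc, mul_one, zero_mul,
    zero_add]
  ring

theorem phase_ext {X Y : Phase 1 1} (h0 : X (Sum.inl 0) = Y (Sum.inl 0))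
    (h1 : X (Sum.inr 0) = Y (Sum.inr 0)) : X = Y := by
  ext i
  rcases i with i | i <;> rw [Subsingleton.elim i 0] <;> assumption

@[simp] theorem trace_trace (u : Pl) : trace (trace u) = trace u := by
  ext X
  exact congrArg u.1 (phase_ext (by simp [Sm.toMap]) (by simp [Sm.toMap]))

theorem trace_liftX {U : EuclideanSpace ℝ (Fin 1) → ℝ} (hU : ContDiff ℝ ∞ U) :
    trace (liftX U hU) = liftX U hU := by
  ext X
  simp only [trace, pull_apply, liftX_apply]
  congr 1
  ext i
  rw [Subsingleton.elim i 0]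
  simp [xPart, Sm.toMap]

theorem sqv_liftX {U : EuclideanSpace ℝ (Fin 1) → ℝ} (hU : ContDiff ℝ ∞ U) :
    sqv (liftX U hU) = liftX U hU := by
  ext X
  simp only [sqv, pull_apply, liftX_apply]
  congr 1
  ext i
  rw [Subsingleton.elim i 0]
  simp [xPart, Sm.toMap]

variable {s : EuclideanSpace ℝ (Fin 1)}

theorem trace_mem_I {n : ℕ} {u : Pl} (hu : u ∈ I (atRest 1 s) n) : trace u ∈ I (atRest 1 s) n := by
  refine pull_mem_I ?_
  convert hu using 2
  exact phase_ext (by simp [Sm.toMap]) (by simp [Sm.toMap, atRest])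

theorem trace_mem_Flat {u : Pl} (hu : u ∈ Flat (atRest 1 s)) : trace u ∈ Flat (atRest 1 s) :=
  mem_Flat.2 fun n => trace_mem_I (mem_Flat.1 hu n)

theorem sqv_mem_I {n : ℕ} {u : Pl} (hu : u ∈ I (atRest 1 s) n) : sqv u ∈ I (atRest 1 s) n := by
  refine pull_mem_I ?_
  convert hu using 2
  exact phase_ext (by simp [Sm.toMap]) (by simp [Sm.toMap, atRest])

theorem sqv_mem_Flat {u : Pl} (hu : u ∈ Flat (atRest 1 s)) : sqv u ∈ Flat (atRest 1 s) :=
  mem_Flat.2 fun n => sqv_mem_I (mem_Flat.1 hu n)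

theorem trace_mem_Hom {n : ℕ} {p : Pl} (hp : p ∈ Hom (atRest 1 s) n) :
    trace p ∈ Hom (atRest 1 s) n := by
  intro t X
  have h1 : ∀ Y : Phase 1 1, Sm.toMap (Sum.elim (fun _ => Xc) (fun _ => 0)) (atRest 1 s + Y)
      = atRest 1 s + Sm.toMap (Sum.elim (fun _ => Xc) (fun _ => (0 : Pl))) Y := fun Y =>
    phase_ext (by simp [Sm.toMap]) (by simp [Sm.toMap, atRest])
  have h2 : Sm.toMap (Sum.elim (fun _ => Xc) (fun _ => (0 : Pl))) (t • X)
      = t • Sm.toMap (Sum.elim (fun _ => Xc) (fun _ => (0 : Pl))) X :=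
    phase_ext (by simp [Sm.toMap]) (by simp [Sm.toMap])
  simp only [trace, pull_apply]
  rw [h1, h1, h2]
  exact hp t _

theorem Zc_eq : (Zc : Pl) = coord (atRest 1 s) (Sum.inr 0) := by
  ext X
  simp [atRest]

theorem Zc_mem_I : Zc ∈ I (atRest 1 s) 1 := by
  rw [Zc_eq (s := s)]
  exact coord_mem_I _

theorem Zc_mem_Hom : Zc ∈ Hom (atRest 1 s) 1 := by
  rw [Zc_eq (s := s)]
  exact coord_mem_Hom _

/-- The leading part of the equations that determine a function from its restriction to `z = 0`. -/
def charOp : Pl →ₗ[ℝ] Pl :=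
  (LinearMap.mulLeft ℝ Zc).comp ((Dx : Pl →ₗ[ℝ] Pl) + (2 : ℝ) • (Dz : Pl →ₗ[ℝ] Pl))
    + trace.toLinearMap

theorem charOp_eq (q : Pl) : charOp q = Zc * (Dx q + 2 * Dz q) + trace q := by
  have : (2 : ℝ) • Dz q = 2 * Dz q := by rw [Algebra.smul_def, map_ofNat]
  rw [← this]
  rfl

theorem charOp_mem_Hom {n : ℕ} {p : Pl} (hp : p ∈ Hom (atRest 1 s) n) :
    charOp p ∈ Hom (atRest 1 s) n := by
  rw [charOp_eq]
  refine add_mem ?_ (trace_mem_Hom hp)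
  cases n with
  | zero =>
    rw [D_eq_zero_of_mem_Hom_zero hp, D_eq_zero_of_mem_Hom_zero hp]
    simp
  | succ n =>
    rw [add_comm n 1]
    refine mul_mem_Hom Zc_mem_Hom (add_mem (D_mem_Hom hp _) ?_)
    rw [two_mul]
    exact add_mem (D_mem_Hom hp _) (D_mem_Hom hp _)

/-- Taking traces gives trace q = 0, and dividing by z shows that q is constant along the direction
(1, 2). Every such line meets the axis z = 0, where q vanishes. The trace was added to the operator
to make it injective. -/
theorem eq_zero_of_charOp_eq_zero {q : Pl} (h : charOp q = 0) : q = 0 := by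
  rw [charOp_eq] at h
  have htr : trace q = 0 := by
    have := congrArg trace h
    simpa using this
  rw [htr, add_zero] at h
  have h1 := eq_zero_of_coo_mul h
  set Y : Phase 1 1 := WithLp.toLp 2 (Sum.elim (fun _ => 1) (fun _ => 2)) with hY
  have h2 : ∀ X, fderiv ℝ q.1 X Y = 0 := by
    intro X
    rw [fderiv_eq_sum_pd, Fintype.sum_sum_type]
    have h3 := congrArg (fun w : Pl => w.1 X) h1
    have h4 : ((2 : Pl)).1 X = 2 := by
      rw [← map_ofNat (algebraMap ℝ Pl) 2, Sm.algebraMap_apply]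
    simp only [Sm.add_apply, Sm.mul_apply, h4, D_apply, Sm.zero_apply] at h3
    simp only [Fin.sum_univ_one, hY, Sum.elim_inl, Sum.elim_inr, one_mul]
    exact h3
  ext X
  have h5 := eq_of_fderiv_eq_zero q Y h2 X (-(X (Sum.inr 0)) / 2)
  rw [← h5]
  have h6 := congrArg (fun w : Pl => w.1 (X + (-(X (Sum.inr 0)) / 2) • Y)) htr
  refine Eq.trans (congrArg q.1 (phase_ext ?_ ?_)) h6
  · simp [Sm.toMap]
  · simp [Sm.toMap, hY]

theorem exists_charOp_eq {n : ℕ} {p : Pl} (hp : p ∈ Hom (atRest 1 s) n) (htr : trace p = 0) :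
    ∃ q ∈ Hom (atRest 1 s) n, trace q = 0 ∧ Zc * (Dx q + 2 * Dz q) = p := by
  obtain ⟨q, hq, hqp⟩ := exists_mem_Hom_eq charOp (fun _ h => charOp_mem_Hom h)
    (fun _ _ h => eq_zero_of_charOp_eq_zero h) hp
  rw [charOp_eq] at hqp
  have h1 : trace q = 0 := by
    have := congrArg trace hqp
    simpa [htr] using this
  exact ⟨q, hq, h1, by rw [← hqp, h1, add_zero]⟩

/-- Formal solution, with prescribed restriction to `z = 0`, of an equation with leading part
`z (∂_x + 2 ∂_z)`. -/
theorem exists_solution_with_trace (Φ : Pl → Pl) (n₀ : ℕ) {y u₀ : Pl} (hu₀ : trace u₀ = y)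
    (h₀ : Φ u₀ ∈ I (atRest 1 s) n₀)
    (htr : ∀ u, trace u = y → trace (Φ u) ∈ Flat (atRest 1 s))
    (hlin : ∀ N, n₀ ≤ N → ∀ u q, u - u₀ ∈ I (atRest 1 s) n₀ → q ∈ I (atRest 1 s) N →
      Φ (u + q) - Φ u - Zc * (Dx q + 2 * Dz q) ∈ I (atRest 1 s) (N + 1))
    (hcont : ∀ N u q, q ∈ I (atRest 1 s) (N + 1) → Φ (u + q) - Φ u ∈ I (atRest 1 s) N) :
    ∃ g, trace g = y ∧ g - u₀ ∈ I (atRest 1 s) n₀ ∧ Φ g ∈ Flat (atRest 1 s) := by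
  obtain ⟨u, hu, hu'⟩ := exists_formal_solution (s := atRest 1 s) Φ (fun u => trace u = y) n₀ u₀
    hu₀ h₀ (fun N hN u hu htu hΦ => by
      obtain ⟨p, hp, hΦp⟩ := exists_leading hΦ
      -- The error has flat trace, so its leading part vanishes on the axis: this is the condition
      -- under which it is divisible by z and can be removed without changing the trace.
      have htp : trace p = 0 := by
        refine eq_zero_of_mem_Hom_of_mem_I (trace_mem_Hom hp) ?_
        have h1 := sub_mem (mem_Flat.1 (htr u htu) (N + 1)) (trace_mem_I hΦp)
        rwa [map_sub, sub_sub_cancel] at h1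
      obtain ⟨q, hq, htq, hqp⟩ := exists_charOp_eq (neg_mem hp) (by rw [map_neg, htp, neg_zero])
      refine ⟨q, hq, by rw [map_add, htu, htq, add_zero], ?_⟩
      have h1 := hlin N hN u q hu (Hom_le_I hq)
      rw [hqp] at h1
      convert add_mem h1 hΦp using 1
      ring)
  have hflat : trace u - y ∈ Flat (atRest 1 s) := by
    refine mem_Flat.2 fun N => ?_
    obtain ⟨w, hw, huw, -⟩ := hu' N
    have := trace_mem_I huw
    rwa [map_sub, hw] at this
  have hy : trace y = y := by rw [← hu₀, trace_trace]
  -- The Borel sum has the prescribed trace only up to a flat function, which is subtracted.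
  refine ⟨u - (trace u - y), ?_, ?_, ?_⟩
  · rw [map_sub, map_sub, trace_trace, hy]; ring
  · have := sub_mem hu (mem_Flat.1 hflat n₀)
    convert this using 1
    ring
  · refine mem_Flat.2 fun N => ?_
    obtain ⟨w, -, huw, hw⟩ := hu' (N + 1)
    have h1 := hcont N w (u - (trace u - y) - w) (by
      have := sub_mem huw (mem_Flat.1 hflat (N + 1))
      convert this using 1
      ring)
    rw [add_sub_cancel] at h1
    have := add_mem h1 (I_anti (by omega) hw)
    rwa [sub_add_cancel] at this

/-- Formal solution, among the functions of `x`, of an equation with leading part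
`κ ((x - s) ∂_x + 1)`. -/
theorem exists_trace_solution (Φ : Pl → Pl) (n₀ : ℕ) {u₀ : Pl} (hu₀ : trace u₀ = u₀)
    (h₀ : Φ u₀ ∈ I (atRest 1 s) n₀) {κ : ℝ} (hκ : κ ≠ 0)
    (htr : ∀ u, Φ (trace u) = trace (Φ u))
    (hlin : ∀ N, n₀ ≤ N → ∀ u q, u - u₀ ∈ I (atRest 1 s) n₀ → q ∈ I (atRest 1 s) N →
      Φ (u + q) - Φ u - κ • (coord (atRest 1 s) (Sum.inl 0) * Dx q + q) ∈ I (atRest 1 s) (N + 1))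
    (hcont : ∀ N u q, q ∈ I (atRest 1 s) (N + 1) → Φ (u + q) - Φ u ∈ I (atRest 1 s) N) :
    ∃ y, trace y = y ∧ y - u₀ ∈ I (atRest 1 s) n₀ ∧ Φ y ∈ Flat (atRest 1 s) := by
  obtain ⟨u, hu, hu'⟩ := exists_formal_solution (s := atRest 1 s) Φ (fun u => trace u = u) n₀ u₀
    hu₀ h₀ (fun N hN u hu htu hΦ => by
      obtain ⟨p, hp, hΦp⟩ := exists_leading hΦ
      have hp' := trace_mem_Hom hp
      have hΦp' : Φ u - trace p ∈ I (atRest 1 s) (N + 1) := by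
        have := trace_mem_I hΦp
        rwa [map_sub, ← htr, htu] at this
      have heul := euler hp'
      rw [Fintype.sum_sum_type, Fin.sum_univ_one, Fin.sum_univ_one, Dz_trace, mul_zero,
        add_zero] at heul
      -- By Euler's identity, κ((x - s)∂_x + 1) is multiplication by κ(N + 1) on homogeneous
      -- functions of x of degree N.
      refine ⟨(-(κ * (N + 1))⁻¹) • trace p, Submodule.smul_mem _ _ hp', ?_, ?_⟩
      · rw [map_add, htu, map_smul, trace_trace]
      · have h1 := hlin N hN u _ hu (smul_mem_I (-(κ * (N + 1))⁻¹) (Hom_le_I hp'))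
        have h2 : κ • (coord (atRest 1 s) (Sum.inl 0) * Dx ((-(κ * (N + 1))⁻¹) • trace p)
            + (-(κ * (N + 1))⁻¹) • trace p) = - trace p := by
          rw [Derivation.map_smul, mul_smul_comm, heul, smul_smul, ← add_smul, smul_smul]
          have : κ * (-(κ * ((N : ℝ) + 1))⁻¹ * N + -(κ * (N + 1))⁻¹) = -1 := by
            have : (N : ℝ) + 1 ≠ 0 := by positivity
            field_simp
            ring
          rw [this, neg_one_smul]
        rw [h2] at h1
        convert add_mem h1 hΦp' using 1
        ring)
  refine ⟨trace u, trace_trace u, ?_, ?_⟩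
  · have := trace_mem_I hu
    rwa [map_sub, hu₀] at this
  · rw [htr]
    refine trace_mem_Flat (mem_Flat.2 fun N => ?_)
    obtain ⟨w, -, huw, hw⟩ := hu' (N + 1)
    have h1 := hcont N w (u - w) huw
    rw [add_sub_cancel] at h1
    have := add_mem h1 (I_anti (by omega) hw)
    rwa [sub_add_cancel] at this

end Plane

/-! ### Solution of the equations in the variables (x, z). -/

section PlaneEquations

/-- The factor of `z` in the eikonal equation in the variables `(x, z)`. -/
def planeEik (V₁ g : Pl) : Pl := Dx g + 2 * (1 - 2 * V₁) * Dz g + 4 * g * (Dz g * Dz g)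

/-- The linearization of `planeEik`. -/
def planeLin (V₁ g₀ g : Pl) : Pl :=
  Dx g + 2 * (1 - 2 * V₁) * Dz g + 8 * g₀ * Dz g₀ * Dz g + 4 * (Dz g₀ * Dz g₀) * g

/-- The terms with a factor `z` that involve the previous coefficients. -/
def planeRem (g : ℕ → Pl) (n : ℕ) : Pl :=
  4 * (∑ p ∈ Finset.range n, ∑ q ∈ Finset.range n, ∑ r ∈ Finset.range n,
    if p + q + r = n then g p * (Dz (g q) * Dz (g r)) else 0) - 4 * Dz (Dz (g (n - 1)))

/-- The derivative along the characteristic direction at `z = 0`. -/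
def charDer (g : Pl) : Pl := Dx g + 2 * Dz g

/-- The eikonal (`n = 0`) and transport (`n ≥ 1`) expressions in the variables `(x, z)`. -/
def planeEq (V₁ : Pl) (g : ℕ → Pl) (n : ℕ) : Pl :=
  if n = 0 then Zc * planeEik V₁ (g 0)
  else Zc * (planeLin V₁ (g 0) (g n) + planeRem g n) - charDer (g (n - 1))

theorem planeRem_congr {g g' : ℕ → Pl} {n : ℕ} (hn : n ≠ 0) (h : ∀ k < n, g k = g' k) :
    planeRem g n = planeRem g' n := by
  unfold planeRem
  rw [h (n - 1) (by omega)]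
  congr 2
  refine Finset.sum_congr rfl fun p hp => Finset.sum_congr rfl fun q hq =>
    Finset.sum_congr rfl fun r hr => ?_
  rw [h p (Finset.mem_range.1 hp), h q (Finset.mem_range.1 hq), h r (Finset.mem_range.1 hr)]

theorem D_two_mul {ι : Type} [Fintype ι] [DecidableEq ι] (i : ι) (u : Sm ι) :
    D i (2 * u) = 2 * D i u := by
  rw [two_mul, map_add, two_mul]

variable {s : EuclideanSpace ℝ (Fin 1)} {V₁ : Pl} {η : ℝ}

/-- The function `x - s`. -/
abbrev xc (s : EuclideanSpace ℝ (Fin 1)) : Pl := coord (atRest 1 s) (Sum.inl 0)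

theorem Dx_xc : Dx (xc s) = 1 := by simp [D_coord]

theorem Dz_xc : Dz (xc s) = 0 := by simp [D_coord]

theorem trace_xc : trace (xc s) = xc s := by
  ext X
  simp [trace, Sm.toMap, atRest]

theorem Dz_eq_zero_of_trace {y : Pl} (hy : trace y = y) : Dz y = 0 := by
  rw [← hy, Dz_trace]

theorem trace_Dx_of_trace {y : Pl} (hy : trace y = y) : trace (Dx y) = Dx y := by
  rw [← Dx_trace, hy]

/-- Setting γ = -y'/2 in the eikonal factor on z = 0 leaves y'(yy' + 2V₁) = 0. The second factor is
solved here: its linearization at η(x - s) is η((x - s)∂_x + 1), invertible in every degree. -/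
theorem exists_axis_solution (hV₁ : trace V₁ = V₁) (hη : η ≠ 0)
    (hV₁x : 2 * V₁ + algebraMap ℝ Pl (η * η) * xc s ∈ I (atRest 1 s) 2) :
    ∃ y, trace y = y ∧ y - algebraMap ℝ Pl η * xc s ∈ I (atRest 1 s) 2 ∧
      y * Dx y + 2 * V₁ ∈ Flat (atRest 1 s) := by
  have hu₀ : trace (algebraMap ℝ Pl η * xc s) = algebraMap ℝ Pl η * xc s := by
    rw [map_mul, AlgHom.commutes, trace_xc]
  have hDu : Dx (algebraMap ℝ Pl η * xc s) = algebraMap ℝ Pl η := by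
    rw [D_mul, Dx_xc, Derivation.map_algebraMap, mul_one, mul_zero, add_zero]
  refine exists_trace_solution (s := s) (fun y => y * Dx y + 2 * V₁) 2 hu₀ ?_ hη ?_ ?_ ?_
  · convert hV₁x using 1
    rw [hDu, map_mul]
    ring
  · intro u
    have : trace (2 : Pl) = 2 := map_ofNat _ 2
    simp only [map_add, map_mul, Dx_trace, hV₁, this]
  · intro N hN u q hu hq
    have h1 : (u + q) * Dx (u + q) + 2 * V₁ - (u * Dx u + 2 * V₁)
        - η • (xc s * Dx q + q) = (u - algebraMap ℝ Pl η * xc s) * Dx q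
          + q * Dx (u - algebraMap ℝ Pl η * xc s) + q * Dx q := by
      rw [map_sub, hDu, map_add, Algebra.smul_def]
      ring
    rw [h1]
    refine add_mem (add_mem ?_ ?_) ?_
    · exact mul_mem_I hu (D_mem_I hq le_rfl _) (by omega)
    · exact mul_mem_I hq (D_mem_I hu le_rfl _) (by omega)
    · exact mul_mem_I hq (D_mem_I hq le_rfl _) (by omega)
  · intro N u q hq
    have h1 : (u + q) * Dx (u + q) + 2 * V₁ - (u * Dx u + 2 * V₁)
        = (u + q) * Dx q + q * Dx u := by
      rw [map_add]; ring
    rw [h1]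
    exact add_mem (Ideal.mul_mem_left _ _ (D_mem_I hq (by omega) _))
      (Ideal.mul_mem_right _ _ (I_anti (by omega) hq))

/-- To leading order -2V₁ = η²(x - s) and y₀' = η, so the operator is η²((x - s)∂_x + 1). -/
theorem exists_axis_transport (hV₁ : trace V₁ = V₁) (hη : η ≠ 0)
    (hV₁x : 2 * V₁ + algebraMap ℝ Pl (η * η) * xc s ∈ I (atRest 1 s) 2) {y₀ : Pl}
    (hy₀ : trace y₀ = y₀) (hy₀x : y₀ - algebraMap ℝ Pl η * xc s ∈ I (atRest 1 s) 2) {m : Pl}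
    (hm : trace m = m) :
    ∃ y, trace y = y ∧ -(2 * V₁) * Dx y + Dx y₀ * Dx y₀ * y + m ∈ Flat (atRest 1 s) := by
  have hDu : Dx (algebraMap ℝ Pl η * xc s) = algebraMap ℝ Pl η := by
    rw [D_mul, Dx_xc, Derivation.map_algebraMap, mul_one, mul_zero, add_zero]
  obtain ⟨y, hy, -, hy'⟩ := exists_trace_solution (s := s)
    (fun y => -(2 * V₁) * Dx y + Dx y₀ * Dx y₀ * y + m) 0 (map_zero trace) (mem_I_zero _)
    (mul_ne_zero hη hη) (by
      intro u
      have : trace (2 : Pl) = 2 := map_ofNat _ 2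
      simp only [map_add, map_mul, map_neg, Dx_trace, hV₁, this, hm, trace_Dx_of_trace hy₀]) (by
      intro N _ u q _ hq
      have h1 : -(2 * V₁) * Dx (u + q) + Dx y₀ * Dx y₀ * (u + q) + m
          - (-(2 * V₁) * Dx u + Dx y₀ * Dx y₀ * u + m) - (η * η) • (xc s * Dx q + q)
          = -((2 * V₁ + algebraMap ℝ Pl (η * η) * xc s) * Dx q)
            + (Dx y₀ + algebraMap ℝ Pl η) * Dx (y₀ - algebraMap ℝ Pl η * xc s) * q := by
        rw [map_sub, hDu, map_add, Algebra.smul_def, map_mul]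
        ring
      rw [h1]
      refine add_mem (neg_mem (mul_mem_I hV₁x (D_mem_I hq le_rfl _) (by omega))) ?_
      exact mul_mem_I (m := 1) (Ideal.mul_mem_left _ _ (D_mem_I hy₀x (by omega) _)) hq (by omega))
    (by
      intro N u q hq
      have h1 : -(2 * V₁) * Dx (u + q) + Dx y₀ * Dx y₀ * (u + q) + m
          - (-(2 * V₁) * Dx u + Dx y₀ * Dx y₀ * u + m)
          = -(2 * V₁) * Dx q + Dx y₀ * Dx y₀ * q := by
        rw [map_add]; ring
      rw [h1]
      exact add_mem (Ideal.mul_mem_left _ _ (D_mem_I hq (by omega) _))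
        (Ideal.mul_mem_left _ _ (I_anti (by omega) hq)))
  exact ⟨y, hy, hy'⟩

/-- After division by z the equation is transverse to the axis, so the trace can be prescribed. The
slope -η/2 in z is the one that makes the first-order expression vanish at s. -/
theorem exists_planeEik_solution (hV₁S : V₁ ∈ I (atRest 1 s) 1) {y₀ : Pl}
    (hy₀ : trace y₀ = y₀) (hy₀x : y₀ - algebraMap ℝ Pl η * xc s ∈ I (atRest 1 s) 2) :
    ∃ g, trace g = y₀ ∧ g - (y₀ - algebraMap ℝ Pl (η / 2) * Zc) ∈ I (atRest 1 s) 2 ∧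
      Zc * planeEik V₁ g ∈ Flat (atRest 1 s) := by
  set u₀ := y₀ - algebraMap ℝ Pl (η / 2) * Zc with hu₀
  have hDu : Dx (algebraMap ℝ Pl η * xc s) = algebraMap ℝ Pl η := by
    rw [D_mul, Dx_xc, Derivation.map_algebraMap, mul_one, mul_zero, add_zero]
  have hy₀1 : y₀ ∈ I (atRest 1 s) 1 := by
    have := add_mem (I_anti (m := 1) (by omega) hy₀x)
      (Ideal.mul_mem_left _ (algebraMap ℝ Pl η) (coord_mem_I (s := atRest 1 s) (Sum.inl 0)))
    rwa [sub_add_cancel] at this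
  have hu₀1 : u₀ ∈ I (atRest 1 s) 1 := sub_mem hy₀1 (Ideal.mul_mem_left _ _ Zc_mem_I)
  have hDzu : Dz u₀ = -algebraMap ℝ Pl (η / 2) := by
    rw [hu₀, map_sub, Dz_eq_zero_of_trace hy₀, D_mul, Dz_Zc, Derivation.map_algebraMap]
    ring
  have hDxu : Dx u₀ = Dx y₀ := by
    rw [hu₀, map_sub, D_mul, Dx_Zc, Derivation.map_algebraMap]
    ring
  refine exists_solution_with_trace (s := s) (fun g => Zc * planeEik V₁ g) 2 (y := y₀) ?_ ?_ ?_
    ?_ ?_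
  · rw [hu₀, map_sub, map_mul, trace_Zc, mul_zero, sub_zero, hy₀]
  · refine mul_mem_I Zc_mem_I (n := 1) ?_ le_rfl
    have h1 : planeEik V₁ u₀ = Dx (y₀ - algebraMap ℝ Pl η * xc s)
        + (4 * algebraMap ℝ Pl (η / 2)) * V₁
        + 4 * (algebraMap ℝ Pl (η / 2) * algebraMap ℝ Pl (η / 2)) * u₀ := by
      have h2 : algebraMap ℝ Pl η = 2 * algebraMap ℝ Pl (η / 2) := by
        rw [← map_ofNat (algebraMap ℝ Pl) 2, ← map_mul]
        congr 1
        ring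
      rw [planeEik, hDzu, hDxu, map_sub, hDu, h2]
      ring
    rw [h1]
    exact add_mem (add_mem (D_mem_I hy₀x (by omega) _) (Ideal.mul_mem_left _ _ hV₁S))
      (Ideal.mul_mem_left _ _ hu₀1)
  · intro u _
    rw [map_mul, trace_Zc, zero_mul]
    exact zero_mem _
  · intro N hN u q hu hq
    have hu1 : u ∈ I (atRest 1 s) 1 := by
      have := add_mem (I_anti (m := 1) (by omega) hu) hu₀1
      rwa [sub_add_cancel] at this
    have h1 : Zc * planeEik V₁ (u + q) - Zc * planeEik V₁ u - Zc * (Dx q + 2 * Dz q)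
        = Zc * (-4 * (V₁ * Dz q) + 4 * ((Dz u + Dz q) * (Dz u + Dz q)) * q
          + 4 * (2 * Dz u + Dz q) * (u * Dz q)) := by
      simp only [planeEik, map_add]
      ring
    rw [h1]
    refine mul_mem_I (n := N) Zc_mem_I (add_mem (add_mem ?_ ?_) ?_) (by omega)
    · exact Ideal.mul_mem_left _ _ (mul_mem_I hV₁S (D_mem_I hq le_rfl _) (by omega))
    · exact Ideal.mul_mem_left _ _ hq
    · exact Ideal.mul_mem_left _ _ (mul_mem_I hu1 (D_mem_I hq le_rfl _) (by omega))
  · intro N u q hq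
    have hx := D_mem_I (m := N) hq (by omega) (Sum.inl 0)
    have hz := D_mem_I (m := N) hq (by omega) (Sum.inr 0)
    have h1 : Zc * planeEik V₁ (u + q) - Zc * planeEik V₁ u
        = Zc * Dx q + Zc * (2 * (1 - 2 * V₁) + 4 * u * (2 * Dz u + Dz q)) * Dz q
          + Zc * (4 * ((Dz u + Dz q) * (Dz u + Dz q))) * q := by
      simp only [planeEik, map_add]
      ring
    rw [h1]
    exact add_mem (add_mem (Ideal.mul_mem_left _ _ hx) (Ideal.mul_mem_left _ _ hz))
      (Ideal.mul_mem_left _ _ (I_anti (by omega) hq))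

/-- Compatibility at order h. On the axis the eikonal factor is, modulo y₀y₀' + 2V₁, the product of
y₀' + 2γ with a function equal to 1 at s, where γ is the trace of ∂_z g; that second function can be
cancelled. -/
theorem charDer_mem_Flat_of_planeEik (hV₁ : trace V₁ = V₁) (hV₁S : V₁ ∈ I (atRest 1 s) 1)
    {y₀ g : Pl} (hy₀S : y₀ ∈ I (atRest 1 s) 1)
    (hy₀' : y₀ * Dx y₀ + 2 * V₁ ∈ Flat (atRest 1 s)) (hg : trace g = y₀)
    (h : Zc * planeEik V₁ g ∈ Flat (atRest 1 s)) : trace (charDer g) ∈ Flat (atRest 1 s) := by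
  have hx : trace (Dx g) = Dx y₀ := by rw [← Dx_trace, hg]
  have h2 : trace (2 : Pl) = 2 := map_ofNat _ 2
  have h4 : trace (4 : Pl) = 4 := map_ofNat _ 4
  have h1 := trace_mem_Flat (D_mem_Flat h (Sum.inr 0))
  rw [D_mul, Dz_Zc, mul_one, map_add, map_mul, trace_Zc, zero_mul, zero_add, planeEik] at h1
  simp only [map_add, map_mul, map_sub, map_one, h2, h4, hV₁, hg, hx] at h1
  rw [charDer, map_add, map_mul, h2, hx]
  set γ := trace (Dz g)
  refine mem_Flat_of_mul_mem (a := 1 + 2 * V₁ + y₀ * (Dx y₀ + 2 * γ)) ?_ ?_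
  · have e1 := mem_I_one.1 hV₁S
    have e2 := mem_I_one.1 hy₀S
    rw [map_add, map_add, map_mul, map_mul, e1, e2]
    simp
  · have : (1 + 2 * V₁ + y₀ * (Dx y₀ + 2 * γ)) * (Dx y₀ + 2 * γ)
        = (Dx y₀ + 2 * (1 - 2 * V₁) * γ + 4 * y₀ * (γ * γ))
          + (Dx y₀ + 4 * γ) * (y₀ * Dx y₀ + 2 * V₁) := by ring
    rw [this]
    exact add_mem h1 (Ideal.mul_mem_left _ _ hy₀')

/-- The z-derivative of the equation on the axis relates γ, the trace of ∂_z g, to y, the trace of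
g. Choosing y to solve the axis transport equation with source M - ∂_zρ makes this relation say (1 +
2V₁)(y' + 2γ) ∈ Flat, which is the compatibility condition for the following order. -/
theorem exists_planeLin_solution (hV₁ : trace V₁ = V₁) (hV₁S : V₁ ∈ I (atRest 1 s) 1)
    (hη : η ≠ 0) (hV₁x : 2 * V₁ + algebraMap ℝ Pl (η * η) * xc s ∈ I (atRest 1 s) 2) {y₀ : Pl}
    (hy₀ : trace y₀ = y₀) (hy₀x : y₀ - algebraMap ℝ Pl η * xc s ∈ I (atRest 1 s) 2)
    (hy₀' : y₀ * Dx y₀ + 2 * V₁ ∈ Flat (atRest 1 s)) {g₀ : Pl} (hg₀ : trace g₀ = y₀)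
    (hg₀S : g₀ ∈ I (atRest 1 s) 1) (hc₀ : trace (charDer g₀) ∈ Flat (atRest 1 s)) (M : Pl) {ρ : Pl}
    (hρ : trace ρ ∈ Flat (atRest 1 s)) :
    ∃ g, Zc * (planeLin V₁ g₀ g + M) - ρ ∈ Flat (atRest 1 s) ∧
      trace (charDer g) ∈ Flat (atRest 1 s) := by
  have h2 : trace (2 : Pl) = 2 := map_ofNat _ 2
  have h4 : trace (4 : Pl) = 4 := map_ofNat _ 4
  have h8 : trace (8 : Pl) = 8 := map_ofNat _ 8
  obtain ⟨y, hy, hyF⟩ := exists_axis_transport hV₁ hη hV₁x hy₀ hy₀x (m := trace (M - Dz ρ))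
    (trace_trace _)
  obtain ⟨g, hg, -, hgF⟩ := exists_solution_with_trace (s := s)
    (fun g => Zc * (planeLin V₁ g₀ g + M) - ρ) 0 hy (mem_I_zero _) (by
      intro u _
      rw [map_sub, map_mul, trace_Zc, zero_mul, zero_sub]
      exact neg_mem hρ) (by
      intro N _ u q _ hq
      have h1 : Zc * (planeLin V₁ g₀ (u + q) + M) - ρ - (Zc * (planeLin V₁ g₀ u + M) - ρ)
          - Zc * (Dx q + 2 * Dz q)
          = Zc * (-4 * V₁ + 8 * Dz g₀ * g₀) * Dz q + Zc * (4 * (Dz g₀ * Dz g₀) * q) := by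
        simp only [planeLin, map_add]
        ring
      rw [h1]
      refine add_mem ?_ ?_
      · refine mul_mem_I (m := 2) ?_ (D_mem_I hq le_rfl _) (by omega)
        exact mul_mem_I Zc_mem_I (n := 1) (add_mem (Ideal.mul_mem_left _ _ hV₁S)
          (Ideal.mul_mem_left _ _ hg₀S)) le_rfl
      · exact mul_mem_I Zc_mem_I (Ideal.mul_mem_left _ _ hq) (by omega)) (by
      intro N u q hq
      have hx := D_mem_I (m := N) hq (by omega) (Sum.inl 0)
      have hz := D_mem_I (m := N) hq (by omega) (Sum.inr 0)
      have h1 : Zc * (planeLin V₁ g₀ (u + q) + M) - ρ - (Zc * (planeLin V₁ g₀ u + M) - ρ)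
          = Zc * Dx q + Zc * (2 * (1 - 2 * V₁) + 8 * g₀ * Dz g₀) * Dz q
            + Zc * (4 * (Dz g₀ * Dz g₀)) * q := by
        simp only [planeLin, map_add]
        ring
      rw [h1]
      exact add_mem (add_mem (Ideal.mul_mem_left _ _ hx) (Ideal.mul_mem_left _ _ hz))
        (Ideal.mul_mem_left _ _ (I_anti (by omega) hq)))
  refine ⟨g, hgF, ?_⟩
  have hx : trace (Dx g) = Dx y := by rw [← Dx_trace, hg]
  have hx₀ : trace (Dx g₀) = Dx y₀ := by rw [← Dx_trace, hg₀]
  have h1 := trace_mem_Flat (D_mem_Flat hgF (Sum.inr 0))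
  rw [map_sub, D_mul, Dz_Zc, mul_one, map_sub, map_add, map_mul, trace_Zc, zero_mul, zero_add,
    planeLin] at h1
  simp only [map_add, map_mul, map_sub, map_one, h2, h4, h8, hV₁, hg, hx, hg₀] at h1
  rw [charDer, map_add, map_mul, h2, hx₀] at hc₀
  rw [charDer, map_add, map_mul, h2, hx]
  rw [map_sub] at hyF
  set γ := trace (Dz g)
  set γ₀ := trace (Dz g₀)
  refine mem_Flat_of_mul_mem (a := 1 + 2 * V₁) ?_ ?_
  · rw [map_add, map_mul, mem_I_one.1 hV₁S]
    simp
  · have : (1 + 2 * V₁) * (Dx y + 2 * γ)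
        = (Dx y + 2 * (1 - 2 * V₁) * γ + 8 * y₀ * γ₀ * γ + 4 * (γ₀ * γ₀) * y + trace M
            - trace (Dz ρ))
          - (-(2 * V₁) * Dx y + Dx y₀ * Dx y₀ * y + (trace M - trace (Dz ρ)))
          + 4 * γ * (y₀ * Dx y₀ + 2 * V₁)
          + ((Dx y₀ - 2 * γ₀) * y - 4 * γ * y₀) * (Dx y₀ + 2 * γ₀) := by ring
    rw [this]
    exact add_mem (add_mem (sub_mem h1 hyF) (Ideal.mul_mem_left _ _ hy₀'))
      (Ideal.mul_mem_left _ _ hc₀)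

/-- The recursion carries, besides the n-th equation, the flatness of (∂_x + 2∂_z)g_n on z = 0,
without which equation n + 1 would not be divisible by z. -/
theorem exists_plane_solution (hV₁ : trace V₁ = V₁) (hη : η ≠ 0)
    (hV₁x : 2 * V₁ + algebraMap ℝ Pl (η * η) * xc s ∈ I (atRest 1 s) 2) :
    ∃ g : ℕ → Pl, g 0 - (algebraMap ℝ Pl η * xc s - algebraMap ℝ Pl (η / 2) * Zc)
        ∈ I (atRest 1 s) 2 ∧ ∀ n, planeEq V₁ g n ∈ Flat (atRest 1 s) := by
  have hV₁S : V₁ ∈ I (atRest 1 s) 1 := by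
    have h1 := sub_mem (I_anti (m := 1) (by omega) hV₁x) (Ideal.mul_mem_left _
      (algebraMap ℝ Pl (η * η)) (coord_mem_I (s := atRest 1 s) (Sum.inl 0)))
    rw [add_sub_cancel_right] at h1
    refine mem_I_of_mul_mem ?_ h1
    rw [map_ofNat]
    norm_num
  obtain ⟨y₀, hy₀, hy₀x, hy₀'⟩ := exists_axis_solution hV₁ hη hV₁x
  have hy₀1 : y₀ ∈ I (atRest 1 s) 1 := by
    have := add_mem (I_anti (m := 1) (by omega) hy₀x)
      (Ideal.mul_mem_left _ (algebraMap ℝ Pl η) (coord_mem_I (s := atRest 1 s) (Sum.inl 0)))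
    rwa [sub_add_cancel] at this
  have : Inhabited Pl := ⟨0⟩
  obtain ⟨g, hg⟩ := exists_seq (fun n (g : ℕ → Pl) =>
    (trace (g 0) = y₀ ∧ g 0 - (y₀ - algebraMap ℝ Pl (η / 2) * Zc) ∈ I (atRest 1 s) 2) ∧
      planeEq V₁ g n ∈ Flat (atRest 1 s) ∧ trace (charDer (g n)) ∈ Flat (atRest 1 s)) (by
      rintro n g g' h ⟨h1, h2, h3⟩
      rw [h 0 (Nat.zero_le _)] at h1
      rw [h n le_rfl] at h3
      refine ⟨h1, ?_, h3⟩
      unfold planeEq at h2 ⊢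
      split_ifs at h2 ⊢ with hn
      · rwa [← h 0 (Nat.zero_le _)]
      · rwa [← h 0 (Nat.zero_le _), ← h n le_rfl, ← h (n - 1) (by omega),
          ← planeRem_congr hn (fun k hk => h k hk.le)]) (by
      intro n g hprev
      by_cases hn : n = 0
      · subst hn
        obtain ⟨u, hu, hu', huF⟩ := exists_planeEik_solution hV₁S hy₀ hy₀x
        refine ⟨u, by simpa using ⟨hu, hu'⟩, by simpa [planeEq] using huF, ?_⟩
        simpa using charDer_mem_Flat_of_planeEik hV₁ hV₁S hy₀1 hy₀' hu huF
      · obtain ⟨⟨h0, h0'⟩, -, h0c⟩ := hprev 0 (Nat.pos_of_ne_zero hn)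
        have hρ := (hprev (n - 1) (by omega)).2.2
        have hg₀S : g 0 ∈ I (atRest 1 s) 1 := by
          have := add_mem (I_anti (m := 1) (by omega) h0')
            (sub_mem hy₀1 (Ideal.mul_mem_left _ (algebraMap ℝ Pl (η / 2)) Zc_mem_I))
          rwa [sub_add_cancel] at this
        obtain ⟨u, hu, hu'⟩ := exists_planeLin_solution hV₁ hV₁S hη hV₁x hy₀ hy₀x hy₀' h0 hg₀S h0c
          (planeRem g n) hρ
        refine ⟨u, ?_, ?_, ?_⟩
        · rw [Function.update_of_ne (Ne.symm hn)]
          exact ⟨h0, h0'⟩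
        · unfold planeEq
          rw [if_neg hn, Function.update_of_ne (Ne.symm hn), Function.update_self,
            Function.update_of_ne (by omega),
            planeRem_congr (g' := g) hn (fun k hk => Function.update_of_ne hk.ne _ _)]
          exact hu
        · rwa [Function.update_self])
  refine ⟨g, ?_, fun n => (hg n).2.1⟩
  convert add_mem (hg 0).1.2 hy₀x using 1
  ring

end PlaneEquations

/-! ### Situation 2: coefficients with no linear part. -/

section NoLinearPart

variable {V : EuclideanSpace ℝ (Fin 1) → ℝ}

/-- The matrix `Σ = 1/2`. -/
abbrev halfMat : Matrix (Fin 1) (Fin 1) ℝ := (1 / 2 : ℝ) • (1 : Matrix (Fin 1) (Fin 1) ℝ)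

theorem halfMat_gram : halfMat.transpose * halfMat = (1 / 4 : ℝ) • (1 : Matrix (Fin 1) (Fin 1) ℝ) := by
  simp only [halfMat, Matrix.transpose_smul, Matrix.transpose_one, Matrix.smul_mul, Matrix.mul_smul,
    Matrix.one_mul, smul_smul]
  norm_num

theorem fric_halfMat : fric halfMat 1 0 = (1 / 4 : ℝ) • Zc := by
  rw [fric, Fin.sum_univ_one, halfMat_gram]
  simp

theorem alphaQuad_eq (h : ℝ) (X : Phase 1 1) :
    alphaQuad h X = ∑ j ∈ Finset.range 2, h ^ j • alphaQuadCoeff j X := by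
  ext i
  simp [Finset.sum_range_succ, alphaQuad, alphaQuadCoeff]
  ring

/-- The components of the coefficients `α^j`. -/
def quadSm : ℕ → Pl
  | 0 => Zc * Zc
  | 1 => -1
  | _ + 2 => 0

theorem alphaQuadCoeff_apply (j : ℕ) (X : Phase 1 1) (i : Fin 1) :
    alphaQuadCoeff j X i = (quadSm j).1 X := by
  rcases j with _ | _ | j
  · simp [alphaQuadCoeff, quadSm, sq]
  · simp [alphaQuadCoeff, quadSm]
  · rfl

theorem betaQuad_apply (hV : ContDiff ℝ ∞ V) (X : Phase 1 1) (i : Fin 1) :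
    betaQuad V X i = (-(2 * Zc * liftX (pd 0 V) (contDiff_pd hV 0)) : Pl).1 X := by
  have h2 : ((2 : Pl)).1 X = 2 := by
    rw [← map_ofNat (algebraMap ℝ Pl) 2, Sm.algebraMap_apply]
  simp [betaQuad, h2]

/-- The products of v² with V' cancel, and the term -h in α is exactly compensated by div_v β =
-2V'. -/
theorem skewRelation_quad (hV : ContDiff ℝ ∞ V) (h : ℝ) :
    SkewRelation halfMat V h (alphaQuad h) (betaQuad V) := by
  intro X
  have e1 : (fun Y => alphaQuad h Y 0) = (Zc * Zc - algebraMap ℝ Pl h).1 := by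
    ext Y
    simp [alphaQuad, sq]
  have e2 : (fun Y => betaQuad V Y 0)
      = ((-2 : ℝ) • (Zc * liftX (pd 0 V) (contDiff_pd hV 0)) : Pl).1 := by
    ext Y
    simp [betaQuad, mul_assoc]
  have e3 : frictionVec halfMat X 0 = 1 / 4 * X (Sum.inr 0) := by
    rw [← fric_apply, fric_halfMat]
    simp
  have e4 : pd (Sum.inl 0) (fun Y => alphaQuad h Y 0) X = 0 := by
    rw [e1, ← D_apply, map_sub, D_mul, Dx_Zc, Derivation.map_algebraMap]
    simp
  have e5 : pd (Sum.inr 0) (fun Y => betaQuad V Y 0) X = -2 * pd 0 V (xPart X) := by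
    rw [e2, ← D_apply, Derivation.map_smul, D_mul, Dz_Zc, D_inr_liftX]
    simp
  simp only [divXV, Fin.sum_univ_one, e3, e4, e5]
  simp only [alphaQuad, betaQuad]
  ring

theorem gradV_plane (u w : Pl) : gradV u w = Dz u * Dz w := by
  rw [gradV, Fin.sum_univ_one]

theorem lapSm_sqv (u : Pl) :
    lapSm (sqv u) = 2 * sqv (Dz u) + 4 * (Zc * Zc) * sqv (Dz (Dz u)) := by
  rw [lapSm, Fin.sum_univ_one, Dz_sqv, D_mul, D_two_mul, Dz_Zc, Dz_sqv]
  ring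

/-- The coefficients of the equations in dimension `1 + 1`. -/
def quadCoeff (V₁ : Pl) : ℕ → Fin 1 ⊕ Fin 1 → Pl
  | 0 => Sum.elim (fun _ => Zc * Zc) (fun _ => -(2 * Zc * V₁))
  | 1 => Sum.elim (fun _ => -1) (fun _ => 0)
  | _ + 2 => fun _ => 0

theorem vecDot_drift_quad (V₁ u : Pl) :
    vecDot (drift halfMat (quadCoeff V₁)) u = Zc * Zc * Dx u + (Zc - 2 * Zc * V₁) * Dz u := by
  have h : (4 : ℝ) • fric halfMat 1 0 = Zc := by
    rw [fric_halfMat, smul_smul]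
    norm_num
  rw [vecDot_eq, Fintype.sum_sum_type, Fin.sum_univ_one, Fin.sum_univ_one]
  simp only [drift, Sum.elim_inl, Sum.elim_inr, quadCoeff, h]
  ring

theorem remSm_sqv (V₁ : Pl) (g : ℕ → Pl) {n : ℕ} (hn : n ≠ 0) :
    remSm (quadCoeff V₁) (fun j => sqv (g j)) n
      = sqv (Zc * planeRem g n - charDer (g (n - 1))) := by
  obtain ⟨m, rfl⟩ : ∃ m, n = m + 1 := ⟨n - 1, by omega⟩
  have h1 : ∑ k ∈ Finset.range (m + 1), vecDot (quadCoeff V₁ (m + 1 - k)) (sqv (g k))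
      = -sqv (Dx (g m)) := by
    rw [Finset.sum_range_succ, Finset.sum_eq_zero, zero_add, Nat.add_sub_cancel_left, vecDot_eq,
      Fintype.sum_sum_type, Fin.sum_univ_one, Fin.sum_univ_one, Dx_sqv]
    · simp [quadCoeff]
    · intro k hk
      rw [Finset.mem_range] at hk
      obtain ⟨j, hj⟩ : ∃ j, m + 1 - k = j + 2 := ⟨m - 1 - k, by omega⟩
      rw [hj, vecDot_eq]
      simp [quadCoeff]
  have h2 : ∀ p q r : ℕ, (if p + q + r = m + 1 then
        sqv (g p) * gradV (sqv (g q)) (sqv (g r)) else 0)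
      = 4 * (Zc * Zc) * sqv (if p + q + r = m + 1 then g p * (Dz (g q) * Dz (g r)) else 0) := by
    intro p q r
    split_ifs
    · rw [gradV_plane, Dz_sqv, Dz_sqv, map_mul, map_mul]
      ring
    · rw [map_zero, mul_zero]
  have s2 : sqv (2 : Pl) = 2 := map_ofNat _ 2
  have s4 : sqv (4 : Pl) = 4 := map_ofNat _ 4
  rw [remSm, h1]
  simp only [h2, ← Finset.mul_sum, ← map_sum]
  rw [lapSm_sqv, planeRem, charDer, Nat.add_sub_cancel]
  simp only [map_sub, map_add, map_mul, sqv_Zc, s2, s4]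
  ring

/-- For functions of (x, v²) one has ∂_v = 2v∂_z, so every first-order term carries a factor v² = z
except the contribution -∂_x of α¹ and the part 2∂_z of Δ_v; these two form the source (∂_x +
2∂_z)g_{n-1}. -/
theorem wkbSm_sqv {V₁ : Pl} (hV₁ : sqv V₁ = V₁) (g : ℕ → Pl) (n : ℕ) :
    wkbSm halfMat (quadCoeff V₁) (fun j => sqv (g j)) n = sqv (planeEq V₁ g n) := by
  have s2 : sqv (2 : Pl) = 2 := map_ofNat _ 2
  have s4 : sqv (4 : Pl) = 4 := map_ofNat _ 4
  have s8 : sqv (8 : Pl) = 8 := map_ofNat _ 8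
  unfold wkbSm planeEq
  split_ifs with hn
  · rw [eikSm, vecDot_drift_quad, gradV_plane, Dx_sqv, Dz_sqv, planeEik]
    simp only [map_sub, map_add, map_mul, sqv_Zc, s2, s4, hV₁, map_one]
    ring
  · rw [remSm_sqv _ _ hn, linSm, vecDot_drift_quad, gradV_plane, gradV_plane, Dx_sqv, Dz_sqv,
      Dz_sqv, planeLin]
    simp only [map_sub, map_add, map_mul, sqv_Zc, s2, s4, s8, hV₁, map_one]
    ring

theorem wkb_noLinearPart (hV : ContDiff ℝ ∞ V) {s : EuclideanSpace ℝ (Fin 1)}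
    (hs : IsSaddle V s) :
    WKBConclusion halfMat V alphaQuad (fun _ => betaQuad V) alphaQuadCoeff
      (constCoeff (betaQuad V)) s := by
  have hSg : IsUnit halfMat.det := by
    simp [halfMat]
  have hα : HasClassicalExpansion Set.univ 1 alphaQuad alphaQuadCoeff := by
    have h := hasClassicalExpansion_of_finite (c := alphaQuadCoeff) (h₀ := 1)
      (fun j => contDiff_of_sm (fun _ => quadSm j) (alphaQuadCoeff_apply j)) 2 (fun j hj => by
        obtain ⟨k, rfl⟩ : ∃ k, j = k + 2 := ⟨j - 2, by omega⟩
        rfl)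
    convert h using 3
    exact alphaQuad_eq _ _
  have hβ := hasClassicalExpansion_const (contDiff_of_sm _ (betaQuad_apply hV)) (h₀ := 1)
  have hskew : ∀ h ∈ Set.Ioc (0 : ℝ) 1, SkewRelation halfMat V h (alphaQuad h) (betaQuad V) :=
    fun h _ => skewRelation_quad hV h
  have hαs := hα.smooth_coeff
  have hβs := hβ.smooth_coeff
  set V₁ : Pl := liftX (pd 0 V) (contDiff_pd hV 0) with hV₁
  have hcoeff : coeffSm hαs hβs = quadCoeff V₁ := by
    ext j i X
    rcases i with i | i
    · refine (alphaQuadCoeff_apply j X i).trans ?_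
      rcases j with _ | _ | j <;> rfl
    · rcases j with _ | _ | j
      · exact betaQuad_apply hV X i
      · rfl
      · rfl
  set H := hess V s 0 0 with hH
  have hHneg : H < 0 := by
    have := (saddle_energy (d' := 1) hSg hV hs).2
    rwa [Matrix.det_fin_one] at this
  have hH0 : H ≠ 0 := hHneg.ne
  -- The linear part of yy' = -2V' imposes η² = -2V''(s), which is positive since a saddle in
  -- dimension one is a maximum.
  set η := Real.sqrt (-2 * H) with hη
  have hηη : η * η = -2 * H := Real.mul_self_sqrt (by linarith)
  have hη0 : η ≠ 0 := by
    intro h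
    rw [h] at hηη
    linarith
  have hV₁x : 2 * V₁ + algebraMap ℝ Pl (η * η) * xc s ∈ I (atRest 1 s) 2 := by
    have hval : V₁.1 (atRest 1 s) = 0 := hs.1 0
    refine mem_I_succ.2 ⟨?_, fun i => mem_I_one.2 ?_⟩
    · rw [map_add, map_mul, map_mul, ev_apply (u := V₁), hval, ev_apply (u := xc s)]
      simp
    · rw [map_add, D_two_mul, D_mul, Derivation.map_algebraMap, mul_zero, add_zero]
      rcases i with i | i <;> rw [Subsingleton.elim i 0]
      · rw [Dx_xc, hV₁, D_inl_liftX, mul_one, map_add, map_mul, map_ofNat, ev_apply, ev_apply,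
          Sm.algebraMap_apply, liftX_apply, xPart_atRest, hηη]
        have : pd 0 (pd 0 V) s = H := rfl
        rw [this]
        ring
      · rw [Dz_xc, hV₁, D_inr_liftX]
        simp
  obtain ⟨g, hg0, hg⟩ := exists_plane_solution (trace_liftX _) hη0 hV₁x
  have hval : (g 0).1 (atRest 1 s) = 0 := by
    have h1 := mem_I_one.1 (I_anti (m := 1) (by omega) hg0)
    simpa [atRest] using h1
  have hDx : (Dx (g 0)).1 (atRest 1 s) = η := by
    have h1 := mem_I_one.1 (D_mem_I (m := 1) hg0 (by omega) (Sum.inl 0))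
    simp only [map_sub, D_mul, Dx_xc, Dx_Zc, Derivation.map_algebraMap, mul_zero, add_zero,
      mul_one, sub_zero, ev_apply, Sm.algebraMap_apply] at h1
    linarith
  have hDz : (Dz (g 0)).1 (atRest 1 s) = -(η / 2) := by
    have h1 := mem_I_one.1 (D_mem_I (m := 1) hg0 (by omega) (Sum.inr 0))
    simp only [map_sub, D_mul, Dz_xc, Dz_Zc, Derivation.map_algebraMap, mul_zero, add_zero,
      mul_one, ev_apply, zero_sub, sub_neg_eq_add] at h1
    rw [Sm.add_apply, Sm.algebraMap_apply] at h1
    linarith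
  have hsq : Sm.toMap (Sum.elim (fun _ => Xc) (fun _ => Zc * Zc)) (atRest 1 s)
      = atRest 1 s := phase_ext (by simp [Sm.toMap]) (by simp [Sm.toMap, atRest])
  have hsqv : ∀ u : Pl, (sqv u).1 (atRest 1 s) = u.1 (atRest 1 s) := fun u => by
    rw [sqv, pull_apply, hsq]
  have hZS : (Zc : Pl).1 (atRest 1 s) = 0 := by simp [atRest]
  have htwo : ∀ X, ((2 : Pl)).1 X = 2 := fun X => by
    rw [← map_ofNat (algebraMap ℝ Pl) 2, Sm.algebraMap_apply]
  have hflat : ∀ n, wkbSm halfMat (coeffSm hαs hβs) (fun j => sqv (g j)) n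
      ∈ Flat (atRest 1 s) := by
    intro n
    rw [hcoeff, wkbSm_sqv (sqv_liftX _)]
    exact sqv_mem_Flat (hg n)
  have hgrad : (Sum.elim (fun _ => η) (fun _ => 0) : Fin 1 ⊕ Fin 1 → ℝ)
      = fun i => pd i (sqv (g 0)).1 (atRest 1 s) := by
    ext i
    rw [← D_apply]
    rcases i with i | i <;> rw [Subsingleton.elim i 0]
    · rw [Dx_sqv, hsqv, hDx]; rfl
    · rw [Dz_sqv, Sm.mul_apply, Sm.mul_apply, hZS]; simp
  have hmul : (hess (en halfMat hV).1 (atRest 1 s)).mulVec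
      (Sum.elim (fun _ => η / H) (fun _ => 0)) = Sum.elim (fun _ => η) (fun _ => 0) := by
    rw [hess_energy, Matrix.fromBlocks_mulVec]
    ext i
    rcases i with i | i
    · rw [Subsingleton.elim i 0]
      have : hess V s 0 0 = H := rfl
      simp [Matrix.mulVec, dotProduct, this]
      field_simp
    · simp [Matrix.mulVec, dotProduct]
  have hdot : (Sum.elim (fun _ => η / H) (fun _ => 0) : Fin 1 ⊕ Fin 1 → ℝ) ⬝ᵥ
      Sum.elim (fun _ => η) (fun _ => 0) = -2 := by
    simp only [dotProduct, Fintype.sum_sum_type, Fin.sum_univ_one, Sum.elim_inl, Sum.elim_inr,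
      mul_zero, add_zero]
    rw [div_mul_eq_mul_div, hηη]
    field_simp
  refine WKBConclusion.of_formal hSg hV hs one_pos hα hβ hskew hαs hβs (fun j => sqv (g j))
    ((hsqv _).trans hval) hflat hgrad hmul hdot one_pos (Or.inr ?_)
  -- Here ∂_v f = v/2 and, to leading order, ∂_vℓ₀ = 2v∂_z g₀(s) = -ηv, so 4⟨A∇f, ∇f⟩ = η²v²
  -- requires the velocity entry η².
  set A : Matrix (Fin 1 ⊕ Fin 1) (Fin 1 ⊕ Fin 1) ℝ :=
    Matrix.diagonal (Sum.elim (fun _ => 0) (fun _ => η * η)) with hA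
  have hform : ∀ X, gradForm A (energy halfMat V) X
      = η * η * (1 / 4) * (X (Sum.inr 0) * X (Sum.inr 0)) := by
    intro X
    have e1 : pd (Sum.inr 0) (en halfMat hV).1 X = 1 / 2 * X (Sum.inr 0) := by
      rw [← D_apply, D_inr_en, fric_halfMat]
      simp
      ring
    rw [← en_eq _ hV, gradForm]
    simp only [Fintype.sum_sum_type, Fin.sum_univ_one, hA, e1, Matrix.diagonal_apply]
    simp
    ring
  refine ⟨A, ?_, ?_, ?_, ?_⟩
  · intro h
    have h1 := congrFun (congrFun h (Sum.inr 0)) (Sum.inr 0)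
    simp [hA, hη0] at h1
  · refine Matrix.PosSemidef.diagonal fun i => ?_
    rcases i with i | i
    · exact le_rfl
    · exact mul_self_nonneg η
  -- Exactly |∂_vℓ₀|² = 4v²(∂_z g₀)², hence 1 + ρ = 4(∂_z g₀)²/η², which is 1 at s as ∂_z g₀(s) =
  -- -η/2.
  · set ρ : Pl := algebraMap ℝ Pl (4 / (η * η)) * (sqv (Dz (g 0)) * sqv (Dz (g 0))) - 1 with hρ
    have hρI : ρ ∈ I (atRest 1 s) 1 := by
      refine mem_I_one.2 ?_
      rw [ev_apply, hρ, Sm.sub_apply, Sm.mul_apply, Sm.mul_apply, hsqv, hDz, Sm.algebraMap_apply,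
        Sm.one_apply]
      field_simp
      ring
    obtain ⟨C, -, hC⟩ := exists_bound_of_mem_I hρI 1
    refine ⟨ρ.1, ⟨C, fun X hX => by simpa using hC X hX.le⟩, fun X _ => ?_⟩
    rw [hform, ← gradV_apply, gradV_plane, Dz_sqv, hρ]
    simp only [Sm.mul_apply, Sm.sub_apply, Sm.algebraMap_apply, Sm.one_apply, htwo, coord_apply,
      PiLp.zero_apply, sub_zero]
    field_simp
    ring
  · intro h
    simp only [hform] at h
    rw [Metric.eventually_nhds_iff] at h
    obtain ⟨ε, hε, h⟩ := h
    have h1 := h (y := atRest 1 s + EuclideanSpace.single (Sum.inr 0) (ε / 2)) (by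
      rw [dist_eq_norm, add_sub_cancel_left, PiLp.norm_single, Real.norm_eq_abs,
        abs_of_pos (by positivity)]
      linarith)
    have h2 : (atRest 1 s + EuclideanSpace.single (Sum.inr 0) (ε / 2) : Phase 1 1) (Sum.inr 0)
        = ε / 2 := by
      simp [atRest]
    rw [h2] at h1
    have : 0 < η * η * (1 / 4) * (ε / 2 * (ε / 2)) := by
      have : 0 < η * η := mul_self_pos.2 hη0
      positivity
    linarith

end NoLinearPart

end KFP

end

theorem mainTheorem6 :
    -- Situation 1: partially degenerate coefficients
    (∀ (d d' : ℕ) (Sg : Matrix (Fin d') (Fin d') ℝ) (V : EuclideanSpace ℝ (Fin d) → ℝ) (h₀ : ℝ)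
      (α : ℝ → KFP.Phase d d' → EuclideanSpace ℝ (Fin d))
      (β : ℝ → KFP.Phase d d' → EuclideanSpace ℝ (Fin d'))
      (αc : ℕ → KFP.Phase d d' → EuclideanSpace ℝ (Fin d))
      (βc : ℕ → KFP.Phase d d' → EuclideanSpace ℝ (Fin d'))
      (s : EuclideanSpace ℝ (Fin d)) (M : Matrix (Fin d) (Fin d') ℝ)
      (Mβ : Matrix (Fin d') (Fin d) ℝ),
      IsUnit Sg.det → ContDiff ℝ ∞ V → KFP.IsSaddle V s → 0 < h₀ →
      KFP.HasClassicalExpansion Set.univ h₀ α αc →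
      KFP.HasClassicalExpansion Set.univ h₀ β βc →
      (∀ h ∈ Set.Ioc 0 h₀, KFP.SkewRelation Sg V h (α h) (β h)) →
      ((fun X => αc 0 X - WithLp.toLp 2 (M.mulVec (KFP.vPart X).ofLp))
        =o[nhds (KFP.atRest d' s)] fun X => X - KFP.atRest d' s) →
      ((fun X => βc 0 X - WithLp.toLp 2 (Mβ.mulVec (KFP.xPart X - s).ofLp))
        =o[nhds (KFP.atRest d' s)] fun X => X - KFP.atRest d' s) →
      KFP.IsSimpleSpectrum (KFP.Lam Sg (KFP.hess V s) M) →
      KFP.WKBConclusion Sg V α β αc βc s) ∧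
    -- Situation 2: coefficients with no linear part, in dimension `1 + 1`, with `Σ = 1/2`
    (∀ (V : EuclideanSpace ℝ (Fin 1) → ℝ) (s : EuclideanSpace ℝ (Fin 1)),
      ContDiff ℝ ∞ V → KFP.IsSaddle V s →
      KFP.WKBConclusion ((1 / 2 : ℝ) • (1 : Matrix (Fin 1) (Fin 1) ℝ)) V
        KFP.alphaQuad (fun _ => KFP.betaQuad V)
        KFP.alphaQuadCoeff (KFP.constCoeff (KFP.betaQuad V)) s) ∧
    -- Situation 3: added magnetic field, in dimension `3 + 3`
    (∀ (Sg : Matrix (Fin 3) (Fin 3) ℝ) (V : EuclideanSpace ℝ (Fin 3) → ℝ)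
      (b : EuclideanSpace ℝ (Fin 3) → EuclideanSpace ℝ (Fin 3)) (s : EuclideanSpace ℝ (Fin 3)),
      IsUnit Sg.det → ContDiff ℝ ∞ V → ContDiff ℝ ∞ b → KFP.IsSaddle V s →
      KFP.WKBConclusion Sg V
        (fun _ => KFP.alphaMag Sg) (fun _ => KFP.betaMag Sg V b)
        (KFP.constCoeff (KFP.alphaMag Sg)) (KFP.constCoeff (KFP.betaMag Sg V b)) s) := by
  refine ⟨?_, ?_, ?_⟩
  · intro d d' Sg V h₀ α β αc βc s M Mβ hSg hV hs hh₀ hα hβ hskew hM hMβ hΛ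
    exact KFP.wkb_partiallyDegenerate hSg hV hs hh₀ hα hβ hskew hM hMβ hΛ
  · intro V s hV hs
    exact KFP.wkb_noLinearPart hV hs
  · intro Sg V b s hSg hV hb hs
    exact KFP.wkb_magnetic hSg hV hb hs
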